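/- **Setting.** Let $N\in\mathbb N$, $\hbar\in\mathbb R\setminus\{0\}$ and $k\in\mathbb C$ with $\operatorname{Re}(k+N)\neq0$. Consider bosons $\hat\lambda_\mu(t)$ ($1\le\mu\le N$), $\hat b_{\mu,\nu}(t),\hat c_{\mu,\nu}(t)$ ($1\le\mu<\nu\le N$), $t\in\mathbb R\setminus\{0\}$, with $$[\hat\lambda_\mu(t),\hat\lambda_\mu(t')]=\frac{\sinh\frac{k+N}2\hbar t\,\sinh\frac{N-1}2\hbar t\,\sinh\frac{\hbar t}2}{\hbar^2t\,\sinh\frac N2\hbar t}\,\delta(t+t'),\qquad [\hat\lambda_\mu(t),\hat\lambda_\nu(t')]=-\frac{\sinh\frac{k+N}2\hbar t\,\sinh^2\frac{\hbar t}2}{\hbar^2t\,\sinh\frac N2\hbar t}\,e^{\operatorname{sign}(\mu-\nu)\frac N2\hbar t}\,\delta(t+t')\quad(\mu\ne\nu),$$ $$[\hat b_{\mu,\nu}(t),\hat b_{\mu',\nu'}(t')]=-[\hat c_{\mu,\nu}(t),\hat c_{\mu',\nu'}(t')]=-\frac{\sinh^2\frac{\hbar t}2}{\hbar^2t}\,\delta_{\mu\mu'}\delta_{\nu\nu'}\delta(t+t'),\qquad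 \sum_{\mu=1}^Ne^{(1-\mu)\hbar t}\hat\lambda_\mu(t)=0,$$ all other commutators being $0$, and $\hat b_{\mu,\nu}=\hat c_{\mu,\nu}=0$ for $\mu\ge\nu$. Modes with $t>0$ are annihilators, modes with $t<0$ are creators; ${:}\ {:}$ is normal ordering. For $\chi=\lambda_\mu,b_{\mu,\nu},c_{\mu,\nu}$ put $$\chi(\beta|u;\alpha)={:}\exp\Big\{-\hbar\int_{\mathbb R}dt\,\frac{e^{-\alpha\hbar|t|}e^{-iut}}{\sinh\frac\beta2\hbar t}\,\hat\chi(t)\Big\}{:},\quad \chi^+(u)=\exp\Big\{2\hbar\int_0^\infty dt\,\hat\chi(t)e^{-iut}\Big\},\quad \chi^-(u)=\exp\Big\{-2\hbar\int_{-\infty}^0dt\,\hat\chi(t)e^{-iut}\Big\},$$ and $(b+c)_{\mu,\nu}(u)={:}b_{\mu,\nu}(1|u;0)\,c_{\mu,\nu}(1|u;0){:}$. Write $u_s=u+s\,i\hbar$. All products and quotients in the following formulas are normal ordered. For $1\le\mu\le N-1$ put $$H^\pm_\mu(u)=\frac{\lambda^\pm_\mu(u_{\pm\frac{k-N}4-\frac\mu2})}{\lambda^\pm_{\mu+1}(u_{\pm\frac{k-N}4-\frac\mu2})}\prod_{m=1}^\mu\frac{b^\pm_{m,\mu+1}(u_{\mp\frac{m-1}2})}{b^\pm_{m,\mu}(u_{\mp\frac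 m2})}\prod_{n=\mu+1}^N\frac{b^\pm_{\mu,n}(u_{\mp\frac n2})}{b^\pm_{\mu+1,n}(u_{\mp\frac{n-1}2})},$$ $$E_\mu(u)=\frac1\hbar\sum_{m=1}^\mu(b+c)_{m,\mu}(u_{-\frac{m-1}2})\Big\{\frac{b^+_{m,\mu+1}(u_{-\frac{m-1}2})}{(b+c)_{m,\mu+1}(u_{-\frac m2})}-\frac{b^-_{m,\mu+1}(u_{-\frac{m-1}2})}{(b+c)_{m,\mu+1}(u_{-\frac{m-2}2})}\Big\}\prod_{n=1}^{m-1}\frac{b^+_{n,\mu+1}(u_{-\frac{n-1}2})}{b^+_{n,\mu}(u_{-\frac n2})},$$ $$\begin{aligned}F_\mu(u)=\frac1\hbar\Big\{&\sum_{m=1}^\mu(b+c)_{m,\mu+1}(u_{\frac m2})\frac{\lambda^-_\mu(u_{-\frac{k-N}4-\frac\mu2})}{\lambda^-_{\mu+1}(u_{-\frac{k-N}4-\frac\mu2})}\Big[\frac{1+\delta_{m,\mu}}{b^-_{m,\mu}(u_{\frac m2})(b+c)_{m,\mu}(u_{\frac{m-1}2})}-\frac1{b^+_{m,\mu}(u_{\frac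 m2})(b+c)_{m,\mu}(u_{\frac{m+1}2})}\Big]\\&\qquad\times\prod_{n=m+1}^\mu\frac{b^-_{n,\mu+1}(u_{\frac{n-1}2})}{b^-_{n,\mu}(u_{\frac n2})}\prod_{n=\mu+1}^N\frac{b^-_{\mu,n}(u_{\frac n2})}{b^-_{\mu+1,n}(u_{\frac{n-1}2})}\\&-\sum_{m=\mu+1}^N(b+c)_{\mu,m}(u_{-\frac{2k+m-1}2})\frac{\lambda^+_\mu(u_{-\frac{3k+N}4-\frac\mu2})}{\lambda^+_{\mu+1}(u_{-\frac{3k+N}4-\frac\mu2})}\Big[(1+\delta_{m,\mu+1})\frac{b^+_{\mu+1,m}(u_{-\frac{2k+m-1}2})}{(b+c)_{\mu+1,m}(u_{-\frac{2k+m}2})}-\frac{b^-_{\mu+1,m}(u_{-\frac{2k+m-1}2})}{(b+c)_{\mu+1,m}(u_{-\frac{2k+m-2}2})}\Big]\\&\qquad\times\prod_{n=m}^N\frac{b^+_{\mu,n}(u_{-\frac{2k+n}2})}{b^+_{\mu+1,n}(u_{-\frac{2k+n-1}2})}\Big\},\end{aligned}$$ $$\begin{aligned}\tilde S_\mu(u)=-\frac1\hbar\sum_{m=\mu+1}^N(b+c)_{\mu+1,m}(u_{-\frac{N-m}2})\Big\{&\frac1{b^-_{\mu,m}(u_{-\frac{N-m}2})(b+c)_{\mu,m}(u_{-\frac{N-m+1}2})}-\frac1{b^+_{\mu,m}(u_{-\frac{N-m}2})(b+c)_{\mu,m}(u_{-\frac{N-m-1}2})}\Big\}\\&\times\prod_{n=m+1}^N\frac{b^-_{\mu+1,n}(u_{-\frac{N-n+1}2})}{b^-_{\mu,n}(u_{-\frac{N-n}2})},\end{aligned}$$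 $$\Lambda_\mu(u;\alpha)={:}\lambda_{\mu+1}(k+N|u_{-\frac\mu2};\alpha)\,\lambda_\mu(k+N|u_{-\frac\mu2};\alpha)^{-1}{:},\qquad S_\mu(u)={:}\Lambda_\mu\big(u;\tfrac{k+N}4\big)\tilde S_\mu(u){:}.$$ Operator products are computed by Wick's theorem. For the products below, $P(u)Q(v)$ converges (all contraction integrals converge absolutely) when $\operatorname{Im}(u-v)$ is sufficiently negative and $Q(v)P(u)$ when it is sufficiently positive; away from these regions they are understood through the analytic continuation of their matrix elements between coherent states. "Regular" means that all these matrix elements are entire in $(u,v)$. We write $P(u)Q(v)\simeq Q(v)P(u)\sim \mathrm{reg.}+s(u,v)$ if both products converge in these regions and have the same analytic continuation, equal to $s(u,v)$ plus a regular term. Put $$({}_{k+N}\partial_vf)(v)=\frac1{i\hbar}\Big(f\big(v-\tfrac N2i\hbar\big)-f\big(v+ki\hbar+\tfrac N2i\hbar\big)\Big),$$ and let $B_{\mu,\nu}$ be half of the Cartan matrix of $sl_N$ ($B_{\mu,\mu}=1$, $B_{\mu,\mu\pm1}=-\frac12$, $B_{\mu,\nu}=0$ otherwise). **Theorem.** For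 all $1\le\mu,\nu\le N-1$: 1. $H^\pm_\mu(u)S_\nu(v)\simeq S_\nu(v)H^\pm_\mu(u)\sim\mathrm{reg.}$ 2. $E_\mu(u)S_\nu(v)\simeq S_\nu(v)E_\mu(u)\sim\mathrm{reg.}$ 3. $(u-v-iB_{\mu,\nu}\hbar)\,\tilde S_\mu(u)\tilde S_\nu(v)$ and $(u-v+iB_{\mu,\nu}\hbar)\,\tilde S_\nu(v)\tilde S_\mu(u)$ have the same analytic continuation, and it is regular. 4. $\displaystyle F_\mu(u)S_\nu(v)\simeq S_\nu(v)F_\mu(u)\sim\mathrm{reg.}+\delta_{\mu,\nu}\;{}_{k+N}\partial_v\Big(-\frac1{u-v}\,\Lambda_\mu\big(v-\tfrac k2i\hbar;-\tfrac{k+N}4\big)\Big).$ In this sense the screening currents $S_\nu$ commute with the generating currents $H^\pm_\mu,E_\mu,F_\mu$ of the free field realization of $DY_\hbar(sl_N)_k$ modulo a total $\hbar$-difference. -/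

import Mathlib

namespace YangianFreeField

/-- The labels of the free bosons: `lam μ` stands for `λ̂_μ`, `b μ ν` for `b̂_{μ,ν}`, `c μ ν` for
`ĉ_{μ,ν}`. -/
inductive Mode where
  | lam (μ : ℕ)
  | b (μ ν : ℕ)
  | c (μ ν : ℕ)

/-- An element `∫ dt ∑_m A m t χ̂_m(t)` of the (completed) linear span of the bosons, given by its
coefficient functions `A m : ℝ → ℂ`. -/
abbrev Exponent := Mode → ℝ → ℂ

/-- The commutative algebra of finite linear combinations of normal ordered exponentials
`:exp(∫ dt ∑_m A m t χ̂_m(t)):`. Its multiplication is the normal ordered product `:P Q:`. -/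
abbrev NormalOrdered := AddMonoidAlgebra ℂ Exponent

/-- The normal ordered exponential `:exp A:`. -/
noncomputable def vertex (A : Exponent) : NormalOrdered := AddMonoidAlgebra.single A 1

/-- Sum over the bosons `λ̂_μ` (`1 ≤ μ ≤ N`), `b̂_{μ,ν}` and `ĉ_{μ,ν}` (`1 ≤ μ < ν ≤ N`). -/
noncomputable def sumModes (N : ℕ) (f : Mode → ℂ) : ℂ :=
  ∑ μ ∈ Finset.Icc 1 N, f (.lam μ) +
    ∑ μ ∈ Finset.Icc 1 N, ∑ ν ∈ Finset.Ioc μ N, (f (.b μ ν) + f (.c μ ν))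

section

variable (N : ℕ) (k : ℂ) (ℏ : ℝ)

/-- The structure function of the Heisenberg algebra:
`[χ̂_m(t), χ̂_{m'}(t')] = commutator m m' t · δ(t + t')`. -/
noncomputable def commutator : Mode → Mode → ℝ → ℂ
  | .lam μ, .lam ν, t =>
      if μ = ν then
        Complex.sinh ((k + N) / 2 * ℏ * t) * Complex.sinh (((N : ℂ) - 1) / 2 * ℏ * t)
            * Complex.sinh (ℏ / 2 * t)
          / (ℏ ^ 2 * t * Complex.sinh ((N : ℂ) / 2 * ℏ * t))
      else
        -(Complex.sinh ((k + N) / 2 * ℏ * t) * Complex.sinh (ℏ / 2 * t) ^ 2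
            / (ℏ ^ 2 * t * Complex.sinh ((N : ℂ) / 2 * ℏ * t)))
          * Complex.exp (SignType.sign ((μ : ℤ) - (ν : ℤ)) * ((N : ℂ) / 2) * ℏ * t)
  | .b μ ν, .b μ' ν', t =>
      if μ = μ' ∧ ν = ν' then -(1 / (ℏ ^ 2 * t)) * Complex.sinh (ℏ * t / 2) ^ 2 else 0
  | .c μ ν, .c μ' ν', t =>
      if μ = μ' ∧ ν = ν' then 1 / (ℏ ^ 2 * t) * Complex.sinh (ℏ * t / 2) ^ 2 else 0
  | _, _, _ => 0

/-- The integrand of the contraction of `A` and `B`. The annihilation part of `A` is its part with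
`t > 0`, the creation part of `B` its part with `t < 0`. -/
noncomputable def contractionIntegrand (A B : Exponent) (t : ℝ) : ℂ :=
  sumModes N fun m => sumModes N fun m' => A m t * B m' (-t) * commutator N k ℏ m m' t

/-- The contraction of `A` and `B`, i.e. the commutator of the annihilation part of `A` with the
creation part of `B`. -/
noncomputable def contraction (A B : Exponent) : ℂ :=
  ∫ t in Set.Ioi (0 : ℝ), contractionIntegrand N k ℏ A B t

/-- The operator product `P Q` in normal ordered form; it is bilinear and on exponentials it is
`:exp A: :exp B: = exp(contraction of A and B) :exp(A + B):`. -/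
noncomputable def opProduct (P Q : NormalOrdered) : NormalOrdered :=
  P.coeff.sum fun A a => Q.coeff.sum fun B b =>
    AddMonoidAlgebra.single (A + B) (a * b * Complex.exp (contraction N k ℏ A B))

/-- All the contractions that occur in the operator product `P Q` converge. -/
def ProductConverges (P Q : NormalOrdered) : Prop :=
  ∀ A ∈ P.coeff.support, ∀ B ∈ Q.coeff.support,
    MeasureTheory.IntegrableOn (contractionIntegrand N k ℏ A B) (Set.Ioi 0)

/-- Labels of a pair of coherent states: `φ m t` is the eigenvalue of `χ̂_m(t)` on the right
coherent state for `t > 0` and on the left coherent state for `t < 0`. The eigenvalues obey the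
linear relation `∑_μ e^{(1-μ)ℏt} λ̂_μ(t) = 0` that is imposed on the bosons. -/
structure CoherentLabel where
  φ : Mode → ℝ → ℂ
  continuous_φ : ∀ m, Continuous (φ m)
  hasCompactSupport_φ : ∀ m, HasCompactSupport (φ m)
  zero_notMem_φ : ∀ m, (0 : ℝ) ∉ tsupport (φ m)
  relation_φ : ∀ t : ℝ,
    ∑ μ ∈ Finset.Icc 1 N, Complex.exp ((1 - (μ : ℂ)) * ℏ * t) * φ (.lam μ) t = 0

variable {N ℏ} in
/-- The matrix element of a normal ordered operator between the coherent states labelled by `z`,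
divided by the pairing of these states. -/
noncomputable def matrixElement (z : CoherentLabel N ℏ) (P : NormalOrdered) : ℂ :=
  P.coeff.sum fun A a => a * Complex.exp (∫ t : ℝ, sumModes N fun m => A m t * z.φ m t)

/-- `T u v` is the analytic continuation, in the sense of matrix elements, of the operator product
`P(u) Q(v)`, which converges for `Im (u - v) ≪ 0`. -/
def ContinuesTo (P Q : ℂ → NormalOrdered) (T : ℂ → ℂ → CoherentLabel N ℏ → ℂ) : Prop :=
  ∃ r : ℝ, ∀ u v : ℂ, (u - v).im < -r →
    ProductConverges N k ℏ (P u) (Q v) ∧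
      ∀ z : CoherentLabel N ℏ, matrixElement z (opProduct N k ℏ (P u) (Q v)) = T u v z

variable {N ℏ} in
/-- Regular terms: all matrix elements are entire functions of `(u, v)`. -/
def IsRegular (R : ℂ → ℂ → CoherentLabel N ℏ → ℂ) : Prop :=
  ∀ z, Differentiable ℂ fun p : ℂ × ℂ => R p.1 p.2 z

/-- The operator product expansion `P(u) Q(v) ≃ Q(v) P(u) ∼ reg. + s(u, v)`: the two products have
the same analytic continuation, and it is `s(u, v)` up to regular terms. -/
def OPE (P Q : ℂ → NormalOrdered) (s : ℂ → ℂ → CoherentLabel N ℏ → ℂ) : Prop :=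
  ∃ R : ℂ → ℂ → CoherentLabel N ℏ → ℂ, IsRegular R ∧
    ContinuesTo N k ℏ P Q (fun u v z => R u v z + s u v z) ∧
    ContinuesTo N k ℏ Q P (fun v u z => R u v z + s u v z)

/-! ### The free fields (given by their exponents) -/

/-- Coefficient function of the field `χ(β|u;α)`. -/
noncomputable def fieldCoeff (β u α : ℂ) (t : ℝ) : ℂ :=
  -ℏ / Complex.sinh (β / 2 * ℏ * t)
    * (if t < 0 then Complex.exp (α * ℏ * t) else Complex.exp (-(α * ℏ * t)))
    * Complex.exp (-(Complex.I * u * t))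

/-- Coefficient function of the field `χ⁺(u)`. -/
noncomputable def plusCoeff (u : ℂ) (t : ℝ) : ℂ :=
  if 0 < t then 2 * ℏ * Complex.exp (-(Complex.I * u * t)) else 0

/-- Coefficient function of the field `χ⁻(u)`. -/
noncomputable def minusCoeff (u : ℂ) (t : ℝ) : ℂ :=
  if t < 0 then -(2 * ℏ) * Complex.exp (-(Complex.I * u * t)) else 0

/-- `∫ dt f(t) λ̂_μ(t)`. -/
def lamExp (μ : ℕ) (f : ℝ → ℂ) : Exponent
  | .lam μ', t => if μ' = μ then f t else 0
  | _, _ => 0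

/-- `∫ dt f(t) b̂_{μ,ν}(t)`, which is `0` unless `μ < ν`. -/
def bExp (μ ν : ℕ) (f : ℝ → ℂ) : Exponent
  | .b μ' ν', t => if μ < ν ∧ μ' = μ ∧ ν' = ν then f t else 0
  | _, _ => 0

/-- `∫ dt f(t) ĉ_{μ,ν}(t)`, which is `0` unless `μ < ν`. -/
def cExp (μ ν : ℕ) (f : ℝ → ℂ) : Exponent
  | .c μ' ν', t => if μ < ν ∧ μ' = μ ∧ ν' = ν then f t else 0
  | _, _ => 0

/-- `λ_μ(β|u;α)` -/
noncomputable def lamField (μ : ℕ) (β u α : ℂ) : Exponent := lamExp μ (fieldCoeff ℏ β u α)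

/-- `λ⁺_μ(u)` -/
noncomputable def lamPlus (μ : ℕ) (u : ℂ) : Exponent := lamExp μ (plusCoeff ℏ u)

/-- `λ⁻_μ(u)` -/
noncomputable def lamMinus (μ : ℕ) (u : ℂ) : Exponent := lamExp μ (minusCoeff ℏ u)

/-- `b⁺_{μ,ν}(u)` -/
noncomputable def bPlus (μ ν : ℕ) (u : ℂ) : Exponent := bExp μ ν (plusCoeff ℏ u)

/-- `b⁻_{μ,ν}(u)` -/
noncomputable def bMinus (μ ν : ℕ) (u : ℂ) : Exponent := bExp μ ν (minusCoeff ℏ u)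

/-- `(b+c)_{μ,ν}(u) = :b_{μ,ν}(u) c_{μ,ν}(u):`, where `b(u) = b(1|u;0)` and `c(u) = c(1|u;0)`. -/
noncomputable def bc (μ ν : ℕ) (u : ℂ) : Exponent :=
  bExp μ ν (fieldCoeff ℏ 1 u 0) + cExp μ ν (fieldCoeff ℏ 1 u 0)

/-! ### The currents -/

/-- The point `u + s iℏ`. -/
noncomputable def sh (u s : ℂ) : ℂ := u + s * Complex.I * ℏ

/-- `H⁺_μ(u)` -/
noncomputable def currentHPlus (μ : ℕ) (u : ℂ) : NormalOrdered :=
  vertex (lamPlus ℏ μ (sh ℏ u ((k - N) / 4 - μ / 2))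
    - lamPlus ℏ (μ + 1) (sh ℏ u ((k - N) / 4 - μ / 2))
    + ∑ m ∈ Finset.Icc 1 μ,
        (bPlus ℏ m (μ + 1) (sh ℏ u (-(m - 1) / 2)) - bPlus ℏ m μ (sh ℏ u (-m / 2)))
    + ∑ n ∈ Finset.Icc (μ + 1) N,
        (bPlus ℏ μ n (sh ℏ u (-n / 2)) - bPlus ℏ (μ + 1) n (sh ℏ u (-(n - 1) / 2))))

/-- `H⁻_μ(u)` -/
noncomputable def currentHMinus (μ : ℕ) (u : ℂ) : NormalOrdered :=
  vertex (lamMinus ℏ μ (sh ℏ u (-(k - N) / 4 - μ / 2))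
    - lamMinus ℏ (μ + 1) (sh ℏ u (-(k - N) / 4 - μ / 2))
    + ∑ m ∈ Finset.Icc 1 μ,
        (bMinus ℏ m (μ + 1) (sh ℏ u ((m - 1) / 2)) - bMinus ℏ m μ (sh ℏ u (m / 2)))
    + ∑ n ∈ Finset.Icc (μ + 1) N,
        (bMinus ℏ μ n (sh ℏ u (n / 2)) - bMinus ℏ (μ + 1) n (sh ℏ u ((n - 1) / 2))))

/-- `E_μ(u)` -/
noncomputable def currentE (μ : ℕ) (u : ℂ) : NormalOrdered :=
  (1 / ℏ : ℂ) • ∑ m ∈ Finset.Icc 1 μ,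
    vertex (bc ℏ m μ (sh ℏ u (-(m - 1) / 2)))
      * (vertex (bPlus ℏ m (μ + 1) (sh ℏ u (-(m - 1) / 2)) - bc ℏ m (μ + 1) (sh ℏ u (-m / 2)))
        - vertex (bMinus ℏ m (μ + 1) (sh ℏ u (-(m - 1) / 2))
            - bc ℏ m (μ + 1) (sh ℏ u (-(m - 2) / 2))))
      * vertex (∑ n ∈ Finset.Ico 1 m,
          (bPlus ℏ n (μ + 1) (sh ℏ u (-(n - 1) / 2)) - bPlus ℏ n μ (sh ℏ u (-n / 2))))

/-- `F_μ(u)`. As `b_{μ,μ} = c_{μ,μ} = 0`, the bracket is `1` for `m = μ` in the first sum and for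
`m = μ + 1` in the second one. -/
noncomputable def currentF (μ : ℕ) (u : ℂ) : NormalOrdered :=
  (1 / ℏ : ℂ) •
    (∑ m ∈ Finset.Icc 1 μ,
        vertex (bc ℏ m (μ + 1) (sh ℏ u (m / 2)))
          * vertex (lamMinus ℏ μ (sh ℏ u (-(k - N) / 4 - μ / 2))
              - lamMinus ℏ (μ + 1) (sh ℏ u (-(k - N) / 4 - μ / 2)))
          * ((if m = μ then (2 : ℂ) else 1) •
                vertex (-bMinus ℏ m μ (sh ℏ u (m / 2)) - bc ℏ m μ (sh ℏ u ((m - 1) / 2)))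
              - vertex (-bPlus ℏ m μ (sh ℏ u (m / 2)) - bc ℏ m μ (sh ℏ u ((m + 1) / 2))))
          * vertex (∑ n ∈ Finset.Icc (m + 1) μ,
              (bMinus ℏ n (μ + 1) (sh ℏ u ((n - 1) / 2)) - bMinus ℏ n μ (sh ℏ u (n / 2))))
          * vertex (∑ n ∈ Finset.Icc (μ + 1) N,
              (bMinus ℏ μ n (sh ℏ u (n / 2)) - bMinus ℏ (μ + 1) n (sh ℏ u ((n - 1) / 2))))
      - ∑ m ∈ Finset.Icc (μ + 1) N,
        vertex (bc ℏ μ m (sh ℏ u (-(2 * k + m - 1) / 2)))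
          * vertex (lamPlus ℏ μ (sh ℏ u (-(3 * k + N) / 4 - μ / 2))
              - lamPlus ℏ (μ + 1) (sh ℏ u (-(3 * k + N) / 4 - μ / 2)))
          * ((if m = μ + 1 then (2 : ℂ) else 1) •
                vertex (bPlus ℏ (μ + 1) m (sh ℏ u (-(2 * k + m - 1) / 2))
                  - bc ℏ (μ + 1) m (sh ℏ u (-(2 * k + m) / 2)))
              - vertex (bMinus ℏ (μ + 1) m (sh ℏ u (-(2 * k + m - 1) / 2))
                  - bc ℏ (μ + 1) m (sh ℏ u (-(2 * k + m - 2) / 2))))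
          * vertex (∑ n ∈ Finset.Icc m N,
              (bPlus ℏ μ n (sh ℏ u (-(2 * k + n) / 2))
                - bPlus ℏ (μ + 1) n (sh ℏ u (-(2 * k + n - 1) / 2)))))

/-- `S̃_μ(u)` -/
noncomputable def screeningTilde (μ : ℕ) (u : ℂ) : NormalOrdered :=
  (-1 / ℏ : ℂ) • ∑ m ∈ Finset.Icc (μ + 1) N,
    vertex (bc ℏ (μ + 1) m (sh ℏ u (-(N - m) / 2)))
      * (vertex (-bMinus ℏ μ m (sh ℏ u (-(N - m) / 2)) - bc ℏ μ m (sh ℏ u (-(N - m + 1) / 2)))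
        - vertex (-bPlus ℏ μ m (sh ℏ u (-(N - m) / 2)) - bc ℏ μ m (sh ℏ u (-(N - m - 1) / 2))))
      * vertex (∑ n ∈ Finset.Icc (m + 1) N,
          (bMinus ℏ (μ + 1) n (sh ℏ u (-(N - n + 1) / 2))
            - bMinus ℏ μ n (sh ℏ u (-(N - n) / 2))))

/-- The normal ordered exponential
`:λ_{μ+1}(k+N | u - iμℏ/2; α) λ_μ(k+N | u - iμℏ/2; α)⁻¹:`. -/
noncomputable def lamRatio (μ : ℕ) (u α : ℂ) : NormalOrdered :=
  vertex (lamField ℏ (μ + 1) (k + N) (sh ℏ u (-μ / 2)) α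
    - lamField ℏ μ (k + N) (sh ℏ u (-μ / 2)) α)

/-- The screening current `S_μ(u)`. -/
noncomputable def screening (μ : ℕ) (u : ℂ) : NormalOrdered :=
  lamRatio N k ℏ μ u ((k + N) / 4) * screeningTilde N ℏ μ u

/-- The difference operator
`(_{k+α}∂_u f)(u) = (f(u - iαℏ/2) - f(u + ikℏ + iαℏ/2)) / (iℏ)`. -/
noncomputable def hDiff (α : ℂ) (f : ℂ → ℂ) (u : ℂ) : ℂ :=
  1 / (Complex.I * ℏ) * (f (sh ℏ u (-α / 2)) - f (sh ℏ u (k + α / 2)))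

end

/-- Half of the Cartan matrix of `sl_N`. -/
noncomputable def halfCartan (μ ν : ℕ) : ℂ :=
  if μ = ν then 1 else if μ = ν + 1 ∨ ν = μ + 1 then -1 / 2 else 0

end YangianFreeField

namespace YangianFreeField

open MeasureTheory Set Filter Topology

/-! ### Analytic preliminaries -/

/-! Every current is a finite linear combination of normal ordered exponentials, so an operator
product is determined by the contractions of pairs of exponents. The basic fact is that for all
pairs occurring here the contraction integrand telescopes to a single difference `(e^{sℏt} -
e^{s'ℏt}) e^{-i(u-v)t} / t` (`HasSymbol`). Its exponentiated integral is `(u - v + s' iℏ) / (u - v +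
s iℏ)` by Frullani (`frullani_exp`): a rational function with at most one simple pole. If the
opposite order has the negated shifts (`IsLocal`), both products continue to the same function.

For such a pair, `IsLocal.expansion` splits off the pole `u = v - s iℏ`: its residue is the vertex
operator `:A(v - s iℏ) B(v):` and the remainder is a difference quotient of an entire function,
hence entire in both variables. The theorem thus becomes a statement about residues.

For `H^±` there is no pole, because the contractions of the λ-sector cancel those of the b-sector.
This rests on the differences `λ_i - λ_{i+1}` having a deformed Cartan matrix as commutators
(`commutator_lam_root`) and on second differences telescoping along rows
(`sum_bPlus_screenTerm_row`). For `E` all poles sit at one point and the residues cancel in pairs: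
`b⁻` equals `b⁺` times a ratio of shifted fields `b(1|u;0)` (`bMinus_sh`), so residues of different
pairs are the same operator.

For `F` the same cancellations leave, when `μ = ν`, exactly one pole from each of its two sums.
There the b-sector exponents add up to zero, and the λ-sector collapses to `Λ` with the opposite
parameter (`rootMinus_add_ratioExp`, `rootPlus_add_ratioExp`). The two poles are the two evaluation
points of the difference operator `hDiff`.

For two `S̃` the orders have different fractions, but every pair of terms becomes the same linear
polynomial once the common denominator `u - v ∓ iBℏ` is cleared (`HasSymbol.expansion`). -/

/-- The difference quotient `(f y - f x) / (y - x)` of an entire function, in integral form. -/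
noncomputable def diffQuot (f : ℂ → ℂ) (p : ℂ × ℂ) : ℂ :=
  ∫ s in Ioc (0 : ℝ) 1, deriv f (p.1 + s * (p.2 - p.1))

theorem mul_diffQuot {f : ℂ → ℂ} (hf : Differentiable ℂ f) (x y : ℂ) :
    (y - x) * diffQuot f (x, y) = f y - f x := by
  have h : ∀ s ∈ uIcc (0 : ℝ) 1, HasDerivAt (fun s : ℝ => f (x + s * (y - x)))
      ((y - x) * deriv f (x + s * (y - x))) s := by
    intro s _
    have h1 : HasDerivAt (fun s : ℝ => x + (s : ℂ) * (y - x)) (y - x) s := by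
      simpa using ((Complex.ofRealCLM.hasDerivAt (x := s)).mul_const (y - x)).const_add x
    have h2 := (hf (x + s * (y - x))).hasDerivAt.comp s h1
    rw [mul_comm]
    exact h2
  have hc : Continuous fun s : ℝ => (y - x) * deriv f (x + s * (y - x)) := by
    have : Continuous (deriv f) := (hf.contDiff (n := 1)).continuous_deriv le_rfl
    fun_prop
  have := intervalIntegral.integral_eq_sub_of_hasDerivAt h (hc.intervalIntegrable _ _)
  rw [intervalIntegral.integral_of_le zero_le_one, integral_const_mul] at this
  simpa [diffQuot] using this

/-- The integral form has no singularity on the diagonal, so joint holomorphy is differentiation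
under the integral sign. This is what makes the remainder at a simple pole entire in both variables.
-/
theorem differentiable_diffQuot {f : ℂ → ℂ} (hf : Differentiable ℂ f) :
    Differentiable ℂ (diffQuot f) := by
  intro p
  have hf1 : Differentiable ℂ (deriv f) := (hf.contDiff (n := 2)).differentiable_deriv_two
  have hc1 : Continuous (deriv f) := hf1.continuous
  have hc2 : Continuous (deriv (deriv f)) := (hf1.contDiff (n := 1)).continuous_deriv le_rfl
  let D : ℝ → (ℂ × ℂ) →L[ℂ] ℂ := fun s =>
    ContinuousLinearMap.fst ℂ ℂ ℂ + (s : ℂ) •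
      (ContinuousLinearMap.snd ℂ ℂ ℂ - ContinuousLinearMap.fst ℂ ℂ ℂ)
  let F' : ℂ × ℂ → ℝ → (ℂ × ℂ) →L[ℂ] ℂ := fun q s =>
    deriv (deriv f) (q.1 + s * (q.2 - q.1)) • D s
  have hF' : Continuous fun r : (ℂ × ℂ) × ℝ => F' r.1 r.2 := by
    simp only [F', D]
    fun_prop
  -- The derivative of the integrand is jointly continuous, hence bounded on the compact set (closed
  -- ball) × [0, 1]; this constant dominates.
  obtain ⟨C, hC⟩ := ((isCompact_closedBall p 1).prod (isCompact_Icc (a := (0 : ℝ)) (b := 1))).exists_bound_of_continuousOn hF'.continuousOn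
  refine (hasFDerivAt_integral_of_dominated_of_fderiv_le (F' := F') (bound := fun _ => C)
    (Metric.ball_mem_nhds p one_pos) (Eventually.of_forall fun q => ?_) ?_ ?_ ?_ ?_ ?_).differentiableAt
  · exact (by fun_prop : Continuous fun s : ℝ => deriv f (q.1 + s * (q.2 - q.1))).aestronglyMeasurable
  · exact ((by fun_prop : Continuous fun s : ℝ => deriv f (p.1 + s * (p.2 - p.1))).continuousOn.integrableOn_compact isCompact_Icc).mono_set Ioc_subset_Icc_self
  · exact (hF'.comp (by fun_prop : Continuous fun s : ℝ => (p, s))).aestronglyMeasurable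
  · filter_upwards [ae_restrict_mem measurableSet_Ioc] with s hs q hq
    exact hC (q, s) ⟨Metric.ball_subset_closedBall hq, Ioc_subset_Icc_self hs⟩
  · exact integrableOn_const (by simp)
  · refine Eventually.of_forall fun s q _ => ?_
    have h1 : HasFDerivAt (fun q : ℂ × ℂ => q.1 + (s : ℂ) * (q.2 - q.1)) (D s) q := by
      have := (hasFDerivAt_fst (𝕜 := ℂ) (p := q)).add
        (((hasFDerivAt_snd (𝕜 := ℂ) (p := q)).sub (hasFDerivAt_fst (𝕜 := ℂ) (p := q))).const_mul (s : ℂ))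
      exact this
    exact (hf1 _).hasDerivAt.comp_hasFDerivAt q h1

/-- The integral of `t ↦ h t * exp (-i u t)` is an entire function of `u`. -/
theorem differentiable_integral_mul_exp {h : ℝ → ℂ} (hc : Continuous h) (hs : HasCompactSupport h) :
    Differentiable ℂ fun u : ℂ => ∫ t : ℝ, h t * Complex.exp (-(Complex.I * u * t)) := by
  intro u
  -- On the unit ball around `u` one has `‖w‖ ≤ ‖u‖ + 1`, which bounds the exponential uniformly;
  -- the compact support of `h` makes the bound integrable.
  have hbound : Integrable fun t : ℝ => ‖h t‖ * (|t| * Real.exp ((‖u‖ + 1) * |t|)) := by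
    refine Continuous.integrable_of_hasCompactSupport (by fun_prop) ?_
    exact hs.norm.mul_right
  refine (hasDerivAt_integral_of_dominated_loc_of_deriv_le
    (F' := fun u t => h t * (Complex.exp (-(Complex.I * u * t)) * (-(Complex.I * t))))
    (Metric.ball_mem_nhds u one_pos) (Eventually.of_forall fun w => ?_) ?_ ?_ ?_ hbound ?_).2.differentiableAt
  · exact (by fun_prop : Continuous fun t : ℝ => h t * Complex.exp (-(Complex.I * w * t))).aestronglyMeasurable
  · exact Continuous.integrable_of_hasCompactSupport (by fun_prop) hs.mul_right
  · exact (by fun_prop : Continuous fun t : ℝ => h t * (Complex.exp (-(Complex.I * u * t)) * (-(Complex.I * t)))).aestronglyMeasurable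
  · refine Eventually.of_forall fun t w hw => ?_
    rw [norm_mul, norm_mul, norm_neg, norm_mul, Complex.norm_I, one_mul, Complex.norm_real,
      Real.norm_eq_abs, mul_comm (‖Complex.exp _‖)]
    gcongr
    rw [Complex.norm_exp]
    gcongr
    refine (Complex.re_le_norm _).trans ?_
    rw [norm_neg, norm_mul, norm_mul, Complex.norm_I, one_mul, Complex.norm_real, Real.norm_eq_abs]
    gcongr
    have := norm_sub_norm_le w u
    have h2 : ‖w - u‖ < 1 := by simpa [dist_eq_norm] using hw
    linarith
  · refine Eventually.of_forall fun t w _ => ?_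
    have h1 : HasDerivAt (fun w : ℂ => -(Complex.I * w * t)) (-(Complex.I * t)) w := by
      simpa using (((hasDerivAt_id w).const_mul Complex.I).mul_const (t : ℂ)).fun_neg
    exact h1.cexp.const_mul (h t)

/-- A complex Frullani integral. -/
theorem frullani_exp {p q : ℂ} (hp : 0 < p.re) (hq : 0 < q.re) :
    IntegrableOn (fun t : ℝ => (Complex.exp (-(p * t)) - Complex.exp (-(q * t))) / t) (Ioi 0) ∧
      Complex.exp (∫ t in Ioi (0 : ℝ), (Complex.exp (-(p * t)) - Complex.exp (-(q * t))) / t)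
        = q / p := by
  -- The segment from `p` to `q` stays in the right half plane. The integrand is the integral of `(q
  -- - p) e^{-wt}` along it; integrating over `t` first gives `(q - p) / w`, whose primitive is the
  -- principal logarithm.
  let w : ℝ → ℂ := fun s => p + s * (q - p)
  have hw : ∀ s ∈ Icc (0 : ℝ) 1, min p.re q.re ≤ (w s).re := by
    intro s hs
    simp only [w, Complex.add_re, Complex.mul_re, Complex.ofReal_re, Complex.ofReal_im, Complex.sub_re]
    have h1 := min_le_left p.re q.re
    have h2 := min_le_right p.re q.re
    nlinarith [hs.1, hs.2, mul_le_mul_of_nonneg_left h2 hs.1,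
      mul_le_mul_of_nonneg_left h1 (sub_nonneg.2 hs.2)]
  have hm : 0 < min p.re q.re := lt_min hp hq
  have hw0 : ∀ s ∈ Icc (0 : ℝ) 1, 0 < (w s).re := fun s hs => hm.trans_le (hw s hs)
  have hwc : Continuous w := by fun_prop
  let K : ℝ → ℝ → ℂ := fun t s => (q - p) * Complex.exp (-(w s * t))
  -- Along the segment the real part is at least `min p.re q.re > 0`, so a decaying exponential in
  -- `t` alone dominates and Fubini applies.
  have hK : Integrable (Function.uncurry K)
      ((volume.restrict (Ioi (0 : ℝ))).prod (volume.restrict (Ioc (0 : ℝ) 1))) := by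
    have hb : Integrable (fun t : ℝ => ‖q - p‖ * Real.exp (-(min p.re q.re) * t))
        (volume.restrict (Ioi 0)) :=
      (integrableOn_exp_mul_Ioi (neg_lt_zero.2 hm) 0).const_mul _
    refine (hb.comp_fst (volume.restrict (Ioc (0 : ℝ) 1))).mono' ?_ ?_
    · exact (by unfold Function.uncurry; fun_prop : Continuous (Function.uncurry K)).aestronglyMeasurable
    · rw [Measure.prod_restrict]
      filter_upwards [ae_restrict_mem (measurableSet_Ioi.prod measurableSet_Ioc)] with x hx
      simp only [Function.uncurry, K, norm_mul, Complex.norm_exp]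
      gcongr
      simp only [Complex.neg_re, Complex.mul_re, Complex.ofReal_re, Complex.ofReal_im, mul_zero,
        sub_zero, neg_mul, neg_le_neg_iff]
      exact mul_le_mul_of_nonneg_right (hw _ (Ioc_subset_Icc_self hx.2)) (le_of_lt hx.1)
  have hin : ∀ t ∈ Ioi (0 : ℝ), ∫ s in Ioc (0 : ℝ) 1, K t s
      = (Complex.exp (-(p * t)) - Complex.exp (-(q * t))) / t := by
    intro t ht
    have ht0 : (t : ℂ) ≠ 0 := by exact_mod_cast ht.ne'
    have hd : ∀ s ∈ uIcc (0 : ℝ) 1,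
        HasDerivAt (fun s : ℝ => -Complex.exp (-(w s * t)) / t) (K t s) s := by
      intro s _
      have h1 : HasDerivAt (fun s : ℝ => -(w s * t)) (-((q - p) * t)) s := by
        have := (((Complex.ofRealCLM.hasDerivAt (x := s)).mul_const (q - p)).const_add p).mul_const (t : ℂ)
        simpa [w] using this.fun_neg
      have h2 := (h1.cexp.fun_neg).div_const (t : ℂ)
      refine h2.congr_deriv ?_
      simp only [K]; field_simp
    have hc : Continuous (K t) := by fun_prop
    have := intervalIntegral.integral_eq_sub_of_hasDerivAt hd (hc.intervalIntegrable _ _)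
    rw [intervalIntegral.integral_of_le zero_le_one] at this
    rw [this]
    simp only [w, Complex.ofReal_one, Complex.ofReal_zero]
    ring_nf
  have hout : ∫ s in Ioc (0 : ℝ) 1, ∫ t in Ioi (0 : ℝ), K t s = Complex.log q - Complex.log p := by
    have h1 : ∫ s in Ioc (0 : ℝ) 1, ∫ t in Ioi (0 : ℝ), K t s
        = ∫ s in Ioc (0 : ℝ) 1, (w s)⁻¹ * (q - p) := by
      refine setIntegral_congr_fun measurableSet_Ioc fun s hs => ?_
      have hs0 := hw0 s (Ioc_subset_Icc_self hs)
      have hne : w s ≠ 0 := fun h => by simp [h] at hs0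
      have := integral_exp_mul_complex_Ioi (a := -w s) (by simpa using hs0) 0
      show ∫ t in Ioi (0 : ℝ), (q - p) * Complex.exp (-(w s * t)) = _
      rw [integral_const_mul]
      simp only [neg_mul] at this
      rw [this]
      simp
      ring
    have hd : ∀ s ∈ uIcc (0 : ℝ) 1,
        HasDerivAt (fun s : ℝ => Complex.log (w s)) ((w s)⁻¹ * (q - p)) s := by
      intro s hs
      rw [uIcc_of_le zero_le_one] at hs
      have h1 : HasDerivAt w (q - p) s := by
        simpa [w] using ((Complex.ofRealCLM.hasDerivAt (x := s)).mul_const (q - p)).const_add p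
      exact (Complex.hasDerivAt_log (Or.inl (hw0 s hs))).comp s h1
    have hc : ContinuousOn (fun s => (w s)⁻¹ * (q - p)) (uIcc (0 : ℝ) 1) := by
      refine ContinuousOn.mul (hwc.continuousOn.inv₀ fun s hs h => ?_) continuousOn_const
      rw [uIcc_of_le zero_le_one] at hs
      have := hw0 s hs
      simp [h] at this
    have := intervalIntegral.integral_eq_sub_of_hasDerivAt hd hc.intervalIntegrable
    rw [intervalIntegral.integral_of_le zero_le_one] at this
    rw [h1, this]
    simp [w]
  have hint := (integrableOn_congr_fun hin measurableSet_Ioi).1 hK.integral_prod_left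
  refine ⟨hint, ?_⟩
  rw [← setIntegral_congr_fun measurableSet_Ioi hin, integral_integral_swap hK, hout,
    Complex.exp_sub, Complex.exp_log, Complex.exp_log]
  · rintro rfl; simp at hp
  · rintro rfl; simp at hq

end YangianFreeField

namespace YangianFreeField

open MeasureTheory Set Filter Topology

/-! ### Matrix elements between coherent states -/

section sumModes

variable (N : ℕ)

theorem sumModes_add (f g : Mode → ℂ) :
    sumModes N (fun m => f m + g m) = sumModes N f + sumModes N g := by
  simp only [sumModes, Finset.sum_add_distrib]; ring

theorem sumModes_mul_left (c : ℂ) (f : Mode → ℂ) :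
    sumModes N (fun m => c * f m) = c * sumModes N f := by
  simp only [sumModes, ← Finset.mul_sum, ← mul_add]

theorem sumModes_mul_right (c : ℂ) (f : Mode → ℂ) :
    sumModes N (fun m => f m * c) = sumModes N f * c := by
  simp only [mul_comm _ c, sumModes_mul_left]

theorem sumModes_zero : sumModes N (fun _ => 0) = 0 := by simp [sumModes]

theorem sumModes_neg (f : Mode → ℂ) : sumModes N (fun m => -f m) = -sumModes N f := by
  simpa using sumModes_mul_left N (-1) f

theorem sumModes_sum {ι : Type*} (s : Finset ι) (f : ι → Mode → ℂ) :
    sumModes N (fun m => ∑ i ∈ s, f i m) = ∑ i ∈ s, sumModes N (f i) := by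
  classical
  induction s using Finset.induction_on with
  | empty => simp [sumModes_zero]
  | insert a s ha ih => simp only [Finset.sum_insert ha, sumModes_add, ih]

theorem continuous_sumModes {f : Mode → ℝ → ℂ} (hf : ∀ m, Continuous (f m)) :
    Continuous fun t => sumModes N fun m => f m t := by
  unfold sumModes; fun_prop

theorem hasCompactSupport_finsetSum {ι : Type*} (s : Finset ι) {f : ι → ℝ → ℂ}
    (hf : ∀ i, HasCompactSupport (f i)) : HasCompactSupport fun t => ∑ i ∈ s, f i t := by
  classical
  induction s using Finset.induction_on with
  | empty => exact HasCompactSupport.zero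
  | insert a s ha ih => simp only [Finset.sum_insert ha]; exact (hf a).add ih

theorem hasCompactSupport_sumModes {f : Mode → ℝ → ℂ} (hf : ∀ m, HasCompactSupport (f m)) :
    HasCompactSupport fun t => sumModes N fun m => f m t := by
  unfold sumModes
  exact (hasCompactSupport_finsetSum _ fun i => hf _).add (hasCompactSupport_finsetSum _ fun i =>
    hasCompactSupport_finsetSum _ fun j => (hf _).add (hf _))

end sumModes

/-- A family of exponents whose coefficient functions are of the form `g(t) e^{-iut}` with `g`
continuous away from `0`. -/
def IsField (A : ℂ → Exponent) : Prop :=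
  ∀ m, ∃ g : ℝ → ℂ, ContinuousOn g {0}ᶜ ∧ ∀ u t, A u m t = g t * Complex.exp (-(Complex.I * u * t))

theorem IsField.zero : IsField fun _ => 0 := fun _ => ⟨0, continuousOn_const, by simp⟩

theorem IsField.add {A B : ℂ → Exponent} (hA : IsField A) (hB : IsField B) :
    IsField fun u => A u + B u := fun m => by
  obtain ⟨f, hf, hf'⟩ := hA m
  obtain ⟨g, hg, hg'⟩ := hB m
  exact ⟨f + g, hf.add hg, fun u t => by simp [hf', hg', add_mul]⟩

theorem IsField.neg {A : ℂ → Exponent} (hA : IsField A) : IsField fun u => -A u := fun m => by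
  obtain ⟨f, hf, hf'⟩ := hA m
  exact ⟨-f, hf.neg, fun u t => by simp [hf']⟩

theorem IsField.sub {A B : ℂ → Exponent} (hA : IsField A) (hB : IsField B) :
    IsField fun u => A u - B u := by simpa only [sub_eq_add_neg] using hA.add hB.neg

theorem IsField.sum {ι : Type*} (s : Finset ι) {A : ι → ℂ → Exponent} (hA : ∀ i, IsField (A i)) :
    IsField fun u => ∑ i ∈ s, A i u := by
  classical
  induction s using Finset.induction_on with
  | empty => simpa using IsField.zero
  | insert a s ha ih => simp only [Finset.sum_insert ha]; exact (hA a).add ih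

theorem IsField.shift {A : ℂ → Exponent} (hA : IsField A) (c : ℂ) : IsField fun u => A (u + c) :=
  fun m => by
    obtain ⟨f, hf, hf'⟩ := hA m
    refine ⟨fun t => f t * Complex.exp (-(Complex.I * c * t)), hf.mul (by fun_prop), fun u t => ?_⟩
    change A (u + c) m t = f t * Complex.exp (-(Complex.I * c * t)) * Complex.exp (-(Complex.I * u * t))
    rw [hf', mul_assoc (f t), ← Complex.exp_add]
    ring_nf

theorem IsField.sh {A : ℂ → Exponent} (hA : IsField A) (ℏ : ℝ) (s : ℂ) :
    IsField fun u => A (sh ℏ u s) := hA.shift _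

variable {N : ℕ} {k : ℂ} {ℏ : ℝ}

/-- The logarithm of the matrix element of `:exp A:` between the coherent states labelled by `z`. -/
noncomputable def pairing (z : CoherentLabel N ℏ) (A : Exponent) : ℂ :=
  ∫ t : ℝ, sumModes N fun m => A m t * z.φ m t

/-- The label vanishes in a neighbourhood of `t = 0`, so the jump of `χ^±` and the pole of `1 /
sinh` at the origin do no harm. -/
theorem CoherentLabel.continuous_mul (z : CoherentLabel N ℏ) (m : Mode) {g : ℝ → ℂ}
    (hg : ContinuousOn g {0}ᶜ) : Continuous fun t => g t * z.φ m t := by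
  rw [continuous_iff_continuousAt]
  intro t
  by_cases ht : t = 0
  · subst ht
    have h0 := z.zero_notMem_φ m
    rw [notMem_tsupport_iff_eventuallyEq] at h0
    have : (fun t => g t * z.φ m t) =ᶠ[𝓝 0] fun _ => 0 := by
      filter_upwards [h0] with t ht
      simp [ht]
    exact this.continuousAt
  · exact (hg.continuousAt (isOpen_compl_singleton.mem_nhds ht)).mul
      (z.continuous_φ m).continuousAt

/-- The parameter `u` enters every mode through the same factor `e^{-iut}`, so the sum over modes is
one continuous compactly supported density times that factor. Integrability and entireness in `u`
both come from this. -/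
theorem IsField.exists_density {A : ℂ → Exponent} (hA : IsField A) (z : CoherentLabel N ℏ) :
    ∃ h : ℝ → ℂ, Continuous h ∧ HasCompactSupport h ∧ ∀ u t,
      sumModes N (fun m => A u m t * z.φ m t) = h t * Complex.exp (-(Complex.I * u * t)) := by
  choose g hg hg' using hA
  refine ⟨fun t => sumModes N fun m => g m t * z.φ m t,
    continuous_sumModes N fun m => z.continuous_mul m (hg m),
    hasCompactSupport_sumModes N fun m => (z.hasCompactSupport_φ m).mul_left, fun u t => ?_⟩
  rw [← sumModes_mul_right]
  congr 1; ext m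
  rw [hg']; ring

theorem IsField.integrable {A : ℂ → Exponent} (hA : IsField A) (z : CoherentLabel N ℏ) (u : ℂ) :
    Integrable fun t => sumModes N fun m => A u m t * z.φ m t := by
  obtain ⟨h, hc, hs, hh⟩ := hA.exists_density z
  simp only [hh]
  exact Continuous.integrable_of_hasCompactSupport (by fun_prop) hs.mul_right

theorem IsField.differentiable_pairing {A : ℂ → Exponent} (hA : IsField A)
    (z : CoherentLabel N ℏ) : Differentiable ℂ fun u => pairing z (A u) := by
  obtain ⟨h, hc, hs, hh⟩ := hA.exists_density z
  simp only [pairing, hh]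
  exact differentiable_integral_mul_exp hc hs

theorem pairing_add {A B : ℂ → Exponent} (hA : IsField A) (hB : IsField B)
    (z : CoherentLabel N ℏ) (u v : ℂ) :
    pairing z (A u + B v) = pairing z (A u) + pairing z (B v) := by
  rw [pairing, pairing, pairing, ← integral_add (hA.integrable z u) (hB.integrable z v)]
  congr 1; ext t
  rw [← sumModes_add]
  congr 1; ext m
  simp [add_mul]

theorem matrixElement_single (z : CoherentLabel N ℏ) (A : Exponent) (a : ℂ) :
    matrixElement z (AddMonoidAlgebra.single A a) = a * Complex.exp (pairing z A) := by
  simp [matrixElement, pairing]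

theorem matrixElement_vertex (z : CoherentLabel N ℏ) (A : Exponent) :
    matrixElement z (vertex A) = Complex.exp (pairing z A) := by
  simp [vertex, matrixElement_single]

theorem matrixElement_zero (z : CoherentLabel N ℏ) : matrixElement z 0 = 0 := by
  simp [matrixElement]

theorem matrixElement_add (z : CoherentLabel N ℏ) (P Q : NormalOrdered) :
    matrixElement z (P + Q) = matrixElement z P + matrixElement z Q := by
  classical
  simp only [matrixElement, AddMonoidAlgebra.coeff_add]
  exact Finsupp.sum_add_index' (by simp) fun A a b => add_mul _ _ _

/-! ### Bilinearity of the operator product -/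

theorem opProduct_zero_left (Q : NormalOrdered) : opProduct N k ℏ 0 Q = 0 := by
  simp [opProduct]

theorem opProduct_zero_right (P : NormalOrdered) : opProduct N k ℏ P 0 = 0 := by
  simp [opProduct]

theorem opProduct_add_left (P P' Q : NormalOrdered) :
    opProduct N k ℏ (P + P') Q = opProduct N k ℏ P Q + opProduct N k ℏ P' Q := by
  classical
  simp only [opProduct, AddMonoidAlgebra.coeff_add]
  refine Finsupp.sum_add_index' (by simp) fun A a b => ?_
  simp only [add_mul, AddMonoidAlgebra.single_add, Finsupp.sum_add]

theorem opProduct_add_right (P Q Q' : NormalOrdered) :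
    opProduct N k ℏ P (Q + Q') = opProduct N k ℏ P Q + opProduct N k ℏ P Q' := by
  classical
  simp only [opProduct, AddMonoidAlgebra.coeff_add]
  rw [← Finsupp.sum_add]
  refine Finset.sum_congr rfl fun A _ => ?_
  refine Finsupp.sum_add_index' (by simp) fun B a b => ?_
  simp only [mul_add, add_mul, AddMonoidAlgebra.single_add]

theorem opProduct_single (A B : Exponent) (a b : ℂ) :
    opProduct N k ℏ (AddMonoidAlgebra.single A a) (AddMonoidAlgebra.single B b)
      = AddMonoidAlgebra.single (A + B) (a * b * Complex.exp (contraction N k ℏ A B)) := by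
  simp [opProduct]

theorem ProductConverges.add_left {P P' Q : NormalOrdered} (h : ProductConverges N k ℏ P Q)
    (h' : ProductConverges N k ℏ P' Q) : ProductConverges N k ℏ (P + P') Q := by
  classical
  intro A hA B hB
  rw [AddMonoidAlgebra.coeff_add] at hA
  rcases Finset.mem_union.1 (Finsupp.support_add hA) with h1 | h1
  exacts [h A h1 B hB, h' A h1 B hB]

theorem ProductConverges.add_right {P Q Q' : NormalOrdered} (h : ProductConverges N k ℏ P Q)
    (h' : ProductConverges N k ℏ P Q') : ProductConverges N k ℏ P (Q + Q') := by
  classical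
  intro A hA B hB
  rw [AddMonoidAlgebra.coeff_add] at hB
  rcases Finset.mem_union.1 (Finsupp.support_add hB) with h1 | h1
  exacts [h A hA B h1, h' A hA B h1]

theorem ContinuesTo.zero_left (Q : ℂ → NormalOrdered) :
    ContinuesTo N k ℏ (fun _ => 0) Q (fun _ _ _ => 0) :=
  ⟨0, fun u v _ => ⟨by intro A hA; simp at hA, fun z => by
    rw [opProduct_zero_left, matrixElement_zero]⟩⟩

theorem ContinuesTo.zero_right (P : ℂ → NormalOrdered) :
    ContinuesTo N k ℏ P (fun _ => 0) (fun _ _ _ => 0) :=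
  ⟨0, fun u v _ => ⟨by intro A _ B hB; simp at hB, fun z => by
    rw [opProduct_zero_right, matrixElement_zero]⟩⟩

theorem ContinuesTo.add_left {P P' Q : ℂ → NormalOrdered} {T T' : ℂ → ℂ → CoherentLabel N ℏ → ℂ}
    (h : ContinuesTo N k ℏ P Q T) (h' : ContinuesTo N k ℏ P' Q T') :
    ContinuesTo N k ℏ (fun u => P u + P' u) Q (fun u v z => T u v z + T' u v z) := by
  obtain ⟨r, h⟩ := h
  obtain ⟨r', h'⟩ := h'
  refine ⟨max r r', fun u v huv => ?_⟩
  have h1 := h u v (huv.trans_le (neg_le_neg (le_max_left _ _)))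
  have h2 := h' u v (huv.trans_le (neg_le_neg (le_max_right _ _)))
  exact ⟨h1.1.add_left h2.1, fun z => by
    rw [opProduct_add_left, matrixElement_add, h1.2, h2.2]⟩

theorem ContinuesTo.add_right {P Q Q' : ℂ → NormalOrdered} {T T' : ℂ → ℂ → CoherentLabel N ℏ → ℂ}
    (h : ContinuesTo N k ℏ P Q T) (h' : ContinuesTo N k ℏ P Q' T') :
    ContinuesTo N k ℏ P (fun v => Q v + Q' v) (fun u v z => T u v z + T' u v z) := by
  obtain ⟨r, h⟩ := h
  obtain ⟨r', h'⟩ := h'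
  refine ⟨max r r', fun u v huv => ?_⟩
  have h1 := h u v (huv.trans_le (neg_le_neg (le_max_left _ _)))
  have h2 := h' u v (huv.trans_le (neg_le_neg (le_max_right _ _)))
  exact ⟨h1.1.add_right h2.1, fun z => by
    rw [opProduct_add_right, matrixElement_add, h1.2, h2.2]⟩

variable (N k ℏ) in
/-- An operator product expansion in which the continuations of `P(u) Q(v)` and `Q(v) P(u)` carry
the prefactors `f(u, v)` and `g(u, v)`. -/
def Expansion (f g : ℂ → ℂ → ℂ) (P Q : ℂ → NormalOrdered)
    (s : ℂ → ℂ → CoherentLabel N ℏ → ℂ) : Prop :=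
  ∃ R : ℂ → ℂ → CoherentLabel N ℏ → ℂ, IsRegular R ∧
    ContinuesTo N k ℏ P Q (fun u v z => (R u v z + s u v z) * f u v) ∧
    ContinuesTo N k ℏ Q P (fun v u z => (R u v z + s u v z) * g u v)

theorem IsRegular.zero : IsRegular (fun _ _ _ => 0 : ℂ → ℂ → CoherentLabel N ℏ → ℂ) :=
  fun _ => differentiable_const _

theorem IsRegular.add {R R' : ℂ → ℂ → CoherentLabel N ℏ → ℂ} (h : IsRegular R)
    (h' : IsRegular R') : IsRegular fun u v z => R u v z + R' u v z :=
  fun z => (h z).add (h' z)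

/-! ### Expansions are stable under finite sums -/

namespace Expansion

variable {f g : ℂ → ℂ → ℂ} {P P' Q Q' : ℂ → NormalOrdered}
  {s s' : ℂ → ℂ → CoherentLabel N ℏ → ℂ}

theorem add_left (h : Expansion N k ℏ f g P Q s) (h' : Expansion N k ℏ f g P' Q s') :
    Expansion N k ℏ f g (fun u => P u + P' u) Q (fun u v z => s u v z + s' u v z) := by
  obtain ⟨R, hR, h1, h2⟩ := h
  obtain ⟨R', hR', h1', h2'⟩ := h'
  refine ⟨_, hR.add hR', ?_, ?_⟩
  · convert h1.add_left h1' using 4; ring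
  · convert h2.add_right h2' using 4; ring

theorem add_right (h : Expansion N k ℏ f g P Q s) (h' : Expansion N k ℏ f g P Q' s') :
    Expansion N k ℏ f g P (fun v => Q v + Q' v) (fun u v z => s u v z + s' u v z) := by
  obtain ⟨R, hR, h1, h2⟩ := h
  obtain ⟨R', hR', h1', h2'⟩ := h'
  refine ⟨_, hR.add hR', ?_, ?_⟩
  · convert h1.add_right h1' using 4; ring
  · convert h2.add_left h2' using 4; ring

theorem zero_left : Expansion N k ℏ f g (fun _ => 0) Q (fun _ _ _ => 0) :=
  ⟨_, IsRegular.zero, by simpa using ContinuesTo.zero_left Q, by simpa using ContinuesTo.zero_right Q⟩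

theorem zero_right : Expansion N k ℏ f g P (fun _ => 0) (fun _ _ _ => 0) :=
  ⟨_, IsRegular.zero, by simpa using ContinuesTo.zero_right P, by simpa using ContinuesTo.zero_left P⟩

theorem sum_left {ι : Type*} (S : Finset ι) {P : ι → ℂ → NormalOrdered}
    {s : ι → ℂ → ℂ → CoherentLabel N ℏ → ℂ} (h : ∀ i ∈ S, Expansion N k ℏ f g (P i) Q (s i)) :
    Expansion N k ℏ f g (fun u => ∑ i ∈ S, P i u) Q (fun u v z => ∑ i ∈ S, s i u v z) := by
  classical
  induction S using Finset.induction_on with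
  | empty => simpa using zero_left
  | insert a S ha ih =>
    simp only [Finset.sum_insert ha]
    exact (h a (Finset.mem_insert_self a S)).add_left (ih fun i hi => h i (Finset.mem_insert_of_mem hi))

theorem sum_right {ι : Type*} (S : Finset ι) {Q : ι → ℂ → NormalOrdered}
    {s : ι → ℂ → ℂ → CoherentLabel N ℏ → ℂ} (h : ∀ i ∈ S, Expansion N k ℏ f g P (Q i) (s i)) :
    Expansion N k ℏ f g P (fun u => ∑ i ∈ S, Q i u) (fun u v z => ∑ i ∈ S, s i u v z) := by
  classical
  induction S using Finset.induction_on with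
  | empty => simpa using zero_right
  | insert a S ha ih =>
    simp only [Finset.sum_insert ha]
    exact (h a (Finset.mem_insert_self a S)).add_right (ih fun i hi => h i (Finset.mem_insert_of_mem hi))

/-- Reduces the product of two currents to pairs of single vertex operators; the polar parts are
collected so that they can cancel afterwards. -/
theorem sum_sum {ι κ : Type*} (S : Finset ι) (T : Finset κ) {P : ι → ℂ → NormalOrdered}
    {Q : κ → ℂ → NormalOrdered} {s : ι → κ → ℂ → ℂ → CoherentLabel N ℏ → ℂ}
    (h : ∀ i ∈ S, ∀ j ∈ T, Expansion N k ℏ f g (P i) (Q j) (s i j)) :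
    Expansion N k ℏ f g (fun u => ∑ i ∈ S, P i u) (fun v => ∑ j ∈ T, Q j v)
      (fun u v z => ∑ i ∈ S, ∑ j ∈ T, s i j u v z) :=
  sum_left S fun i hi => sum_right T fun j hj => h i hi j hj

end Expansion

theorem ope_iff_expansion {P Q : ℂ → NormalOrdered} {s : ℂ → ℂ → CoherentLabel N ℏ → ℂ} :
    OPE N k ℏ P Q s ↔ Expansion N k ℏ (fun _ _ => 1) (fun _ _ => 1) P Q s := by
  simp only [OPE, Expansion, mul_one]

/-! ### Contractions -/

/-- The function `e^{-izt} e^{sℏt} / t`. -/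
noncomputable def elem (ℏ : ℝ) (z : ℂ) (t : ℝ) (s : ℂ) : ℂ :=
  Complex.exp (-(Complex.I * z * t)) * Complex.exp (s * ℏ * t) / t

variable (N k ℏ) in
/-- The contraction of `A(u)` and `B(v)` has the integrand `(e^{sℏt} - e^{s'ℏt}) e^{-i(u-v)t} / t`,
so that its exponential is `(u - v + s' iℏ) / (u - v + s iℏ)`. -/
def HasSymbol (A B : ℂ → Exponent) (s s' : ℂ) : Prop :=
  ∀ u v : ℂ, ∀ t : ℝ, 0 < t →
    contractionIntegrand N k ℏ (A u) (B v) t = elem ℏ (u - v) t s - elem ℏ (u - v) t s'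

/-- As `-i · (s iℏ) = sℏ`, an exponential weight is a shift of the spectral parameter; this
translates coefficients of a contraction into positions of zeros and poles. -/
theorem elem_eq (z : ℂ) (t : ℝ) (s : ℂ) :
    elem ℏ z t s = Complex.exp (-(Complex.I * (z + s * Complex.I * ℏ) * t)) / t := by
  rw [elem, ← Complex.exp_add]
  congr 2
  linear_combination (s * ℏ * t) * Complex.I_sq

/-- The Frullani formula applies with `p = i(u - v + s iℏ)` and `q = i(u - v + s' iℏ)`, whose real
parts are positive as soon as `Im (u - v)` is negative enough; the factor `i` drops out of `q / p`.
-/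
theorem HasSymbol.continuesTo {A B : ℂ → Exponent} {s s' : ℂ} (h : HasSymbol N k ℏ A B s s')
    (a b : ℂ) :
    ∃ r : ℝ, ∀ u v : ℂ, (u - v).im < -r →
      u - v + s * Complex.I * ℏ ≠ 0 ∧
      ProductConverges N k ℏ (AddMonoidAlgebra.single (A u) a) (AddMonoidAlgebra.single (B v) b) ∧
      ∀ z : CoherentLabel N ℏ, matrixElement z
        (opProduct N k ℏ (AddMonoidAlgebra.single (A u) a) (AddMonoidAlgebra.single (B v) b))
        = a * b * ((u - v + s' * Complex.I * ℏ) / (u - v + s * Complex.I * ℏ))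
          * Complex.exp (pairing z (A u + B v)) := by
  -- This bound pushes the zero and the pole of the fraction out of the region at the same time.
  refine ⟨|(s * Complex.I * ℏ).im| + |(s' * Complex.I * ℏ).im|, fun u v huv => ?_⟩
  have hs : (u - v + s * Complex.I * ℏ).im < 0 := by
    rw [Complex.add_im]
    have := le_abs_self (s * Complex.I * ℏ).im
    have := abs_nonneg (s' * Complex.I * ℏ).im
    linarith
  have hs' : (u - v + s' * Complex.I * ℏ).im < 0 := by
    rw [Complex.add_im]
    have := le_abs_self (s' * Complex.I * ℏ).im
    have := abs_nonneg (s * Complex.I * ℏ).im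
    linarith
  have hne : u - v + s * Complex.I * ℏ ≠ 0 := fun h0 => by simp [h0] at hs
  obtain ⟨hi, he⟩ := frullani_exp (p := Complex.I * (u - v + s * Complex.I * ℏ))
    (q := Complex.I * (u - v + s' * Complex.I * ℏ))
    (by rw [Complex.I_mul_re]; linarith) (by rw [Complex.I_mul_re]; linarith)
  have hcong : ∀ t ∈ Ioi (0 : ℝ), contractionIntegrand N k ℏ (A u) (B v) t
      = (Complex.exp (-(Complex.I * (u - v + s * Complex.I * ℏ) * t))
        - Complex.exp (-(Complex.I * (u - v + s' * Complex.I * ℏ) * t))) / t := fun t ht => by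
    rw [h u v t ht, elem_eq, elem_eq, sub_div]
  have hint := (integrableOn_congr_fun hcong measurableSet_Ioi).2 hi
  refine ⟨hne, ?_, fun z => ?_⟩
  · intro A' hA B' hB
    simp only [AddMonoidAlgebra.coeff_single] at hA hB
    rw [Finset.mem_singleton.1 (Finsupp.support_single_subset hA),
      Finset.mem_singleton.1 (Finsupp.support_single_subset hB)]
    exact hint
  · rw [opProduct_single, matrixElement_single, contraction,
      setIntegral_congr_fun measurableSet_Ioi hcong, he,
      mul_div_mul_left _ _ Complex.I_ne_zero]

variable (N k ℏ) in
/-- The contraction factors of `A(u) B(v)` and `B(v) A(u)` continue to the same function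
`(u - v + s' iℏ) / (u - v + s iℏ)`. -/
def IsLocal (A B : ℂ → Exponent) (s s' : ℂ) : Prop :=
  HasSymbol N k ℏ A B s s' ∧ HasSymbol N k ℏ B A (-s) (-s')

/-- The contraction factor is `1 + (s' - s) iℏ / (u - v + s iℏ)`. Freezing the `u`-dependence of its
second summand at the pole `u = v - s iℏ` gives the polar part; what is left is a difference
quotient in `u`. For `s = s'` there is no pole. -/
theorem IsLocal.expansion {A B : ℂ → Exponent} {s s' : ℂ} (h : IsLocal N k ℏ A B s s')
    (hA : IsField A) (hB : IsField B) (a b : ℂ) :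
    Expansion N k ℏ (fun _ _ => 1) (fun _ _ => 1) (fun u => AddMonoidAlgebra.single (A u) a)
      (fun v => AddMonoidAlgebra.single (B v) b)
      (fun u v z => a * b * ((s' - s) * Complex.I * ℏ / (u - v + s * Complex.I * ℏ))
        * matrixElement z (vertex (A (sh ℏ v (-s)) + B v))) := by
  have hAd : ∀ z : CoherentLabel N ℏ, Differentiable ℂ fun u => Complex.exp (pairing z (A u)) :=
    fun z => (hA.differentiable_pairing z).cexp
  have hBd : ∀ z : CoherentLabel N ℏ, Differentiable ℂ fun u => Complex.exp (pairing z (B u)) :=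
    fun z => (hB.differentiable_pairing z).cexp
  let R : ℂ → ℂ → CoherentLabel N ℏ → ℂ := fun u v z =>
    a * b * (Complex.exp (pairing z (A u)) + (s' - s) * Complex.I * ℏ *
      diffQuot (fun u => Complex.exp (pairing z (A u))) (sh ℏ v (-s), u))
      * Complex.exp (pairing z (B v))
  have key : ∀ u v z, u - v + s * Complex.I * ℏ ≠ 0 →
      R u v z + a * b * ((s' - s) * Complex.I * ℏ / (u - v + s * Complex.I * ℏ))
        * matrixElement z (vertex (A (sh ℏ v (-s)) + B v))
      = a * b * ((u - v + s' * Complex.I * ℏ) / (u - v + s * Complex.I * ℏ))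
          * Complex.exp (pairing z (A u + B v)) := by
    intro u v z hne
    have h1 := mul_diffQuot (hAd z) (sh ℏ v (-s)) u
    have h2 : u - sh ℏ v (-s) = u - v + s * Complex.I * ℏ := by rw [sh]; ring
    rw [h2] at h1
    simp only [R, matrixElement_vertex, pairing_add hA hB, Complex.exp_add]
    field_simp
    linear_combination (a * b * (s' - s) * Complex.I * ℏ) * h1
  refine ⟨R, fun z => ?_, ?_, ?_⟩
  · have h1 : Differentiable ℂ fun p : ℂ × ℂ => Complex.exp (pairing z (A p.1)) :=
      (hAd z).comp differentiable_fst
    have h2 : Differentiable ℂ fun p : ℂ × ℂ => Complex.exp (pairing z (B p.2)) :=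
      (hBd z).comp differentiable_snd
    have h3 : Differentiable ℂ fun p : ℂ × ℂ =>
        diffQuot (fun u => Complex.exp (pairing z (A u))) (sh ℏ p.2 (-s), p.1) :=
      (differentiable_diffQuot (hAd z)).comp (by unfold sh; fun_prop)
    simp only [R]
    exact ((differentiable_const _).mul (h1.add ((differentiable_const _).mul h3))).mul h2
  · obtain ⟨r, hr⟩ := h.1.continuesTo a b
    refine ⟨r, fun u v huv => ⟨(hr u v huv).2.1, fun z => ?_⟩⟩
    beta_reduce
    rw [(hr u v huv).2.2, mul_one, key u v z (hr u v huv).1]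
  · obtain ⟨r, hr⟩ := h.2.continuesTo b a
    refine ⟨r, fun v u huv => ⟨(hr v u huv).2.1, fun z => ?_⟩⟩
    have hne := (hr v u huv).1
    have hne' : u - v + s * Complex.I * ℏ ≠ 0 := fun h0 => hne (by linear_combination -h0)
    beta_reduce
    rw [(hr v u huv).2.2, mul_one, key u v z hne', add_comm (B v)]
    congr 1
    -- Exchanging `u` and `v` and negating both shifts changes the sign of numerator and denominator
    -- together, so the fraction is the same.
    rw [mul_comm b a, ← neg_div_neg_eq]
    congr 2 <;> ring_nf

/-- For pairs whose two orders have different fractions: the first is `q(z) / (z - c)` and the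
second `q(z) / (z + c)` with the same `q`, where `z = u - v`. The hypotheses on `q` are these
equalities with denominators cleared, so cancelling zeros and poles need no case distinction. -/
theorem HasSymbol.expansion {A B : ℂ → Exponent} {s₁ s₁' s₂ s₂' c : ℂ}
    (h₁ : HasSymbol N k ℏ A B s₁ s₁') (h₂ : HasSymbol N k ℏ B A s₂ s₂')
    (hA : IsField A) (hB : IsField B) (a b : ℂ) (q : ℂ → ℂ) (hq : Differentiable ℂ q)
    (hq₁ : ∀ z, (z + s₁' * Complex.I * ℏ) * (z - c) = q z * (z + s₁ * Complex.I * ℏ))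
    (hq₂ : ∀ z, (z - s₂' * Complex.I * ℏ) * (z + c) = q z * (z - s₂ * Complex.I * ℏ)) :
    Expansion N k ℏ (fun u v => 1 / (u - v - c)) (fun u v => 1 / (u - v + c))
      (fun u => AddMonoidAlgebra.single (A u) a) (fun v => AddMonoidAlgebra.single (B v) b)
      (fun _ _ _ => 0) := by
  have hAd : ∀ z : CoherentLabel N ℏ, Differentiable ℂ fun u => Complex.exp (pairing z (A u)) :=
    fun z => (hA.differentiable_pairing z).cexp
  have hBd : ∀ z : CoherentLabel N ℏ, Differentiable ℂ fun u => Complex.exp (pairing z (B u)) :=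
    fun z => (hB.differentiable_pairing z).cexp
  -- The prefactors have their own pole at `±c`, which the region of convergence must also avoid.
  have hcne : ∀ w : ℂ, w.im < -|c.im| → w - c ≠ 0 := fun w hw h0 => by
    have h1 : w.im = c.im := by rw [sub_eq_zero.1 h0]
    have := neg_abs_le c.im
    linarith
  refine ⟨fun u v z => a * b * q (u - v) * (Complex.exp (pairing z (A u)) *
    Complex.exp (pairing z (B v))), fun z => ?_, ?_, ?_⟩
  · have h1 : Differentiable ℂ fun p : ℂ × ℂ => Complex.exp (pairing z (A p.1)) :=
      (hAd z).comp differentiable_fst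
    have h2 : Differentiable ℂ fun p : ℂ × ℂ => Complex.exp (pairing z (B p.2)) :=
      (hBd z).comp differentiable_snd
    have h3 : Differentiable ℂ fun p : ℂ × ℂ => q (p.1 - p.2) := hq.comp (by fun_prop)
    exact ((differentiable_const _).mul h3).mul (h1.mul h2)
  · obtain ⟨r, hr⟩ := h₁.continuesTo a b
    refine ⟨max r |c.im|, fun u v huv => ?_⟩
    obtain ⟨hne, hconv, hm⟩ := hr u v (huv.trans_le (neg_le_neg (le_max_left _ _)))
    have hc := hcne _ (huv.trans_le (neg_le_neg (le_max_right _ _)))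
    refine ⟨hconv, fun z => ?_⟩
    have hfrac : (u - v + s₁' * Complex.I * ℏ) / (u - v + s₁ * Complex.I * ℏ)
        = q (u - v) / (u - v - c) := by
      rw [div_eq_div_iff hne hc]
      linear_combination hq₁ (u - v)
    rw [hm, hfrac, pairing_add hA hB, Complex.exp_add]
    ring
  · obtain ⟨r, hr⟩ := h₂.continuesTo b a
    refine ⟨max r |c.im|, fun v u huv => ?_⟩
    obtain ⟨hne, hconv, hm⟩ := hr v u (huv.trans_le (neg_le_neg (le_max_left _ _)))
    have hc := hcne _ (huv.trans_le (neg_le_neg (le_max_right _ _)))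
    have hc' : u - v + c ≠ 0 := fun h0 => hc (by linear_combination -h0)
    have hne' : u - v - s₂ * Complex.I * ℏ ≠ 0 := fun h0 => hne (by linear_combination -h0)
    refine ⟨hconv, fun z => ?_⟩
    have hfrac : (v - u + s₂' * Complex.I * ℏ) / (v - u + s₂ * Complex.I * ℏ)
        = q (u - v) / (u - v + c) := by
      rw [div_eq_div_iff hne hc']
      linear_combination -hq₂ (u - v)
    rw [hm, hfrac, pairing_add hB hA, Complex.exp_add]
    ring

end YangianFreeField

namespace YangianFreeField

/-! ### Pairings of the generating fields -/

variable {N : ℕ} {k : ℂ} {ℏ : ℝ}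

theorem contractionIntegrand_add_left (A A' B : Exponent) (t : ℝ) :
    contractionIntegrand N k ℏ (A + A') B t
      = contractionIntegrand N k ℏ A B t + contractionIntegrand N k ℏ A' B t := by
  simp only [contractionIntegrand, Pi.add_apply, add_mul, sumModes_add]

theorem contractionIntegrand_neg_left (A B : Exponent) (t : ℝ) :
    contractionIntegrand N k ℏ (-A) B t = -contractionIntegrand N k ℏ A B t := by
  simp only [contractionIntegrand, Pi.neg_apply, neg_mul, sumModes_neg]

theorem contractionIntegrand_sub_left (A A' B : Exponent) (t : ℝ) :
    contractionIntegrand N k ℏ (A - A') B t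
      = contractionIntegrand N k ℏ A B t - contractionIntegrand N k ℏ A' B t := by
  rw [sub_eq_add_neg, contractionIntegrand_add_left, contractionIntegrand_neg_left, sub_eq_add_neg]

theorem contractionIntegrand_sum_left {ι : Type*} (S : Finset ι) (A : ι → Exponent)
    (B : Exponent) (t : ℝ) :
    contractionIntegrand N k ℏ (∑ i ∈ S, A i) B t
      = ∑ i ∈ S, contractionIntegrand N k ℏ (A i) B t := by
  simp only [contractionIntegrand, Finset.sum_apply, Finset.sum_mul, sumModes_sum]

theorem contractionIntegrand_add_right (A B B' : Exponent) (t : ℝ) :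
    contractionIntegrand N k ℏ A (B + B') t
      = contractionIntegrand N k ℏ A B t + contractionIntegrand N k ℏ A B' t := by
  simp only [contractionIntegrand, Pi.add_apply, mul_add, add_mul, sumModes_add]

theorem contractionIntegrand_neg_right (A B : Exponent) (t : ℝ) :
    contractionIntegrand N k ℏ A (-B) t = -contractionIntegrand N k ℏ A B t := by
  simp only [contractionIntegrand, Pi.neg_apply, neg_mul, mul_neg, sumModes_neg]

theorem contractionIntegrand_sub_right (A B B' : Exponent) (t : ℝ) :
    contractionIntegrand N k ℏ A (B - B') t
      = contractionIntegrand N k ℏ A B t - contractionIntegrand N k ℏ A B' t := by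
  rw [sub_eq_add_neg, contractionIntegrand_add_right, contractionIntegrand_neg_right,
    sub_eq_add_neg]

theorem contractionIntegrand_sum_right {ι : Type*} (S : Finset ι) (A : Exponent)
    (B : ι → Exponent) (t : ℝ) :
    contractionIntegrand N k ℏ A (∑ i ∈ S, B i) t
      = ∑ i ∈ S, contractionIntegrand N k ℏ A (B i) t := by
  simp only [contractionIntegrand, Finset.sum_apply, Finset.mul_sum, Finset.sum_mul, sumModes_sum]

/-- Collapses the mode sum to one boson. The range condition remains in the answer because fields
with labels outside `1 ≤ i < j ≤ N` occur in the products and contribute nothing. -/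
theorem sumModes_single_b (i j : ℕ) (g : Mode → ℂ)
    (hg : ∀ m, (∀ i' j', m = .b i' j' → ¬(i < j ∧ i' = i ∧ j' = j)) → g m = 0) :
    sumModes N g = if 1 ≤ i ∧ i < j ∧ j ≤ N then g (.b i j) else 0 := by
  have h1 : ∀ a, g (.lam a) = 0 := fun a => hg _ (by simp)
  have h2 : ∀ a b, g (.c a b) = 0 := fun a b => hg _ (by simp)
  obtain ⟨e, he⟩ : ∃ e, e = g (.b i j) := ⟨_, rfl⟩
  rw [← he]
  have h3 : ∀ a b, g (.b a b) = if a = i then (if b = j then (if i < j then e else 0) else 0) else 0 := by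
    intro a b
    split_ifs with ha hb hij
    · rw [ha, hb, he]
    · exact hg _ (by simp [hij])
    · exact hg _ (by rintro _ _ ⟨⟩; simp [hb])
    · exact hg _ (by rintro _ _ ⟨⟩; simp [ha])
  simp only [sumModes, h1, h2, Finset.sum_const_zero, zero_add, add_zero]
  simp only [h3]
  have h4 : ∀ a, (∑ b ∈ Finset.Ioc a N, if a = i then (if b = j then (if i < j then e else 0) else 0) else 0)
      = if a = i then (if j ∈ Finset.Ioc i N then (if i < j then e else 0) else 0) else 0 := by
    intro a
    by_cases ha : a = i
    · simp only [ha, if_true, Finset.sum_ite_eq']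
    · simp [ha]
  simp only [h4, Finset.sum_ite_eq', Finset.mem_Icc, Finset.mem_Ioc]
  split_ifs <;> first | rfl | omega

theorem sumModes_single_c (i j : ℕ) (g : Mode → ℂ)
    (hg : ∀ m, (∀ i' j', m = .c i' j' → ¬(i < j ∧ i' = i ∧ j' = j)) → g m = 0) :
    sumModes N g = if 1 ≤ i ∧ i < j ∧ j ≤ N then g (.c i j) else 0 := by
  have h1 : ∀ a, g (.lam a) = 0 := fun a => hg _ (by simp)
  have h2 : ∀ a b, g (.b a b) = 0 := fun a b => hg _ (by simp)
  obtain ⟨e, he⟩ : ∃ e, e = g (.c i j) := ⟨_, rfl⟩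
  rw [← he]
  have h3 : ∀ a b, g (.c a b) = if a = i then (if b = j then (if i < j then e else 0) else 0) else 0 := by
    intro a b
    split_ifs with ha hb hij
    · rw [ha, hb, he]
    · exact hg _ (by simp [hij])
    · exact hg _ (by rintro _ _ ⟨⟩; simp [hb])
    · exact hg _ (by rintro _ _ ⟨⟩; simp [ha])
  simp only [sumModes, h1, h2, Finset.sum_const_zero, zero_add]
  simp only [h3]
  have h4 : ∀ a, (∑ b ∈ Finset.Ioc a N, if a = i then (if b = j then (if i < j then e else 0) else 0) else 0)
      = if a = i then (if j ∈ Finset.Ioc i N then (if i < j then e else 0) else 0) else 0 := by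
    intro a
    by_cases ha : a = i
    · simp only [ha, if_true, Finset.sum_ite_eq']
    · simp [ha]
  simp only [h4, Finset.sum_ite_eq', Finset.mem_Icc, Finset.mem_Ioc]
  split_ifs <;> first | rfl | omega

theorem sumModes_single_lam (i : ℕ) (g : Mode → ℂ)
    (hg : ∀ m, m ≠ .lam i → g m = 0) :
    sumModes N g = if 1 ≤ i ∧ i ≤ N then g (.lam i) else 0 := by
  have h1 : ∀ a b, g (.b a b) = 0 := fun a b => hg _ (by simp)
  have h2 : ∀ a b, g (.c a b) = 0 := fun a b => hg _ (by simp)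
  obtain ⟨e, he⟩ : ∃ e, e = g (.lam i) := ⟨_, rfl⟩
  rw [← he]
  have h3 : ∀ a, g (.lam a) = if a = i then e else 0 := by
    intro a
    split_ifs with ha
    · rw [ha, he]
    · exact hg _ (by simp [ha])
  simp only [sumModes, h1, h2, Finset.sum_const_zero, add_zero]
  simp only [h3, Finset.sum_ite_eq', Finset.mem_Icc]

theorem contractionIntegrand_bExp_left (i j : ℕ) (f : ℝ → ℂ) (B : Exponent) (t : ℝ) :
    contractionIntegrand N k ℏ (bExp i j f) B t = if 1 ≤ i ∧ i < j ∧ j ≤ N then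
      f t * B (.b i j) (-t) * (-(1 / (ℏ ^ 2 * t)) * Complex.sinh (ℏ * t / 2) ^ 2) else 0 := by
  rw [contractionIntegrand, sumModes_single_b i j]
  · split_ifs with h
    · rw [sumModes_single_b i j, if_pos h]
      · simp [bExp, commutator, h.2.1]
      · rintro (_ | ⟨i', j'⟩ | _) hm
        · simp [commutator]
        · have := hm i' j' rfl
          have h' : ¬(i = i' ∧ j = j') := fun h'' => this ⟨h.2.1, h''.1.symm, h''.2.symm⟩
          simp [commutator, h']
        · simp [commutator]
    · rfl
  · rintro (_ | ⟨i', j'⟩ | _) hm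
    · simp [bExp, sumModes_zero]
    · have := hm i' j' rfl
      simp [bExp, this, sumModes_zero]
    · simp [bExp, sumModes_zero]

theorem contractionIntegrand_cExp_left (i j : ℕ) (f : ℝ → ℂ) (B : Exponent) (t : ℝ) :
    contractionIntegrand N k ℏ (cExp i j f) B t = if 1 ≤ i ∧ i < j ∧ j ≤ N then
      f t * B (.c i j) (-t) * (1 / (ℏ ^ 2 * t) * Complex.sinh (ℏ * t / 2) ^ 2) else 0 := by
  rw [contractionIntegrand, sumModes_single_c i j]
  · split_ifs with h
    · rw [sumModes_single_c i j, if_pos h]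
      · simp [cExp, commutator, h.2.1]
      · rintro (_ | _ | ⟨i', j'⟩) hm
        · simp [commutator]
        · simp [commutator]
        · have := hm i' j' rfl
          have h' : ¬(i = i' ∧ j = j') := fun h'' => this ⟨h.2.1, h''.1.symm, h''.2.symm⟩
          simp [commutator, h']
    · rfl
  · rintro (_ | _ | ⟨i', j'⟩) hm
    · simp [cExp, sumModes_zero]
    · simp [cExp, sumModes_zero]
    · have := hm i' j' rfl
      simp [cExp, this, sumModes_zero]

theorem contractionIntegrand_lamExp_lamExp (i j : ℕ) (f g : ℝ → ℂ) (t : ℝ) (hi : 1 ≤ i)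
    (hi' : i ≤ N) (hj : 1 ≤ j) (hj' : j ≤ N) :
    contractionIntegrand N k ℏ (lamExp i f) (lamExp j g) t
      = f t * g (-t) * commutator N k ℏ (.lam i) (.lam j) t := by
  rw [contractionIntegrand, sumModes_single_lam i, if_pos ⟨hi, hi'⟩, sumModes_single_lam j,
    if_pos ⟨hj, hj'⟩]
  · simp [lamExp]
  · rintro (a | _ | _) hm
    · have : a ≠ j := fun h => hm (by rw [h])
      simp [lamExp, this]
    · simp [lamExp]
    · simp [lamExp]
  · rintro (a | _ | _) hm
    · have : a ≠ i := fun h => hm (by rw [h])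
      simp [lamExp, this, sumModes_zero]
    · simp [lamExp, sumModes_zero]
    · simp [lamExp, sumModes_zero]

/-- Integrand of the contraction of `b⁺(u)` with `(b+c)(v)` and of `(b+c)(u)` with `b⁻(v)`. -/
noncomputable def crossElem (ℏ : ℝ) (z : ℂ) (t : ℝ) (x : ℂ) : ℂ :=
  elem ℏ z t (x - 1 / 2) - elem ℏ z t (x + 1 / 2)

/-- Integrand of the contraction of `b⁺(u)` with `b⁻(v)`. -/
noncomputable def diagElem (ℏ : ℝ) (z : ℂ) (t : ℝ) (x : ℂ) : ℂ :=
  elem ℏ z t (x + 1) - 2 * elem ℏ z t x + elem ℏ z t (x - 1)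

theorem sinh_half_ne_zero (hℏ : ℏ ≠ 0) {t : ℝ} (ht : t ≠ 0) :
    Complex.sinh (ℏ * t / 2) ≠ 0 := by
  have h : Real.sinh (ℏ * t / 2) ≠ 0 := by
    rw [Ne, Real.sinh_eq_zero]
    simp [hℏ, ht]
  have : ((Real.sinh (ℏ * t / 2) : ℝ) : ℂ) ≠ 0 := by exact_mod_cast h
  simpa using this

theorem exp_mul_exp_shift (u v s s' : ℂ) (t : ℝ) :
    Complex.exp (-(Complex.I * sh ℏ u s * t)) * Complex.exp (-(Complex.I * sh ℏ v s' * (-t)))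
      = Complex.exp (-(Complex.I * (u - v) * t)) * Complex.exp ((s - s') * ℏ * t) := by
  rw [← Complex.exp_add, ← Complex.exp_add]
  congr 1
  simp only [sh]
  linear_combination (-(s - s') * ℏ * t) * Complex.I_sq

theorem elem_add (z : ℂ) (t : ℝ) (x y : ℂ) :
    elem ℏ z t (x + y) = Complex.exp (-(Complex.I * z * t)) * Complex.exp (x * ℏ * t) / t
      * Complex.exp (y * ℏ * t) := by
  rw [elem, add_mul, add_mul, Complex.exp_add]; ring

theorem crossElem_eq (z : ℂ) (t : ℝ) (x : ℂ) :
    crossElem ℏ z t x = -2 * Complex.sinh (ℏ * t / 2) / t *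
      (Complex.exp (-(Complex.I * z * t)) * Complex.exp (x * ℏ * t)) := by
  rw [crossElem, sub_eq_add_neg x, elem_add, elem_add, Complex.sinh]
  have h1 : -(1 / 2 : ℂ) * ℏ * t = -(ℏ * t / 2) := by ring
  have h2 : (1 / 2 : ℂ) * ℏ * t = ℏ * t / 2 := by ring
  rw [h1, h2]; ring

/-- Up to `1 / t`, a commutator with both factors `sinh` is a second difference of exponentials, and
one with a single `sinh` (`crossElem`) a first difference. Hence sums of contractions with
consecutive shifts telescope. -/
theorem diagElem_eq (z : ℂ) (t : ℝ) (x : ℂ) :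
    diagElem ℏ z t x = 4 * Complex.sinh (ℏ * t / 2) ^ 2 / t *
      (Complex.exp (-(Complex.I * z * t)) * Complex.exp (x * ℏ * t)) := by
  have h0 : elem ℏ z t x = elem ℏ z t (x + 0) := by rw [add_zero]
  rw [diagElem, sub_eq_add_neg x, h0, elem_add, elem_add, elem_add, Complex.sinh]
  have h1 : (-1 : ℂ) * ℏ * t = -(ℏ * t / 2) + -(ℏ * t / 2) := by ring
  have h2 : (1 : ℂ) * ℏ * t = ℏ * t / 2 + ℏ * t / 2 := by ring
  rw [h1, h2, Complex.exp_add, Complex.exp_add, zero_mul, zero_mul, Complex.exp_zero]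
  have h3 : Complex.exp (ℏ * t / 2) * Complex.exp (-(ℏ * t / 2)) = 1 := by
    rw [← Complex.exp_add]; simp
  linear_combination (2 * (Complex.exp (-(Complex.I * z * t)) * Complex.exp (x * ℏ * t) / t)) * h3

/-! ### Contractions of the fields built from b and c -/

/-- The denominator of `b(1|v;0)` cancels one of the two factors `sinh` of the commutator; the
remaining one is a first difference. -/
theorem contractionIntegrand_bPlus_bc (hℏ : ℏ ≠ 0) {t : ℝ} (ht : 0 < t) (i j i' j' : ℕ) (u v s s' : ℂ) :
    contractionIntegrand N k ℏ (bPlus ℏ i j (sh ℏ u s)) (bc ℏ i' j' (sh ℏ v s')) t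
      = if i = i' ∧ j = j' ∧ 1 ≤ i ∧ i < j ∧ j ≤ N then crossElem ℏ (u - v) t (s - s') else 0 := by
  rw [bPlus, contractionIntegrand_bExp_left]
  have h1 := sinh_half_ne_zero hℏ ht.ne'
  have h2 : (t : ℂ) ≠ 0 := by exact_mod_cast ht.ne'
  have h3 : (ℏ : ℂ) ≠ 0 := by exact_mod_cast hℏ
  have h4 : Complex.sinh (1 / 2 * ℏ * -t) = -Complex.sinh (ℏ * t / 2) := by
    rw [← Complex.sinh_neg]; congr 1; ring
  by_cases h : i = i' ∧ j = j' ∧ 1 ≤ i ∧ i < j ∧ j ≤ N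
  · obtain ⟨rfl, rfl, h⟩ := h
    rw [if_pos h, if_pos ⟨rfl, rfl, h⟩, crossElem_eq, ← exp_mul_exp_shift]
    simp only [bc, Pi.add_apply, bExp, cExp, plusCoeff, fieldCoeff, h.2.1, ht, and_self, if_true, Left.neg_neg_iff,
      Complex.ofReal_neg, h4, zero_mul, Complex.exp_zero, mul_one, add_zero]
    field_simp
  · rw [if_neg h]
    split_ifs with h'
    · have : ¬(i' < j' ∧ i = i' ∧ j = j') := fun h'' => h ⟨h''.2.1, h''.2.2, h'⟩
      simp [bc, bExp, cExp, this]
    · rfl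

theorem contractionIntegrand_bPlus_bMinus (hℏ : ℏ ≠ 0) {t : ℝ} (ht : 0 < t) (i j i' j' : ℕ) (u v s s' : ℂ) :
    contractionIntegrand N k ℏ (bPlus ℏ i j (sh ℏ u s)) (bMinus ℏ i' j' (sh ℏ v s')) t
      = if i = i' ∧ j = j' ∧ 1 ≤ i ∧ i < j ∧ j ≤ N then diagElem ℏ (u - v) t (s - s') else 0 := by
  rw [bPlus, contractionIntegrand_bExp_left]
  have h2 : (t : ℂ) ≠ 0 := by exact_mod_cast ht.ne'
  have h3 : (ℏ : ℂ) ≠ 0 := by exact_mod_cast hℏ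
  by_cases h : i = i' ∧ j = j' ∧ 1 ≤ i ∧ i < j ∧ j ≤ N
  · obtain ⟨rfl, rfl, h⟩ := h
    rw [if_pos h, if_pos ⟨rfl, rfl, h⟩, diagElem_eq, ← exp_mul_exp_shift]
    simp only [bMinus, bExp, plusCoeff, minusCoeff, h.2.1, ht, and_self, if_true, Left.neg_neg_iff,
      Complex.ofReal_neg]
    field_simp
    ring
  · rw [if_neg h]
    split_ifs with h'
    · have : ¬(i' < j' ∧ i = i' ∧ j = j') := fun h'' => h ⟨h''.2.1, h''.2.2, h'⟩
      simp [bMinus, bExp, this]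
    · rfl

theorem contractionIntegrand_bc_bMinus (hℏ : ℏ ≠ 0) {t : ℝ} (ht : 0 < t) (i j i' j' : ℕ) (u v s s' : ℂ) :
    contractionIntegrand N k ℏ (bc ℏ i j (sh ℏ u s)) (bMinus ℏ i' j' (sh ℏ v s')) t
      = if i = i' ∧ j = j' ∧ 1 ≤ i ∧ i < j ∧ j ≤ N then crossElem ℏ (u - v) t (s - s') else 0 := by
  rw [bc, contractionIntegrand_add_left, contractionIntegrand_bExp_left,
    contractionIntegrand_cExp_left]
  have h1 := sinh_half_ne_zero hℏ ht.ne'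
  have h2 : (t : ℂ) ≠ 0 := by exact_mod_cast ht.ne'
  have h3 : (ℏ : ℂ) ≠ 0 := by exact_mod_cast hℏ
  have h4 : Complex.sinh (1 / 2 * ℏ * t) = Complex.sinh (ℏ * t / 2) := by congr 1; ring
  by_cases h : i = i' ∧ j = j' ∧ 1 ≤ i ∧ i < j ∧ j ≤ N
  · obtain ⟨rfl, rfl, h⟩ := h
    rw [if_pos h, if_pos h, if_pos ⟨rfl, rfl, h⟩, crossElem_eq, ← exp_mul_exp_shift]
    simp only [bMinus, bExp, minusCoeff, fieldCoeff, h.2.1, ht, ht.not_gt, and_self, if_true, if_false, Left.neg_neg_iff,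
      Complex.ofReal_neg, h4, zero_mul, neg_zero, Complex.exp_zero, mul_one, mul_zero, add_zero]
    field_simp
  · rw [if_neg h]
    split_ifs with h'
    · have : ¬(i' < j' ∧ i = i' ∧ j = j') := fun h'' => h ⟨h''.2.1, h''.2.2, h'⟩
      simp [bMinus, bExp, this]
    · simp

/-- A `+` field has no creation part, so on the right of a product it contributes zero; dually, a
`-` field contributes nothing on the left. -/
theorem contractionIntegrand_bPlus_bPlus {t : ℝ} (ht : 0 < t) (i j i' j' : ℕ) (w w' : ℂ) :
    contractionIntegrand N k ℏ (bPlus ℏ i j w) (bPlus ℏ i' j' w') t = 0 := by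
  rw [bPlus, contractionIntegrand_bExp_left]
  simp [bPlus, bExp, plusCoeff, ht.le]

theorem contractionIntegrand_bc_bPlus {t : ℝ} (ht : 0 < t) (i j i' j' : ℕ) (w w' : ℂ) :
    contractionIntegrand N k ℏ (bc ℏ i j w) (bPlus ℏ i' j' w') t = 0 := by
  rw [bc, contractionIntegrand_add_left, contractionIntegrand_bExp_left,
    contractionIntegrand_cExp_left]
  simp [bPlus, bExp, plusCoeff, ht.le]

theorem contractionIntegrand_bMinus_left {t : ℝ} (ht : 0 < t) (i j : ℕ) (w : ℂ) (B : Exponent) :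
    contractionIntegrand N k ℏ (bMinus ℏ i j w) B t = 0 := by
  rw [bMinus, contractionIntegrand_bExp_left]
  simp [minusCoeff, ht.le]

theorem contractionIntegrand_lamMinus_left {t : ℝ} (ht : 0 < t) (i : ℕ) (w : ℂ) (B : Exponent) :
    contractionIntegrand N k ℏ (lamMinus ℏ i w) B t = 0 := by
  have : ∀ m, lamExp i (minusCoeff ℏ w) m t = 0 := by
    rintro (_ | _ | _) <;> simp [lamExp, minusCoeff, ht.le]
  simp [contractionIntegrand, lamMinus, this, sumModes_zero]

theorem contractionIntegrand_lamPlus_right {t : ℝ} (ht : 0 < t) (i : ℕ) (w : ℂ) (A : Exponent) :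
    contractionIntegrand N k ℏ A (lamPlus ℏ i w) t = 0 := by
  have : ∀ m, lamExp i (plusCoeff ℏ w) m (-t) = 0 := by
    rintro (_ | _ | _) <;> simp [lamExp, plusCoeff, ht.le]
  simp [contractionIntegrand, lamPlus, this, sumModes_zero]

/-- The bosons `b` and `c` enter with equal coefficients and have opposite commutators, so their
contributions cancel. -/
theorem contractionIntegrand_bc_bc (t : ℝ) (i j i' j' : ℕ) (w w' : ℂ) :
    contractionIntegrand N k ℏ (bc ℏ i j w) (bc ℏ i' j' w') t = 0 := by
  rw [bc, contractionIntegrand_add_left, contractionIntegrand_bExp_left,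
    contractionIntegrand_cExp_left]
  split_ifs with h
  · simp only [bc, Pi.add_apply, bExp, cExp]; ring
  · simp

end YangianFreeField

namespace YangianFreeField

variable {N : ℕ} {k : ℂ} {ℏ : ℝ}

/-! ### Pairings of the bosons `λ` -/

/-- A zero of `sinh` at `w` forces `|e^w| = |e^{-w}|`, that is `Re w = 0`. For complex level this is
where `Re (k + N) ≠ 0` is needed. -/
theorem sinh_ofReal_mul_ne_zero {c : ℂ} (hc : c.re ≠ 0) (hℏ : ℏ ≠ 0) {t : ℝ} (ht : t ≠ 0) :
    Complex.sinh (c / 2 * ℏ * t) ≠ 0 := by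
  intro h
  rw [Complex.sinh, div_eq_zero_iff, or_iff_left two_ne_zero, sub_eq_zero] at h
  have h1 := congrArg (fun z => ‖z‖) h
  simp only [Complex.norm_exp, Real.exp_eq_exp] at h1
  have h2 : (c / 2 * ℏ * t).re = c.re / 2 * ℏ * t := by
    rw [mul_assoc, ← Complex.ofReal_mul, Complex.re_mul_ofReal]
    simp [mul_assoc]
  rw [Complex.neg_re, h2] at h1
  have : c.re / 2 * ℏ * t = 0 := by linarith
  simp [hc, hℏ, ht] at this

theorem commutator_lam_self (i : ℕ) (t : ℝ) :
    commutator N k ℏ (.lam i) (.lam i) t =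
      Complex.sinh ((k + N) / 2 * ℏ * t) * Complex.sinh (((N : ℂ) - 1) / 2 * ℏ * t)
            * Complex.sinh (ℏ / 2 * t)
          / (ℏ ^ 2 * t * Complex.sinh ((N : ℂ) / 2 * ℏ * t)) := by
  simp [commutator]

theorem commutator_lam_lt {i j : ℕ} (h : i < j) (t : ℝ) :
    commutator N k ℏ (.lam i) (.lam j) t =
      -(Complex.sinh ((k + N) / 2 * ℏ * t) * Complex.sinh (ℏ / 2 * t) ^ 2
            / (ℏ ^ 2 * t * Complex.sinh ((N : ℂ) / 2 * ℏ * t)))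
          * Complex.exp (-((N : ℂ) / 2 * ℏ * t)) := by
  have h1 : SignType.sign ((i : ℤ) - (j : ℤ)) = -1 := sign_neg (by omega)
  simp [commutator, h.ne, h1]

theorem commutator_lam_gt {i j : ℕ} (h : j < i) (t : ℝ) :
    commutator N k ℏ (.lam i) (.lam j) t =
      -(Complex.sinh ((k + N) / 2 * ℏ * t) * Complex.sinh (ℏ / 2 * t) ^ 2
            / (ℏ ^ 2 * t * Complex.sinh ((N : ℂ) / 2 * ℏ * t)))
          * Complex.exp ((N : ℂ) / 2 * ℏ * t) := by
  have h1 : SignType.sign ((i : ℤ) - (j : ℤ)) = 1 := sign_pos (by omega)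
  simp [commutator, h.ne', h1]

/-- The structure function of the differences `λ̂_i - λ̂_{i+1}`, up to the factor
`sinh((k+N)ℏt/2) / (ℏ²t)` and in the symmetric normalization. -/
noncomputable def rootElem (ℏ : ℝ) (i j : ℕ) (t : ℝ) : ℂ :=
  if i = j then Complex.sinh (ℏ * t)
  else if i = j + 1 ∨ j = i + 1 then -Complex.sinh (ℏ / 2 * t) else 0

/-- In passing from `λ_i` to the differences `λ_i - λ_{i+1}` the denominator `sinh (Nℏt/2)`
disappears and a deformed Cartan matrix remains. The exponential prefactor is the one that the
shifts by `-i/2` and `-j/2` in the root fields produce. -/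
theorem commutator_lam_root (hN : 1 ≤ N) (hℏ : ℏ ≠ 0) {t : ℝ} (ht : t ≠ 0) (i j : ℕ) :
    Complex.exp (((j : ℂ) - i) * (ℏ / 2 * t)) *
      (commutator N k ℏ (.lam i) (.lam j) t - commutator N k ℏ (.lam i) (.lam (j + 1)) t
      - commutator N k ℏ (.lam (i + 1)) (.lam j) t
      + commutator N k ℏ (.lam (i + 1)) (.lam (j + 1)) t)
      = Complex.sinh ((k + N) / 2 * ℏ * t) / (ℏ ^ 2 * t) * rootElem ℏ i j t := by
  have hs : Complex.sinh ((N : ℂ) / 2 * ℏ * t) ≠ 0 :=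
    sinh_ofReal_mul_ne_zero (c := N) (by simpa using Nat.one_le_iff_ne_zero.1 hN) hℏ ht
  have ht' : (t : ℂ) ≠ 0 := by exact_mod_cast ht
  have hℏ' : (ℏ : ℂ) ≠ 0 := by exact_mod_cast hℏ
  have e1 : ((N : ℂ) - 1) / 2 * ℏ * t = (N : ℂ) / 2 * ℏ * t - ℏ / 2 * t := by ring
  have e2 : (ℏ : ℂ) * t = 2 * (ℏ / 2 * t) := by ring
  have hcs := Complex.cosh_sq_sub_sinh_sq (ℏ / 2 * t : ℂ)
  rcases lt_trichotomy i j with h | h | h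
  · rw [commutator_lam_lt h, commutator_lam_lt (h.trans (Nat.lt_succ_self j)),
      commutator_lam_lt (by omega : i + 1 < j + 1)]
    -- For distant indices the four commutators agree and cancel in the alternating sum.
    rcases Nat.lt_or_ge (i + 1) j with h' | h'
    · rw [commutator_lam_lt h', rootElem, if_neg h.ne, if_neg (by omega)]
      ring
    · obtain rfl : j = i + 1 := by omega
      rw [commutator_lam_self, rootElem, if_neg (by omega), if_pos (Or.inr rfl), e1,
        Complex.sinh_sub, ← Complex.cosh_sub_sinh]
      have e3 : (((i + 1 : ℕ) : ℂ) - i) * (ℏ / 2 * t) = ℏ / 2 * t := by push_cast; ring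
      rw [e3, ← Complex.cosh_add_sinh]
      generalize Complex.cosh (ℏ / 2 * t : ℂ) = c at *
      generalize Complex.sinh (ℏ / 2 * t : ℂ) = s at *
      generalize Complex.sinh ((N : ℂ) / 2 * ℏ * t) = S at *
      generalize Complex.cosh ((N : ℂ) / 2 * ℏ * t) = C at *
      generalize Complex.sinh ((k + N) / 2 * ℏ * t) = K at *
      field_simp
      linear_combination (-(K * s * S)) * hcs
  · subst h
    rw [commutator_lam_self, commutator_lam_self, commutator_lam_lt (Nat.lt_succ_self i),
      commutator_lam_gt (Nat.lt_succ_self i), rootElem, if_pos rfl, e1, e2,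
      Complex.sinh_two_mul, Complex.sinh_sub, sub_self, zero_mul, Complex.exp_zero,
      ← Complex.cosh_sub_sinh, ← Complex.cosh_add_sinh]
    generalize Complex.cosh (ℏ / 2 * t : ℂ) = c at *
    generalize Complex.sinh (ℏ / 2 * t : ℂ) = s at *
    generalize Complex.sinh ((N : ℂ) / 2 * ℏ * t) = S at *
    generalize Complex.cosh ((N : ℂ) / 2 * ℏ * t) = C at *
    generalize Complex.sinh ((k + N) / 2 * ℏ * t) = K at *
    field_simp
    ring
  · rw [commutator_lam_gt h, commutator_lam_gt (h.trans (Nat.lt_succ_self i)),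
      commutator_lam_gt (by omega : j + 1 < i + 1)]
    rcases Nat.lt_or_ge (j + 1) i with h' | h'
    · rw [commutator_lam_gt h', rootElem, if_neg h.ne', if_neg (by omega)]
      ring
    · obtain rfl : i = j + 1 := by omega
      rw [commutator_lam_self, rootElem, if_neg (by omega), if_pos (Or.inl rfl), e1,
        Complex.sinh_sub]
      have e3 : ((j : ℂ) - (j + 1 : ℕ)) * (ℏ / 2 * t) = -(ℏ / 2 * t) := by push_cast; ring
      rw [e3, ← Complex.cosh_sub_sinh, ← Complex.cosh_add_sinh]
      generalize Complex.cosh (ℏ / 2 * t : ℂ) = c at *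
      generalize Complex.sinh (ℏ / 2 * t : ℂ) = s at *
      generalize Complex.sinh ((N : ℂ) / 2 * ℏ * t) = S at *
      generalize Complex.cosh ((N : ℂ) / 2 * ℏ * t) = C at *
      generalize Complex.sinh ((k + N) / 2 * ℏ * t) = K at *
      field_simp
      linear_combination (-(K * s * S)) * hcs

theorem contractionIntegrand_lam_root {f g : ℝ → ℂ} (t : ℝ) (i j : ℕ) (hi : 1 ≤ i)
    (hi' : i < N) (hj : 1 ≤ j) (hj' : j < N) :
    contractionIntegrand N k ℏ (lamExp i f - lamExp (i + 1) f) (lamExp j g - lamExp (j + 1) g) t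
      = f t * g (-t) * (commutator N k ℏ (.lam i) (.lam j) t
      - commutator N k ℏ (.lam i) (.lam (j + 1)) t - commutator N k ℏ (.lam (i + 1)) (.lam j) t
      + commutator N k ℏ (.lam (i + 1)) (.lam (j + 1)) t) := by
  rw [contractionIntegrand_sub_left, contractionIntegrand_sub_right, contractionIntegrand_sub_right,
    contractionIntegrand_lamExp_lamExp, contractionIntegrand_lamExp_lamExp,
    contractionIntegrand_lamExp_lamExp, contractionIntegrand_lamExp_lamExp]
  · ring
  all_goals omega

/-- Integrand of the contractions of `λ⁺_i / λ⁺_{i+1}` with `Λ_j` and of `Λ_j` with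
`λ⁻_i / λ⁻_{i+1}`. -/
noncomputable def rootPair (ℏ : ℝ) (i j : ℕ) (z : ℂ) (t : ℝ) (x : ℂ) : ℂ :=
  if i = j then elem ℏ z t (x - 1) - elem ℏ z t (x + 1)
  else if i = j + 1 ∨ j = i + 1 then elem ℏ z t (x + 1 / 2) - elem ℏ z t (x - 1 / 2) else 0

theorem rootPair_eq (i j : ℕ) (z : ℂ) (t : ℝ) (x : ℂ) :
    rootPair ℏ i j z t x = -2 * (Complex.exp (-(Complex.I * z * t)) * Complex.exp (x * ℏ * t)) / t
      * rootElem ℏ i j t := by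
  rw [rootPair, rootElem]
  split_ifs
  · rw [sub_eq_add_neg x, elem_add, elem_add, Complex.sinh]
    have h1 : -(1 : ℂ) * ℏ * t = -(ℏ * t) := by ring
    have h2 : (1 : ℂ) * ℏ * t = ℏ * t := by ring
    rw [h1, h2]; ring
  · rw [sub_eq_add_neg x, elem_add, elem_add, Complex.sinh]
    have h1 : -(1 / 2 : ℂ) * ℏ * t = -(ℏ / 2 * t) := by ring
    have h2 : (1 / 2 : ℂ) * ℏ * t = ℏ / 2 * t := by ring
    rw [h1, h2]; ring
  · ring

/-- The exponent of `λ⁺_i(u + (s - i/2) iℏ) / λ⁺_{i+1}(u + (s - i/2) iℏ)`. -/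
noncomputable def rootPlus (ℏ : ℝ) (i : ℕ) (s u : ℂ) : Exponent :=
  lamPlus ℏ i (sh ℏ u (s - i / 2)) - lamPlus ℏ (i + 1) (sh ℏ u (s - i / 2))

/-- The exponent of `λ⁻_i(u + (s - i/2) iℏ) / λ⁻_{i+1}(u + (s - i/2) iℏ)`. -/
noncomputable def rootMinus (ℏ : ℝ) (i : ℕ) (s u : ℂ) : Exponent :=
  lamMinus ℏ i (sh ℏ u (s - i / 2)) - lamMinus ℏ (i + 1) (sh ℏ u (s - i / 2))

variable (N k ℏ) in
/-- The exponent of `Λ_j(v; α)`. -/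
noncomputable def ratioExp (j : ℕ) (α v : ℂ) : Exponent :=
  lamField ℏ (j + 1) (k + N) (sh ℏ v (-j / 2)) α - lamField ℏ j (k + N) (sh ℏ v (-j / 2)) α

/-- The factor `sinh ((k+N)ℏt/2)` of the commutator cancels the denominator of `Λ`, and the
parameter `α` becomes a shift. The result is independent of the level except through the shift `s -
α`. -/
theorem contractionIntegrand_rootPlus_ratio (hk : (k + N).re ≠ 0) (hℏ : ℏ ≠ 0) {t : ℝ}
    (ht : 0 < t) {i j : ℕ} (hi : 1 ≤ i) (hi' : i < N) (hj : 1 ≤ j) (hj' : j < N)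
    (s α u v : ℂ) :
    contractionIntegrand N k ℏ (rootPlus ℏ i s u) (ratioExp N k ℏ j α v) t
      = rootPair ℏ i j (u - v) t (s - α) := by
  have hK := sinh_ofReal_mul_ne_zero hk hℏ ht.ne'
  have ht' : (t : ℂ) ≠ 0 := by exact_mod_cast ht.ne'
  have hℏ' : (ℏ : ℂ) ≠ 0 := by exact_mod_cast hℏ
  -- The ratio `Λ_j` is `λ_{j+1} / λ_j`, the inverse of a root field; hence the sign.
  rw [rootPlus, ratioExp, ← neg_sub (lamField ℏ j _ _ _), contractionIntegrand_neg_right]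
  simp only [lamPlus, lamField]
  rw [contractionIntegrand_lam_root t i j hi hi' hj hj', rootPair_eq]
  have hroot := commutator_lam_root (N := N) (k := k) (by omega) hℏ ht.ne' i j
  have hsinh : Complex.sinh ((k + N) / 2 * ℏ * -t) = -Complex.sinh ((k + N) / 2 * ℏ * t) := by
    rw [← Complex.sinh_neg]; congr 1; ring
  have hexp : Complex.exp (-(Complex.I * sh ℏ u (s - i / 2) * t)) * Complex.exp (α * ℏ * -t) *
      Complex.exp (-(Complex.I * sh ℏ v (-j / 2) * -t))
      = Complex.exp (-(Complex.I * (u - v) * t)) * Complex.exp ((s - α) * ℏ * t) *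
        Complex.exp (((j : ℂ) - i) * (ℏ / 2 * t)) := by
    rw [← Complex.exp_add, ← Complex.exp_add, ← Complex.exp_add, ← Complex.exp_add]
    congr 1
    simp only [sh]
    linear_combination (-(s - i / 2 + j / 2) * ℏ * t) * Complex.I_sq
  simp only [plusCoeff, fieldCoeff, ht, if_true, Left.neg_neg_iff, Complex.ofReal_neg, hsinh]
  have : rootElem ℏ i j t = ℏ ^ 2 * t / Complex.sinh ((k + N) / 2 * ℏ * t) *
      (Complex.sinh ((k + N) / 2 * ℏ * t) / (ℏ ^ 2 * t) * rootElem ℏ i j t) := by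
    generalize Complex.sinh ((k + N) / 2 * ℏ * t) = K at *
    field_simp
  rw [this, ← hroot]
  generalize commutator N k ℏ (.lam i) (.lam j) t
      - commutator N k ℏ (.lam i) (.lam (j + 1)) t - commutator N k ℏ (.lam (i + 1)) (.lam j) t
      + commutator N k ℏ (.lam (i + 1)) (.lam (j + 1)) t = D
  rw [show ∀ a b c d e f : ℂ, -(a * b * (c * d * e) * f) = -(b * d * e) * (a * c * f) by intros; ring,
    hexp]
  generalize Complex.sinh ((k + N) / 2 * ℏ * t) = K at *
  field_simp

theorem contractionIntegrand_ratio_rootMinus (hk : (k + N).re ≠ 0) (hℏ : ℏ ≠ 0) {t : ℝ}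
    (ht : 0 < t) {i j : ℕ} (hi : 1 ≤ i) (hi' : i < N) (hj : 1 ≤ j) (hj' : j < N)
    (s α u v : ℂ) :
    contractionIntegrand N k ℏ (ratioExp N k ℏ j α v) (rootMinus ℏ i s u) t
      = rootPair ℏ i j (v - u) t (-s - α) := by
  have hK := sinh_ofReal_mul_ne_zero hk hℏ ht.ne'
  have ht' : (t : ℂ) ≠ 0 := by exact_mod_cast ht.ne'
  have hℏ' : (ℏ : ℂ) ≠ 0 := by exact_mod_cast hℏ
  rw [rootMinus, ratioExp, ← neg_sub (lamField ℏ j _ _ _), contractionIntegrand_neg_left]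
  simp only [lamMinus, lamField]
  rw [contractionIntegrand_lam_root t j i hj hj' hi hi', rootPair_eq]
  have hsymm : rootElem ℏ i j t = rootElem ℏ j i t := by
    simp only [rootElem, eq_comm (a := i) (b := j), or_comm (a := i = j + 1)]
  have hroot := commutator_lam_root (N := N) (k := k) (by omega) hℏ ht.ne' j i
  have hexp : Complex.exp (-(α * ℏ * t)) * Complex.exp (-(Complex.I * sh ℏ v (-j / 2) * t)) *
      Complex.exp (-(Complex.I * sh ℏ u (s - i / 2) * -t))
      = Complex.exp (-(Complex.I * (v - u) * t)) * Complex.exp ((-s - α) * ℏ * t) *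
        Complex.exp (((i : ℂ) - j) * (ℏ / 2 * t)) := by
    rw [← Complex.exp_add, ← Complex.exp_add, ← Complex.exp_add, ← Complex.exp_add]
    congr 1
    simp only [sh]
    linear_combination ((s - i / 2 + j / 2) * ℏ * t) * Complex.I_sq
  simp only [minusCoeff, fieldCoeff, ht, ht.not_gt, if_true, if_false, Left.neg_neg_iff,
    Complex.ofReal_neg]
  have : rootElem ℏ i j t = ℏ ^ 2 * t / Complex.sinh ((k + N) / 2 * ℏ * t) *
      (Complex.sinh ((k + N) / 2 * ℏ * t) / (ℏ ^ 2 * t) * rootElem ℏ j i t) := by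
    rw [hsymm]
    generalize Complex.sinh ((k + N) / 2 * ℏ * t) = K at *
    field_simp
  rw [this, ← hroot]
  generalize commutator N k ℏ (.lam j) (.lam i) t
      - commutator N k ℏ (.lam j) (.lam (i + 1)) t - commutator N k ℏ (.lam (j + 1)) (.lam i) t
      + commutator N k ℏ (.lam (j + 1)) (.lam (i + 1)) t = D
  rw [show ∀ a b c d e f : ℂ, -(a * b * c * (d * e) * f) = -(b * c * e) * (a * d * f) by intros; ring,
    hexp]
  generalize Complex.sinh ((k + N) / 2 * ℏ * t) = K at *
  field_simp

end YangianFreeField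

namespace YangianFreeField

variable {N : ℕ} {k : ℂ} {ℏ : ℝ}

/-! ### Pairings with sums over a row or a column -/

/-- In a product along a row or a column at most one factor has the labels of a given field, so the
sum of contractions has at most one nonzero entry. -/
theorem sum_ite_col (S : Finset ℕ) (p q : Prop) [Decidable p] [Decidable q] (j : ℕ) (X : ℕ → ℂ) :
    (∑ n ∈ S, if p ∧ j = n ∧ q then X n else 0) = if p ∧ j ∈ S ∧ q then X j else 0 := by
  by_cases hp : p <;> by_cases hq : q <;> simp [hp, hq]

theorem sum_ite_row (S : Finset ℕ) (q : Prop) [Decidable q] (i : ℕ) (X : ℕ → ℂ) :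
    (∑ n ∈ S, if i = n ∧ q then X n else 0) = if i ∈ S ∧ q then X i else 0 := by
  by_cases hq : q <;> simp [hq]

section

variable {t : ℝ} (S : Finset ℕ) (i j a : ℕ) (u v s : ℂ) (f : ℕ → ℂ)

theorem sum_bPlus_bMinus_col (hℏ : ℏ ≠ 0) (ht : 0 < t) :
    ∑ n ∈ S, contractionIntegrand N k ℏ (bPlus ℏ i j (sh ℏ u s)) (bMinus ℏ a n (sh ℏ v (f n))) t
      = if i = a ∧ j ∈ S ∧ 1 ≤ i ∧ i < j ∧ j ≤ N then diagElem ℏ (u - v) t (s - f j) else 0 := by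
  simp only [contractionIntegrand_bPlus_bMinus hℏ ht]
  exact sum_ite_col S _ _ j fun n => diagElem ℏ (u - v) t (s - f n)

theorem sum_bPlus_bMinus_row (hℏ : ℏ ≠ 0) (ht : 0 < t) :
    ∑ n ∈ S, contractionIntegrand N k ℏ (bPlus ℏ i j (sh ℏ u s)) (bMinus ℏ n a (sh ℏ v (f n))) t
      = if i ∈ S ∧ j = a ∧ 1 ≤ i ∧ i < j ∧ j ≤ N then diagElem ℏ (u - v) t (s - f i) else 0 := by
  simp only [contractionIntegrand_bPlus_bMinus hℏ ht]
  exact sum_ite_row S _ i fun n => diagElem ℏ (u - v) t (s - f n)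

theorem sum_bc_bMinus_col (hℏ : ℏ ≠ 0) (ht : 0 < t) :
    ∑ n ∈ S, contractionIntegrand N k ℏ (bc ℏ i j (sh ℏ u s)) (bMinus ℏ a n (sh ℏ v (f n))) t
      = if i = a ∧ j ∈ S ∧ 1 ≤ i ∧ i < j ∧ j ≤ N then crossElem ℏ (u - v) t (s - f j) else 0 := by
  simp only [contractionIntegrand_bc_bMinus hℏ ht]
  exact sum_ite_col S _ _ j fun n => crossElem ℏ (u - v) t (s - f n)

theorem sum_bc_bMinus_row (hℏ : ℏ ≠ 0) (ht : 0 < t) :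
    ∑ n ∈ S, contractionIntegrand N k ℏ (bc ℏ i j (sh ℏ u s)) (bMinus ℏ n a (sh ℏ v (f n))) t
      = if i ∈ S ∧ j = a ∧ 1 ≤ i ∧ i < j ∧ j ≤ N then crossElem ℏ (u - v) t (s - f i) else 0 := by
  simp only [contractionIntegrand_bc_bMinus hℏ ht]
  exact sum_ite_row S _ i fun n => crossElem ℏ (u - v) t (s - f n)

end

/-! ### The terms of the screening currents -/

/-- The bracket of the `m`-th summand of `S̃_ν(v)`: its second term for `τ = true`, its first term
for `τ = false`. -/
noncomputable def screenHead (N : ℕ) (ℏ : ℝ) (ν : ℕ) (v : ℂ) : Bool → ℕ → Exponent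
  | false, m => -bMinus ℏ ν m (sh ℏ v (-(N - m) / 2)) - bc ℏ ν m (sh ℏ v (-(N - m + 1) / 2))
  | true, m => -bPlus ℏ ν m (sh ℏ v (-(N - m) / 2)) - bc ℏ ν m (sh ℏ v (-(N - m - 1) / 2))

/-- The exponents of the vertex operators in `S̃_ν(v)`. -/
noncomputable def screenTerm (N : ℕ) (ℏ : ℝ) (ν : ℕ) (τ : Bool) (m : ℕ) (v : ℂ) : Exponent :=
  bc ℏ (ν + 1) m (sh ℏ v (-(N - m) / 2)) + screenHead N ℏ ν v τ m +
    ∑ n ∈ Finset.Icc (m + 1) N, (bMinus ℏ (ν + 1) n (sh ℏ v (-(N - n + 1) / 2))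
      - bMinus ℏ ν n (sh ℏ v (-(N - n) / 2)))

/-- A term of `S̃_ν` lives in rows `ν` and `ν + 1`: the entry `m` belongs to the head and the
entries beyond `m` to the tail. The choice `τ` drops out: against `b⁺`, the second difference from
`b⁻` exactly makes up for the distance between the two positions of `(b+c)`. -/
theorem contractionIntegrand_bPlus_screenTerm (hℏ : ℏ ≠ 0) {t : ℝ} (ht : 0 < t) (i j : ℕ)
    {ν m : ℕ} (τ : Bool) (hν : 1 ≤ ν) (u v s : ℂ) :
    contractionIntegrand N k ℏ (bPlus ℏ i j (sh ℏ u s)) (screenTerm N ℏ ν τ m v) t =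
      if i = ν + 1 ∧ ν + 1 < j ∧ j ≤ N then
        (if j < m then 0 else if j = m then crossElem ℏ (u - v) t (s + (N - j) / 2)
          else diagElem ℏ (u - v) t (s + (N - j + 1) / 2))
      else if i = ν ∧ ν < j ∧ j ≤ N then
        (if j < m then 0 else if j = m then
          elem ℏ (u - v) t (s + (N - j) / 2) - elem ℏ (u - v) t (s + (N - j) / 2 - 1)
          else -diagElem ℏ (u - v) t (s + (N - j) / 2))
      else 0 := by
  cases τ
  all_goals
    simp only [screenTerm, screenHead, contractionIntegrand_sub_right,
      contractionIntegrand_add_right, contractionIntegrand_sum_right, Finset.sum_sub_distrib,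
      contractionIntegrand_neg_right]
    simp only [sum_bPlus_bMinus_col _ _ _ _ _ _ _ _ hℏ ht, Finset.mem_Icc]
    simp only [contractionIntegrand_bPlus_bc hℏ ht,
      contractionIntegrand_bPlus_bMinus hℏ ht, contractionIntegrand_bPlus_bPlus ht]
    by_cases h1 : i = ν + 1 ∧ ν + 1 < j ∧ j ≤ N
    · rcases lt_trichotomy j m with h3 | h3 | h3 <;>
        simp (disch := omega) only [if_pos, if_neg] <;> try subst h3
      all_goals first | (simp only [crossElem, diagElem]; ring_nf) | ring_nf
    by_cases h2 : i = ν ∧ ν < j ∧ j ≤ N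
    · rcases lt_trichotomy j m with h3 | h3 | h3 <;>
        simp (disch := omega) only [if_pos, if_neg] <;> try subst h3
      all_goals first | (simp only [crossElem, diagElem]; ring_nf) | ring_nf
    · simp (disch := omega) only [if_neg]; ring_nf

/-- Here the two brackets differ: `(b+c)` contracts with the `b⁻` in the head of the first one,
whereas `b⁺` and `(b+c)` on the right give nothing. -/
theorem contractionIntegrand_bc_screenTerm (hℏ : ℏ ≠ 0) {t : ℝ} (ht : 0 < t) (i j : ℕ)
    {ν m : ℕ} (τ : Bool) (hν : 1 ≤ ν) (u v s : ℂ) :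
    contractionIntegrand N k ℏ (bc ℏ i j (sh ℏ u s)) (screenTerm N ℏ ν τ m v) t =
      if i = ν + 1 ∧ ν + 1 < j ∧ j ≤ N then
        (if j ≤ m then 0 else crossElem ℏ (u - v) t (s + (N - j + 1) / 2))
      else if i = ν ∧ ν < j ∧ j ≤ N then
        (if j < m ∨ (j = m ∧ τ = true) then 0 else -crossElem ℏ (u - v) t (s + (N - j) / 2))
      else 0 := by
  cases τ
  all_goals
    simp only [screenTerm, screenHead, contractionIntegrand_sub_right,
      contractionIntegrand_add_right, contractionIntegrand_sum_right, Finset.sum_sub_distrib,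
      contractionIntegrand_neg_right]
    simp only [sum_bc_bMinus_col _ _ _ _ _ _ _ _ hℏ ht, Finset.mem_Icc]
    simp only [contractionIntegrand_bc_bc,
      contractionIntegrand_bc_bMinus hℏ ht, contractionIntegrand_bc_bPlus ht, and_true,
      and_false, or_false, reduceCtorEq]
    by_cases h1 : i = ν + 1 ∧ ν + 1 < j ∧ j ≤ N
    · rcases lt_trichotomy j m with h3 | h3 | h3 <;>
        simp (disch := omega) only [if_pos, if_neg] <;> try subst h3
      all_goals ring_nf
    by_cases h2 : i = ν ∧ ν < j ∧ j ≤ N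
    · rcases lt_trichotomy j m with h3 | h3 | h3 <;>
        simp (disch := omega) only [if_pos, if_neg] <;> try subst h3
      all_goals ring_nf
    · simp (disch := omega) only [if_neg]; ring_nf

/-- On the left of an operator product only the annihilation part of a screening term matters. -/
theorem contractionIntegrand_screenTerm_left {t : ℝ} (ht : 0 < t) {ν m : ℕ} (τ : Bool) (v : ℂ)
    (B : Exponent) :
    contractionIntegrand N k ℏ (screenTerm N ℏ ν τ m v) B t =
      contractionIntegrand N k ℏ (bc ℏ (ν + 1) m (sh ℏ v (-(N - m) / 2))) B t
      + (if τ then -contractionIntegrand N k ℏ (bPlus ℏ ν m (sh ℏ v (-(N - m) / 2))) B t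
          - contractionIntegrand N k ℏ (bc ℏ ν m (sh ℏ v (-(N - m - 1) / 2))) B t
        else -contractionIntegrand N k ℏ (bc ℏ ν m (sh ℏ v (-(N - m + 1) / 2))) B t) := by
  cases τ <;> simp [screenTerm, screenHead, contractionIntegrand_sub_left,
      contractionIntegrand_add_left, contractionIntegrand_sum_left,
      contractionIntegrand_neg_left, contractionIntegrand_bMinus_left ht]

/-! ### Continuity of the generating fields -/

theorem isField_bExp {f : ℂ → ℝ → ℂ} (hf : ∃ g : ℝ → ℂ, ContinuousOn g {0}ᶜ ∧
    ∀ u t, f u t = g t * Complex.exp (-(Complex.I * u * t))) (i j : ℕ) :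
    IsField fun u => bExp i j (f u) := by
  obtain ⟨g, hg, hf⟩ := hf
  rintro (_ | ⟨a, b⟩ | _)
  · exact ⟨0, continuousOn_const, by simp [bExp]⟩
  · by_cases h : i < j ∧ a = i ∧ b = j
    · exact ⟨g, hg, fun u t => by simp only [bExp, h, and_self, if_true, hf]⟩
    · exact ⟨0, continuousOn_const, fun u t => by simp [bExp, h]⟩
  · exact ⟨0, continuousOn_const, by simp [bExp]⟩

theorem isField_cExp {f : ℂ → ℝ → ℂ} (hf : ∃ g : ℝ → ℂ, ContinuousOn g {0}ᶜ ∧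
    ∀ u t, f u t = g t * Complex.exp (-(Complex.I * u * t))) (i j : ℕ) :
    IsField fun u => cExp i j (f u) := by
  obtain ⟨g, hg, hf⟩ := hf
  rintro (_ | _ | ⟨a, b⟩)
  · exact ⟨0, continuousOn_const, by simp [cExp]⟩
  · exact ⟨0, continuousOn_const, by simp [cExp]⟩
  · by_cases h : i < j ∧ a = i ∧ b = j
    · exact ⟨g, hg, fun u t => by simp only [cExp, h, and_self, if_true, hf]⟩
    · exact ⟨0, continuousOn_const, fun u t => by simp [cExp, h]⟩

theorem isField_lamExp {f : ℂ → ℝ → ℂ} (hf : ∃ g : ℝ → ℂ, ContinuousOn g {0}ᶜ ∧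
    ∀ u t, f u t = g t * Complex.exp (-(Complex.I * u * t))) (i : ℕ) :
    IsField fun u => lamExp i (f u) := by
  obtain ⟨g, hg, hf⟩ := hf
  rintro (a | _ | _)
  · by_cases h : a = i
    · exact ⟨g, hg, fun u t => by simp only [lamExp, h, if_true, hf]⟩
    · exact ⟨0, continuousOn_const, fun u t => by simp [lamExp, h]⟩
  · exact ⟨0, continuousOn_const, by simp [lamExp]⟩
  · exact ⟨0, continuousOn_const, by simp [lamExp]⟩

theorem continuousOn_ite_pos {f g : ℝ → ℂ} {p : ℝ → Prop} [DecidablePred p]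
    (hf : Continuous f) (hg : Continuous g)
    (hp : ∀ t : ℝ, t ≠ 0 → (∀ᶠ s in nhds t, p s) ∨ ∀ᶠ s in nhds t, ¬p s) :
    ContinuousOn (fun t => if p t then f t else g t) {0}ᶜ := by
  intro t ht
  refine ContinuousAt.continuousWithinAt ?_
  rcases hp t ht with h | h
  · exact hf.continuousAt.congr (h.mono fun s hs => by simp [hs])
  · exact hg.continuousAt.congr (h.mono fun s hs => by simp [hs])

theorem eventually_pos_or (t : ℝ) (ht : t ≠ 0) :
    (∀ᶠ s in nhds t, 0 < s) ∨ ∀ᶠ s in nhds t, ¬0 < s := by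
  rcases ht.lt_or_gt with h | h
  · exact Or.inr ((gt_mem_nhds h).mono fun s hs => not_lt.2 (le_of_lt hs))
  · exact Or.inl (lt_mem_nhds h)

theorem eventually_neg_or (t : ℝ) (ht : t ≠ 0) :
    (∀ᶠ s in nhds t, s < 0) ∨ ∀ᶠ s in nhds t, ¬s < 0 := by
  rcases ht.lt_or_gt with h | h
  · exact Or.inl (gt_mem_nhds h)
  · exact Or.inr ((lt_mem_nhds h).mono fun s hs => not_lt.2 (le_of_lt hs))

theorem plusCoeff_density (ℏ : ℝ) : ∃ g : ℝ → ℂ, ContinuousOn g {0}ᶜ ∧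
    ∀ u t, plusCoeff ℏ u t = g t * Complex.exp (-(Complex.I * u * t)) :=
  ⟨fun t => if 0 < t then 2 * ℏ else 0,
    continuousOn_ite_pos continuous_const continuous_const eventually_pos_or,
    fun u t => by simp only [plusCoeff, ite_mul, zero_mul]⟩

theorem minusCoeff_density (ℏ : ℝ) : ∃ g : ℝ → ℂ, ContinuousOn g {0}ᶜ ∧
    ∀ u t, minusCoeff ℏ u t = g t * Complex.exp (-(Complex.I * u * t)) :=
  ⟨fun t => if t < 0 then -(2 * ℏ) else 0,
    continuousOn_ite_pos continuous_const continuous_const eventually_neg_or,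
    fun u t => by simp only [minusCoeff, ite_mul, zero_mul]⟩

theorem fieldCoeff_density (hℏ : ℏ ≠ 0) {β : ℂ} (hβ : β.re ≠ 0) (α : ℂ) :
    ∃ g : ℝ → ℂ, ContinuousOn g {0}ᶜ ∧
    ∀ u t, fieldCoeff ℏ β u α t = g t * Complex.exp (-(Complex.I * u * t)) :=
  ⟨fun t => -ℏ / Complex.sinh (β / 2 * ℏ * t)
    * (if t < 0 then Complex.exp (α * ℏ * t) else Complex.exp (-(α * ℏ * t))),
    (ContinuousOn.div continuousOn_const (by fun_prop)
      fun t ht => sinh_ofReal_mul_ne_zero hβ hℏ ht).mul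
      (continuousOn_ite_pos (by fun_prop) (by fun_prop) eventually_neg_or),
    fun u t => rfl⟩

theorem isField_bPlus (i j : ℕ) : IsField (bPlus ℏ i j) := isField_bExp (plusCoeff_density ℏ) i j

theorem isField_bMinus (i j : ℕ) : IsField (bMinus ℏ i j) :=
  isField_bExp (minusCoeff_density ℏ) i j

theorem isField_bc (hℏ : ℏ ≠ 0) (i j : ℕ) : IsField (bc ℏ i j) :=
  (isField_bExp (fieldCoeff_density hℏ (by simp) 0) i j).add
    (isField_cExp (fieldCoeff_density hℏ (by simp) 0) i j)

theorem isField_rootPlus (i : ℕ) (s : ℂ) : IsField (rootPlus ℏ i s) :=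
  IsField.sub ((isField_lamExp (plusCoeff_density ℏ) i).sh ℏ _)
    ((isField_lamExp (plusCoeff_density ℏ) (i + 1)).sh ℏ _)

theorem isField_rootMinus (i : ℕ) (s : ℂ) : IsField (rootMinus ℏ i s) :=
  IsField.sub ((isField_lamExp (minusCoeff_density ℏ) i).sh ℏ _)
    ((isField_lamExp (minusCoeff_density ℏ) (i + 1)).sh ℏ _)

theorem isField_ratioExp (hℏ : ℏ ≠ 0) (hk : (k + N).re ≠ 0) (j : ℕ) (α : ℂ) :
    IsField (ratioExp N k ℏ j α) :=
  IsField.sub ((isField_lamExp (fieldCoeff_density hℏ hk α) (j + 1)).sh ℏ _)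
    ((isField_lamExp (fieldCoeff_density hℏ hk α) j).sh ℏ _)

theorem isField_screenTerm (hℏ : ℏ ≠ 0) (ν : ℕ) (τ : Bool) (m : ℕ) :
    IsField (screenTerm N ℏ ν τ m) := by
  refine IsField.add (IsField.add ((isField_bc hℏ _ _).sh ℏ _) ?_) (IsField.sum _ fun n =>
    ((isField_bMinus _ _).sh ℏ _).sub ((isField_bMinus _ _).sh ℏ _))
  cases τ
  · exact ((isField_bMinus _ _).sh ℏ _).neg.sub ((isField_bc hℏ _ _).sh ℏ _)
  · exact ((isField_bPlus _ _).sh ℏ _).neg.sub ((isField_bc hℏ _ _).sh ℏ _)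

end YangianFreeField

namespace YangianFreeField

variable {N : ℕ} {k : ℂ} {ℏ : ℝ}

/-! ### The terms of `E_μ` -/

/-- The bracket of the `m`-th summand of `E_μ(u)`: its first term for `σ = true`, its second term
for `σ = false`. -/
noncomputable def raiseHead (ℏ : ℝ) (μ : ℕ) (u : ℂ) : Bool → ℕ → Exponent
  | true, m => bPlus ℏ m (μ + 1) (sh ℏ u (-(m - 1) / 2)) - bc ℏ m (μ + 1) (sh ℏ u (-m / 2))
  | false, m => bMinus ℏ m (μ + 1) (sh ℏ u (-(m - 1) / 2)) - bc ℏ m (μ + 1) (sh ℏ u (-(m - 2) / 2))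

/-- The exponents of the vertex operators in `E_μ(u)`. -/
noncomputable def raiseTerm (ℏ : ℝ) (μ : ℕ) (σ : Bool) (m : ℕ) (u : ℂ) : Exponent :=
  bc ℏ m μ (sh ℏ u (-(m - 1) / 2)) + raiseHead ℏ μ u σ m +
    ∑ n ∈ Finset.Ico 1 m,
      (bPlus ℏ n (μ + 1) (sh ℏ u (-(n - 1) / 2)) - bPlus ℏ n μ (sh ℏ u (-n / 2)))

theorem isField_raiseTerm (hℏ : ℏ ≠ 0) (μ : ℕ) (σ : Bool) (m : ℕ) :
    IsField (raiseTerm ℏ μ σ m) := by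
  refine IsField.add (IsField.add ((isField_bc hℏ _ _).sh ℏ _) ?_) (IsField.sum _ fun n =>
    ((isField_bPlus _ _).sh ℏ _).sub ((isField_bPlus _ _).sh ℏ _))
  cases σ
  · exact ((isField_bMinus _ _).sh ℏ _).sub ((isField_bc hℏ _ _).sh ℏ _)
  · exact ((isField_bPlus _ _).sh ℏ _).sub ((isField_bc hℏ _ _).sh ℏ _)

/-- For sums over rows contracted with a term of `S̃_ν`, to which only rows `ν` and `ν + 1`
contribute. -/
theorem sum_eq_add_succ {S : Finset ℕ} {g : ℕ → ℂ} (ν : ℕ)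
    (hg : ∀ n ∈ S, n ≠ ν → n ≠ ν + 1 → g n = 0) :
    ∑ n ∈ S, g n = (if ν ∈ S then g ν else 0) + (if ν + 1 ∈ S then g (ν + 1) else 0) := by
  have h : ∀ n ∈ S, g n = (if n = ν then g ν else 0) + (if n = ν + 1 then g (ν + 1) else 0) := by
    intro n hn
    by_cases h1 : n = ν
    · subst h1; simp
    · by_cases h2 : n = ν + 1
      · subst h2; simp
      · simp [h1, h2, hg n hn h1 h2]
  rw [Finset.sum_congr rfl h, Finset.sum_add_distrib, Finset.sum_ite_eq', Finset.sum_ite_eq']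

theorem contractionIntegrand_raiseTerm_screenTerm (hℏ : ℏ ≠ 0) {t : ℝ} (ht : 0 < t) {μ ν m m' : ℕ}
    (σ τ : Bool) (hν : 1 ≤ ν) (u v : ℂ) :
    contractionIntegrand N k ℏ (raiseTerm ℏ μ σ m u) (screenTerm N ℏ ν τ m' v) t =
      contractionIntegrand N k ℏ (bc ℏ m μ (sh ℏ u (-(m - 1) / 2))) (screenTerm N ℏ ν τ m' v) t
      + (if σ = true then
          contractionIntegrand N k ℏ (bPlus ℏ m (μ + 1) (sh ℏ u (-(m - 1) / 2)))
            (screenTerm N ℏ ν τ m' v) t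
          - contractionIntegrand N k ℏ (bc ℏ m (μ + 1) (sh ℏ u (-m / 2)))
            (screenTerm N ℏ ν τ m' v) t
        else -contractionIntegrand N k ℏ (bc ℏ m (μ + 1) (sh ℏ u (-(m - 2) / 2)))
            (screenTerm N ℏ ν τ m' v) t)
      + ((if ν < m then
          contractionIntegrand N k ℏ (bPlus ℏ ν (μ + 1) (sh ℏ u (-(ν - 1) / 2)))
            (screenTerm N ℏ ν τ m' v) t
          - contractionIntegrand N k ℏ (bPlus ℏ ν μ (sh ℏ u (-ν / 2)))
            (screenTerm N ℏ ν τ m' v) t else 0)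
        + (if ν + 1 < m then
          contractionIntegrand N k ℏ (bPlus ℏ (ν + 1) (μ + 1) (sh ℏ u (-ν / 2)))
            (screenTerm N ℏ ν τ m' v) t
          - contractionIntegrand N k ℏ (bPlus ℏ (ν + 1) μ (sh ℏ u (-(ν + 1) / 2)))
            (screenTerm N ℏ ν τ m' v) t else 0)) := by
  have hsum := sum_eq_add_succ (S := Finset.Ico 1 m) (g := fun n =>
    contractionIntegrand N k ℏ (bPlus ℏ n (μ + 1) (sh ℏ u (-(n - 1) / 2)))
      (screenTerm N ℏ ν τ m' v) t
      - contractionIntegrand N k ℏ (bPlus ℏ n μ (sh ℏ u (-n / 2))) (screenTerm N ℏ ν τ m' v) t) ν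
    (fun n _ h1 h2 => by
      simp only [contractionIntegrand_bPlus_screenTerm hℏ ht _ _ _ hν]
      simp (disch := omega) only [if_neg, sub_zero])
  rw [raiseTerm, contractionIntegrand_add_left, contractionIntegrand_add_left,
    contractionIntegrand_sum_left]
  simp only [contractionIntegrand_sub_left]
  rw [hsum]
  simp only [Finset.mem_Ico, hν, true_and, Nat.le_add_left, Nat.cast_add, Nat.cast_one,
    add_sub_cancel_right]
  congr 2
  cases σ <;> simp [raiseHead, contractionIntegrand_sub_left, contractionIntegrand_bMinus_left ht]

theorem contractionIntegrand_bc_raiseTerm (hℏ : ℏ ≠ 0) {t : ℝ} (ht : 0 < t) (i j : ℕ)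
    {μ m : ℕ} (σ : Bool) (u v s : ℂ) :
    contractionIntegrand N k ℏ (bc ℏ i j (sh ℏ v s)) (raiseTerm ℏ μ σ m u) t =
      if σ = false ∧ i = m ∧ j = μ + 1 ∧ 1 ≤ i ∧ i < j ∧ j ≤ N then
        crossElem ℏ (v - u) t (s + (m - 1) / 2) else 0 := by
  cases σ
  all_goals
    simp only [raiseTerm, raiseHead, contractionIntegrand_add_right,
      contractionIntegrand_sub_right, contractionIntegrand_sum_right, contractionIntegrand_bc_bc,
      contractionIntegrand_bc_bPlus ht, contractionIntegrand_bc_bMinus hℏ ht, true_and,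
      reduceCtorEq, false_and, if_false, sub_zero, Finset.sum_const_zero, add_zero, zero_add]
  split_ifs <;> ring_nf

theorem contractionIntegrand_bPlus_raiseTerm (hℏ : ℏ ≠ 0) {t : ℝ} (ht : 0 < t) (i j : ℕ)
    {μ m : ℕ} (σ : Bool) (u v s : ℂ) :
    contractionIntegrand N k ℏ (bPlus ℏ i j (sh ℏ v s)) (raiseTerm ℏ μ σ m u) t =
      (if i = m ∧ j = μ ∧ 1 ≤ i ∧ i < j ∧ j ≤ N then
        crossElem ℏ (v - u) t (s + (m - 1) / 2) else 0)
      - (if i = m ∧ j = μ + 1 ∧ 1 ≤ i ∧ i < j ∧ j ≤ N then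
        (if σ = true then crossElem ℏ (v - u) t (s + m / 2) else
          -diagElem ℏ (v - u) t (s + (m - 1) / 2) + crossElem ℏ (v - u) t (s + (m - 2) / 2))
        else 0) := by
  cases σ
  all_goals
    simp only [raiseTerm, raiseHead, contractionIntegrand_add_right,
      contractionIntegrand_sub_right, contractionIntegrand_sum_right,
      contractionIntegrand_bPlus_bc hℏ ht,
      contractionIntegrand_bPlus_bPlus ht, contractionIntegrand_bPlus_bMinus hℏ ht,
      reduceCtorEq, if_false, if_true, sub_zero, Finset.sum_const_zero, add_zero]
    split_ifs <;> ring_nf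

theorem isLocal_zero {A B : ℂ → Exponent} (h₁ : ∀ u v : ℂ, ∀ t : ℝ, 0 < t →
    contractionIntegrand N k ℏ (A u) (B v) t = 0) (h₂ : ∀ u v : ℂ, ∀ t : ℝ, 0 < t →
    contractionIntegrand N k ℏ (B v) (A u) t = 0) : IsLocal N k ℏ A B 0 0 :=
  ⟨fun u v t ht => by rw [h₁ u v t ht, sub_self], fun u v t ht => by rw [h₂ v u t ht, sub_self]⟩

/-- The difference of the two shifts in the contraction of a term of `E_μ` with a term of `S_ν`. -/
noncomputable def raiseShift (μ ν m m' : ℕ) (σ τ : Bool) : ℂ :=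
  if m = ν ∧ m' = μ + 1 then
    (if σ = true then (if τ = true then -1 else 0) else (if τ = true then 0 else 1))
  else if m = ν ∧ m' = μ then (if τ = true then 1 else 0)
  else if m = ν + 1 ∧ m' = μ + 1 then (if σ = true then 0 else -1)
  else 0

theorem trichotomy_succ (a b : ℕ) : a < b ∨ a = b ∨ a = b + 1 ∨ b + 1 < a := by omega

set_option maxHeartbeats 1000000 in
-- All first and second differences telescope to one pair. The first shift, hence the pole, is the
-- same for all terms of both currents; only the second shift depends on the pair, and it equals the
-- first (no pole) outside three positions of `(m, m')`.
theorem hasSymbol_raise_screen (hℏ : ℏ ≠ 0) {μ ν m m' : ℕ} (σ τ : Bool) (hν : 1 ≤ ν)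
    (hm : 1 ≤ m) (hmμ : m ≤ μ) (hm' : ν + 1 ≤ m') (hm'N : m' ≤ N) (hμN : μ < N) :
    HasSymbol N k ℏ (raiseTerm ℏ μ σ m) (screenTerm N ℏ ν τ m') ((N - μ - ν) / 2)
      ((N - μ - ν) / 2 + raiseShift μ ν m m' σ τ) := by
  intro u v t ht
  rw [contractionIntegrand_raiseTerm_screenTerm hℏ ht σ τ hν]
  simp only [contractionIntegrand_bPlus_screenTerm hℏ ht _ _ _ hν,
    contractionIntegrand_bc_screenTerm hℏ ht _ _ _ hν, raiseShift]
  rcases trichotomy_succ m ν with h1 | h1 | h1 | h1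
  -- The `E`-term involves only rows up to `m < ν`, so nothing contracts.
  · simp (disch := omega) only [if_neg]
    simp
  all_goals
    rcases trichotomy_succ m' μ with h3 | h3 | h3 | h3
    all_goals
      rcases trichotomy_succ μ ν with h2 | h2 | h2 | h2 <;> try (exfalso; omega)
    all_goals
      simp (disch := omega) only [if_pos, if_neg]
      try subst h1
      try subst h3
      try subst h2
      try simp (disch := omega) only [if_pos, if_neg]
      cases σ <;> cases τ <;>
        simp (disch := omega) only [if_pos, if_neg, reduceCtorEq, true_and, or_true, and_true,
        and_false, or_false, if_true, if_false, crossElem, diagElem, Nat.cast_add, Nat.cast_one] <;> ring_nf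

set_option maxHeartbeats 1000000 in
theorem isLocal_raise_screen (hℏ : ℏ ≠ 0) {μ ν m m' : ℕ} (σ τ : Bool) (hν : 1 ≤ ν)
    (hm : 1 ≤ m) (hmμ : m ≤ μ) (hm' : ν + 1 ≤ m') (hm'N : m' ≤ N) (hμN : μ < N) :
    IsLocal N k ℏ (raiseTerm ℏ μ σ m) (screenTerm N ℏ ν τ m') ((N - μ - ν) / 2)
      ((N - μ - ν) / 2 + raiseShift μ ν m m' σ τ) := by
  refine ⟨hasSymbol_raise_screen hℏ σ τ hν hm hmμ hm' hm'N hμN, fun v u t ht => ?_⟩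
  rw [contractionIntegrand_screenTerm_left ht]
  simp only [contractionIntegrand_bPlus_raiseTerm hℏ ht,
      contractionIntegrand_bc_raiseTerm hℏ ht, raiseShift]
  rcases trichotomy_succ m ν with h1 | h1 | h1 | h1 <;>
  rcases trichotomy_succ m' μ with h3 | h3 | h3 | h3
  all_goals
    try subst h1
    try subst h3
    cases σ <;> cases τ <;>
    simp (disch := omega) only [if_pos, if_neg, reduceCtorEq, true_and, false_and,
        if_true, if_false, crossElem, diagElem, Nat.cast_add, Nat.cast_one] <;> ring_nf

end YangianFreeField

namespace YangianFreeField

variable {N : ℕ} {k : ℂ} {ℏ : ℝ}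

/-! ### The currents as sums of vertex operators -/

theorem vertex_mul_vertex (A B : Exponent) : vertex A * vertex B = vertex (A + B) := by
  simp [vertex, AddMonoidAlgebra.single_mul_single]

theorem smul_vertex (a : ℂ) (A : Exponent) : a • vertex A = AddMonoidAlgebra.single A a := by
  simp [vertex]

/-- The sign of the first (`true`) or second (`false`) term of a difference. -/
def bracketSign (σ : Bool) : ℂ := if σ = true then 1 else -1

variable (N k ℏ) in
/-- The exponents of the vertex operators in `S_ν(v)`. -/
noncomputable def currentTerm (ν : ℕ) (τ : Bool) (m : ℕ) (v : ℂ) : Exponent :=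
  ratioExp N k ℏ ν ((k + N) / 4) v + screenTerm N ℏ ν τ m v

/-- The overall minus sign of `S̃` reverses the bracket, so its second term, labelled `true`,
carries the plus sign. -/
theorem screeningTilde_eq_sum (ν : ℕ) (v : ℂ) :
    screeningTilde N ℏ ν v = ∑ p ∈ Finset.Icc (ν + 1) N ×ˢ Finset.univ,
      AddMonoidAlgebra.single (screenTerm N ℏ ν p.2 p.1 v) (1 / ℏ * bracketSign p.2) := by
  rw [screeningTilde, Finset.sum_product, Finset.smul_sum]
  refine Finset.sum_congr rfl fun m _ => ?_
  simp only [Fintype.sum_bool, ← smul_vertex, screenTerm, screenHead, mul_sub, sub_mul,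
    vertex_mul_vertex, bracketSign, smul_sub, if_true, reduceCtorEq, if_false]
  module

theorem screening_eq_sum (ν : ℕ) (v : ℂ) :
    screening N k ℏ ν v = ∑ p ∈ Finset.Icc (ν + 1) N ×ˢ Finset.univ,
      AddMonoidAlgebra.single (currentTerm N k ℏ ν p.2 p.1 v) (1 / ℏ * bracketSign p.2) := by
  rw [screening, screeningTilde_eq_sum, Finset.mul_sum]
  refine Finset.sum_congr rfl fun p _ => ?_
  rw [← smul_vertex, ← smul_vertex, mul_smul_comm, lamRatio, vertex_mul_vertex]
  rfl

theorem currentE_eq_sum (μ : ℕ) (u : ℂ) :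
    currentE ℏ μ u = ∑ p ∈ Finset.Icc 1 μ ×ˢ Finset.univ,
      AddMonoidAlgebra.single (raiseTerm ℏ μ p.2 p.1 u) (1 / ℏ * bracketSign p.2) := by
  rw [currentE, Finset.sum_product, Finset.smul_sum]
  refine Finset.sum_congr rfl fun m _ => ?_
  simp only [Fintype.sum_bool, ← smul_vertex, raiseTerm, raiseHead, mul_sub, sub_mul,
    vertex_mul_vertex, bracketSign, smul_sub, if_true, reduceCtorEq, if_false]
  module

/-! ### Relations between the exponents -/

theorem sh_sh (u s s' : ℂ) : sh ℏ (sh ℏ u s) s' = sh ℏ u (s + s') := by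
  simp only [sh]; ring

/-- Shifting by `±iℏ/2` multiplies the coefficient by `e^{±ℏt/2}`; the difference produces `2 sinh
(ℏt/2)`, which cancels the denominator and leaves `-2ℏ` on both half lines. This is `χ⁻ - χ⁺`. -/
theorem fieldCoeff_sh_sub (hℏ : ℏ ≠ 0) (u s : ℂ) :
    minusCoeff ℏ (sh ℏ u s) = plusCoeff ℏ (sh ℏ u s) + fieldCoeff ℏ 1 (sh ℏ u (s + 1 / 2)) 0
      - fieldCoeff ℏ 1 (sh ℏ u (s - 1 / 2)) 0 := by
  funext t
  rcases eq_or_ne t 0 with rfl | ht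
  -- At `t = 0` every term is zero, for the singular coefficient by the convention `x / 0 = 0`.
  · simp [minusCoeff, plusCoeff, fieldCoeff]
  have hs : Complex.sinh ((1 : ℂ) / 2 * ℏ * t) ≠ 0 :=
    sinh_ofReal_mul_ne_zero (by simp) hℏ ht
  have e1 : Complex.exp (-(Complex.I * sh ℏ u (s + 1 / 2) * t)) =
      Complex.exp (-(Complex.I * sh ℏ u s * t)) * Complex.exp ((1 : ℂ) / 2 * ℏ * t) := by
    rw [← Complex.exp_add]; congr 1; simp only [sh]; linear_combination (-ℏ*t/2 : ℂ) * Complex.I_sq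
  have e2 : Complex.exp (-(Complex.I * sh ℏ u (s - 1 / 2) * t)) =
      Complex.exp (-(Complex.I * sh ℏ u s * t)) * Complex.exp (-((1 : ℂ) / 2 * ℏ * t)) := by
    rw [← Complex.exp_add]; congr 1; simp only [sh]; linear_combination (ℏ*t/2 : ℂ) * Complex.I_sq
  have e3 := Complex.two_sinh ((1 : ℂ) / 2 * ℏ * t)
  simp only [Pi.add_apply, Pi.sub_apply, fieldCoeff, e1, e2, zero_mul, neg_zero, Complex.exp_zero,
    ite_self, mul_one]
  have e4 : (-ℏ : ℂ) / Complex.sinh (1 / 2 * ℏ * t) * (Complex.exp (-(Complex.I * sh ℏ u s * t)) *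
      Complex.exp (1 / 2 * ℏ * t)) - -ℏ / Complex.sinh (1 / 2 * ℏ * t) *
      (Complex.exp (-(Complex.I * sh ℏ u s * t)) * Complex.exp (-(1 / 2 * ℏ * t)))
      = -(2 * ℏ) * Complex.exp (-(Complex.I * sh ℏ u s * t)) := by
    rw [← mul_sub, ← mul_sub, ← e3, div_mul_eq_mul_div, div_eq_iff hs]
    ring
  rw [add_sub_assoc, e4]
  rcases ht.lt_or_gt with h | h
  · simp [minusCoeff, plusCoeff, h, h.not_gt]
  · simp [minusCoeff, plusCoeff, h, h.not_gt]

/-- Eliminates `b⁻` in favour of `b⁺` and shifted `b`. After this substitution, coincidences between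
residues are identities in a free abelian notation. -/
theorem bMinus_sh (hℏ : ℏ ≠ 0) (i j : ℕ) (u s : ℂ) :
    bMinus ℏ i j (sh ℏ u s) = bPlus ℏ i j (sh ℏ u s)
      + bExp i j (fieldCoeff ℏ 1 (sh ℏ u (s + 1 / 2)) 0)
      - bExp i j (fieldCoeff ℏ 1 (sh ℏ u (s - 1 / 2)) 0) := by
  rw [bMinus, fieldCoeff_sh_sub hℏ]
  funext m t
  rcases m with _ | ⟨a, b⟩ | _ <;> simp only [bPlus, bExp, Pi.add_apply, Pi.sub_apply]
  · simp
  · split_ifs <;> simp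
  · simp

theorem sum_Icc_succ_bot {M : Type*} [AddCommMonoid M] {m n : ℕ} (h : m ≤ n) (f : ℕ → M) :
    ∑ i ∈ Finset.Icc m n, f i = f m + ∑ i ∈ Finset.Icc (m + 1) n, f i := by
  rw [Finset.Icc_add_one_left_eq_Ioc, Finset.add_sum_Ioc_eq_sum_Icc h]

/-- Raising `m` from `ν` to `ν + 1` gives the tail of `E_μ` the factor `n = ν`; raising `m'` from
`μ` to `μ + 1` takes the factor `n = μ + 1` from the tail of `S̃_ν`. At the common pole these
changes compensate those in the heads. -/
theorem raise_screen_add_eq₁ (hℏ : ℏ ≠ 0) {μ ν : ℕ} (hμN : μ < N) (hν : 1 ≤ ν) (v : ℂ) :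
    raiseTerm ℏ μ true ν (sh ℏ v (-((N - μ - ν) / 2))) + screenTerm N ℏ ν true μ v =
    raiseTerm ℏ μ false (ν + 1) (sh ℏ v (-((N - μ - ν) / 2)))
      + screenTerm N ℏ ν false (μ + 1) v := by
  simp only [raiseTerm, raiseHead, screenTerm, screenHead, Finset.sum_Ico_succ_top hν,
    sum_Icc_succ_bot (show μ + 1 ≤ N from hμN), sh_sh, bMinus_sh hℏ, bc]
  push_cast
  ring_nf

theorem raise_screen_add_eq₂ (hℏ : ℏ ≠ 0) {μ ν : ℕ} (v : ℂ) :
    raiseTerm ℏ μ true ν (sh ℏ v (-((N - μ - ν) / 2))) + screenTerm N ℏ ν true (μ + 1) v =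
    raiseTerm ℏ μ false ν (sh ℏ v (-((N - μ - ν) / 2))) + screenTerm N ℏ ν false (μ + 1) v := by
  simp only [raiseTerm, raiseHead, screenTerm, screenHead, sh_sh, bMinus_sh hℏ, bc]
  push_cast
  ring_nf

theorem raise_screen_add_eq₃ (hℏ : ℏ ≠ 0) {μ ν : ℕ} (hμN : μ < N) (hν : 1 ≤ ν) (v : ℂ) :
    raiseTerm ℏ μ false ν (sh ℏ v (-((N - μ - ν) / 2))) + screenTerm N ℏ ν true μ v =
    raiseTerm ℏ μ false (ν + 1) (sh ℏ v (-((N - μ - ν) / 2)))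
      + screenTerm N ℏ ν true (μ + 1) v := by
  simp only [raiseTerm, raiseHead, screenTerm, screenHead, Finset.sum_Ico_succ_top hν,
    sum_Icc_succ_bot (show μ + 1 ≤ N from hμN), sh_sh, bMinus_sh hℏ, bc]
  push_cast
  ring_nf

/-! ### Products with `E_μ` -/

theorem contractionIntegrand_eq_zero_of_lam {A B : Exponent} (hA : ∀ m, (∀ i, m ≠ .lam i) → A m = 0)
    (hB : ∀ i, B (.lam i) = 0) (t : ℝ) : contractionIntegrand N k ℏ A B t = 0 ∧
      contractionIntegrand N k ℏ B A t = 0 := by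
  have h : ∀ m m' s t, A m s * B m' t = 0 ∨ ∃ i, m = .lam i ∧ ∀ j, m' ≠ .lam j := by
    intro m m' s t
    by_cases h1 : ∀ i, m ≠ .lam i
    · simp [hA m h1]
    · push Not at h1
      obtain ⟨i, rfl⟩ := h1
      rcases m' with j | ⟨a, b⟩ | ⟨a, b⟩ <;> simp [hB]
  have h1 : ∀ m m' t, A m t * B m' (-t) * commutator N k ℏ m m' t = 0 := by
    intro m m' t
    rcases h m m' t (-t) with h | ⟨i, rfl, h⟩
    · rw [h, zero_mul]
    · rcases m' with j | ⟨a, b⟩ | ⟨a, b⟩ <;> simp [commutator] at h ⊢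
  have h2 : ∀ m m' t, B m t * A m' (-t) * commutator N k ℏ m m' t = 0 := by
    intro m m' t
    rcases h m' m (-t) t with h | ⟨i, rfl, h⟩
    · rw [mul_comm (B m t), h, zero_mul]
    · rcases m with j | ⟨a, b⟩ | ⟨a, b⟩ <;> simp [commutator] at h ⊢
  simp [contractionIntegrand, h1, h2, sumModes_zero]

theorem ratioExp_eq_zero (j : ℕ) (α v : ℂ) (m : Mode) (hm : ∀ i, m ≠ .lam i) :
    ratioExp N k ℏ j α v m = 0 := by
  rcases m with j | ⟨a, b⟩ | ⟨a, b⟩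
  · exact absurd rfl (hm j)
  all_goals
    funext t
    simp [ratioExp, lamField, lamExp]

theorem screenTerm_lam (ν : ℕ) (τ : Bool) (m : ℕ) (v : ℂ) (i : ℕ) :
    screenTerm N ℏ ν τ m v (.lam i) = 0 := by
  funext t
  cases τ <;> simp [screenTerm, screenHead, bc, bPlus, bMinus, bExp, cExp, Finset.sum_apply]

theorem raiseTerm_lam (μ : ℕ) (σ : Bool) (m : ℕ) (u : ℂ) (i : ℕ) :
    raiseTerm ℏ μ σ m u (.lam i) = 0 := by
  funext t
  cases σ <;> simp [raiseTerm, raiseHead, bc, bPlus, bMinus, bExp, cExp, Finset.sum_apply]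

theorem isField_currentTerm (hℏ : ℏ ≠ 0) (hk : (k + N).re ≠ 0) (ν : ℕ) (τ : Bool) (m : ℕ) :
    IsField (currentTerm N k ℏ ν τ m) :=
  (isField_ratioExp hℏ hk ν _).add (isField_screenTerm hℏ ν τ m)

theorem isLocal_raise_current (hℏ : ℏ ≠ 0) {μ ν m m' : ℕ} (σ τ : Bool) (hν : 1 ≤ ν)
    (hm : 1 ≤ m) (hmμ : m ≤ μ) (hm' : ν + 1 ≤ m') (hm'N : m' ≤ N) (hμN : μ < N) :
    IsLocal N k ℏ (raiseTerm ℏ μ σ m) (currentTerm N k ℏ ν τ m') ((N - μ - ν) / 2)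
      ((N - μ - ν) / 2 + raiseShift μ ν m m' σ τ) := by
  have h := isLocal_raise_screen (k := k) hℏ σ τ hν hm hmμ hm' hm'N hμN
  have h0 := fun (u v : ℂ) (t : ℝ) => contractionIntegrand_eq_zero_of_lam (N := N) (k := k) (ℏ := ℏ)
    (ratioExp_eq_zero (N := N) (k := k) (ℏ := ℏ) ν ((k + N) / 4) v) (raiseTerm_lam (ℏ := ℏ) μ σ m u) t
  refine ⟨fun u v t ht => ?_, fun v u t ht => ?_⟩
  · rw [currentTerm, contractionIntegrand_add_right, (h0 u v t).2, zero_add, h.1 u v t ht]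
  · rw [currentTerm, contractionIntegrand_add_left, (h0 u v t).1, zero_add, h.2 v u t ht]

/-- The residue of each pair is weighted by the difference `D` of its two shifts, so the polar part
is an explicit finite sum. Locality is required only for nonzero coefficients, since the degenerate
brackets of `F` (`m = μ`, `m = μ + 1`) carry a spurious label. -/
theorem Expansion.of_isLocal {S T : Finset ℕ} {A B : ℕ → Bool → ℂ → Exponent}
    {s : ℕ → Bool → ℂ} {D : ℕ → ℕ → Bool → Bool → ℂ} (a b : ℕ → Bool → ℂ)
    (h : ∀ m ∈ S, ∀ m' ∈ T, ∀ σ τ, a m σ ≠ 0 →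
      IsLocal N k ℏ (A m σ) (B m' τ) (s m σ) (s m σ + D m m' σ τ))
    (hA : ∀ m σ, IsField (A m σ)) (hB : ∀ m τ, IsField (B m τ)) :
    Expansion N k ℏ (fun _ _ => 1) (fun _ _ => 1)
      (fun u => ∑ p ∈ S ×ˢ Finset.univ, AddMonoidAlgebra.single (A p.1 p.2 u) (a p.1 p.2))
      (fun v => ∑ q ∈ T ×ˢ Finset.univ, AddMonoidAlgebra.single (B q.1 q.2 v) (b q.1 q.2))
      (fun u v z => ∑ m ∈ S, ∑ m' ∈ T, ∑ σ, ∑ τ, a m σ * b m' τ * D m m' σ τ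
        * (Complex.I * ℏ / (u - v + s m σ * Complex.I * ℏ)
          * matrixElement z (vertex (A m σ (sh ℏ v (-s m σ)) + B m' τ v)))) := by
  have key : ∀ p ∈ S ×ˢ (Finset.univ : Finset Bool), ∀ q ∈ T ×ˢ (Finset.univ : Finset Bool),
      Expansion N k ℏ (fun _ _ => 1) (fun _ _ => 1)
        (fun u => AddMonoidAlgebra.single (A p.1 p.2 u) (a p.1 p.2))
        (fun v => AddMonoidAlgebra.single (B q.1 q.2 v) (b q.1 q.2))
        (fun u v z => a p.1 p.2 * b q.1 q.2 * D p.1 q.1 p.2 q.2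
        * (Complex.I * ℏ / (u - v + s p.1 p.2 * Complex.I * ℏ)
          * matrixElement z (vertex (A p.1 p.2 (sh ℏ v (-s p.1 p.2)) + B q.1 q.2 v)))) := by
    rintro ⟨m, σ⟩ hp ⟨m', τ⟩ hq
    by_cases h0 : a m σ = 0
    · simpa only [h0, AddMonoidAlgebra.single_zero, zero_mul] using Expansion.zero_left
    · convert (h m (Finset.mem_product.1 hp).1 m' (Finset.mem_product.1 hq).1 σ τ h0).expansion
        (hA m σ) (hB m' τ) (a m σ) (b m' τ) using 4 with u v z
      ring
  convert Expansion.sum_sum _ _ key using 4 with u v z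
  simp only [Finset.sum_product]
  refine Finset.sum_congr rfl fun m _ => ?_
  rw [Finset.sum_comm]

theorem sum_sum_ite (S T : Finset ℕ) (a b : ℕ) (X : ℕ → ℕ → ℂ) :
    ∑ m ∈ S, ∑ m' ∈ T, (if m = a ∧ m' = b then X m m' else 0)
      = if a ∈ S ∧ b ∈ T then X a b else 0 := by
  simp only [ite_and, Finset.sum_ite_irrel, Finset.sum_ite_eq', Finset.sum_const_zero]

/-- Six pairs of vertex operators have poles, two at each of the positions `(ν, μ+1)`, `(ν, μ)`,
`(ν+1, μ+1)`. Their residues cancel in twos: both at `(ν, μ+1)` against each other, and those at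
`(ν, μ)` against those at `(ν+1, μ+1)`. -/
theorem ope_currentE (hℏ : ℏ ≠ 0) (hk : (k + N).re ≠ 0) {μ ν : ℕ} (hμN : μ < N)
    (hν : 1 ≤ ν) :
    OPE N k ℏ (currentE ℏ μ) (screening N k ℏ ν) fun _ _ _ => 0 := by
  rw [ope_iff_expansion, funext (currentE_eq_sum μ), funext (screening_eq_sum ν)]
  convert Expansion.of_isLocal (S := Finset.Icc 1 μ) (T := Finset.Icc (ν + 1) N)
    (A := fun m σ => raiseTerm ℏ μ σ m) (B := fun m τ => currentTerm N k ℏ ν τ m)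
    (s := fun _ _ => (N - μ - ν) / 2) (D := raiseShift μ ν)
    (fun _ σ => 1 / ℏ * bracketSign σ) (fun _ σ => 1 / ℏ * bracketSign σ)
    (fun m hm m' hm' σ τ _ => isLocal_raise_current hℏ σ τ hν (Finset.mem_Icc.1 hm).1
      (Finset.mem_Icc.1 hm).2 (Finset.mem_Icc.1 hm').1 (Finset.mem_Icc.1 hm').2 hμN)
    (fun m σ => isField_raiseTerm hℏ μ σ m)
    (fun m τ => isField_currentTerm hℏ hk ν τ m) using 4 with u v z
  set G : ℕ → Bool → ℕ → Bool → ℂ := fun m σ m' τ =>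
    Complex.I * ℏ / (u - v + (N - μ - ν) / 2 * Complex.I * ℏ) *
    matrixElement z (vertex (raiseTerm ℏ μ σ m (sh ℏ v (-((N - μ - ν) / 2))) +
      currentTerm N k ℏ ν τ m' v)) with hG
  have e : ∀ m m', ∑ σ, ∑ τ, 1 / (ℏ : ℂ) * bracketSign σ * (1 / ℏ * bracketSign τ)
        * raiseShift μ ν m m' σ τ * G m σ m' τ
      = (if m = ν ∧ m' = μ + 1 then
          1 / (ℏ : ℂ) ^ 2 * (G m false m' false - G m true m' true) else 0)
      + (if m = ν ∧ m' = μ then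
          1 / (ℏ : ℂ) ^ 2 * (G m true m' true - G m false m' true) else 0)
      + (if m = ν + 1 ∧ m' = μ + 1 then
          1 / (ℏ : ℂ) ^ 2 * (G m false m' true - G m false m' false) else 0) := by
    intro m m'
    simp only [Fintype.sum_bool, bracketSign, raiseShift, if_true, reduceCtorEq, if_false]
    by_cases h1 : m = ν ∧ m' = μ + 1
    · simp (disch := omega) only [if_pos, if_neg]; ring
    by_cases h2 : m = ν ∧ m' = μ
    · simp (disch := omega) only [if_pos, if_neg]; ring
    by_cases h3 : m = ν + 1 ∧ m' = μ + 1
    · simp (disch := omega) only [if_pos, if_neg]; ring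
    · simp only [h1, h2, h3, if_false]; ring
  have e₁ : G ν true μ true = G (ν + 1) false (μ + 1) false := by
    simp only [hG, currentTerm]
    rw [add_left_comm, raise_screen_add_eq₁ hℏ hμN hν, add_left_comm]
  have e₂ : G ν true (μ + 1) true = G ν false (μ + 1) false := by
    simp only [hG, currentTerm]
    rw [add_left_comm, raise_screen_add_eq₂ hℏ, add_left_comm]
  have e₃ : G ν false μ true = G (ν + 1) false (μ + 1) true := by
    simp only [hG, currentTerm]
    rw [add_left_comm, raise_screen_add_eq₃ hℏ hμN hν, add_left_comm]
  change _ = ∑ m ∈ _, ∑ m' ∈ _, ∑ σ, ∑ τ, _ * G m σ m' τ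
  simp only [e, Finset.sum_add_distrib, sum_sum_ite, Finset.mem_Icc]
  rw [e₂, e₁, e₃]
  -- The positions `(ν, μ)` and `(ν+1, μ+1)` lie in the range of summation under the same condition
  -- `ν < μ`, so partners are present or absent together.
  split_ifs <;> first | (exfalso; omega) | ring

end YangianFreeField

namespace YangianFreeField

variable {N : ℕ} {k : ℂ} {ℏ : ℝ}

/-! ### Products with `H^±_μ` -/

/-- The contraction of a tail `∏_{n ≥ a} b⁺_{i,n}` with a term of `S_ν`. -/
theorem sum_bPlus_screenTerm_row (hℏ : ℏ ≠ 0) {t : ℝ} (ht : 0 < t) (i a : ℕ) {ν m : ℕ} (τ : Bool)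
    (hν : 1 ≤ ν) (hia : i < a) (haN : a ≤ N + 1) (hmN : m ≤ N) (u v c : ℂ) :
    ∑ n ∈ Finset.Icc a N, contractionIntegrand N k ℏ (bPlus ℏ i n (sh ℏ u (c - n / 2)))
        (screenTerm N ℏ ν τ m v) t =
      if i = ν + 1 then
        elem ℏ (u - v) t (c - N / 2 - 1 / 2) - elem ℏ (u - v) t (c - N / 2 + 1 / 2)
          - (if a ≤ m then 0 else elem ℏ (u - v) t (c + N / 2 - a + 1 / 2)
            - elem ℏ (u - v) t (c + N / 2 - a + 3 / 2))
      else if i = ν then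
        elem ℏ (u - v) t (c - N / 2) - elem ℏ (u - v) t (c - N / 2 - 1)
          + (if a ≤ m then 0 else elem ℏ (u - v) t (c + N / 2 - a)
            - elem ℏ (u - v) t (c + N / 2 - a + 1))
      else 0 := by
  -- Downward induction on the lower end `a`. The second differences telescope: one boundary term
  -- comes from `n = N`, and one from `n = a` unless the row still contains the head entry `m`.
  induction hd : N + 1 - a generalizing a with
  | zero =>
    obtain rfl : a = N + 1 := by omega
    simp (disch := omega) only [Finset.Icc_eq_empty, Finset.sum_empty, if_neg]
    push_cast
    split_ifs <;> ring_nf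
  | succ d ih =>
    rw [sum_Icc_succ_bot (by omega), ih (a + 1) (by omega) (by omega) (by omega),
      contractionIntegrand_bPlus_screenTerm hℏ ht _ _ _ hν]
    by_cases h1 : i = ν + 1
    · rcases lt_trichotomy a m with h3 | h3 | h3 <;>
        simp (disch := omega) only [if_pos, if_neg, crossElem, diagElem] <;> push_cast <;> ring_nf
    by_cases h2 : i = ν
    · rcases lt_trichotomy a m with h3 | h3 | h3 <;>
        simp (disch := omega) only [if_pos, if_neg, crossElem, diagElem] <;> push_cast <;> ring_nf
    · simp (disch := omega) only [if_neg, add_zero]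

theorem adjacency (a b : ℕ) : a + 1 < b ∨ b = a + 1 ∨ a = b ∨ a = b + 1 ∨ b + 1 < a := by omega

/-- The exponent of `H⁺_μ(u)`. -/
noncomputable def hPlusExp (N : ℕ) (k : ℂ) (ℏ : ℝ) (μ : ℕ) (u : ℂ) : Exponent :=
  rootPlus ℏ μ ((k - N) / 4) u + (∑ m ∈ Finset.Icc 1 μ,
        (bPlus ℏ m (μ + 1) (sh ℏ u (-(m - 1) / 2)) - bPlus ℏ m μ (sh ℏ u (-m / 2)))
    + ∑ n ∈ Finset.Icc (μ + 1) N,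
        (bPlus ℏ μ n (sh ℏ u (0 - n / 2)) - bPlus ℏ (μ + 1) n (sh ℏ u (1 / 2 - n / 2))))

/-- The exponent of `H⁻_μ(u)`. -/
noncomputable def hMinusExp (N : ℕ) (k : ℂ) (ℏ : ℝ) (μ : ℕ) (u : ℂ) : Exponent :=
  rootMinus ℏ μ (-(k - N) / 4) u + (∑ m ∈ Finset.Icc 1 μ,
        (bMinus ℏ m (μ + 1) (sh ℏ u ((m - 1) / 2)) - bMinus ℏ m μ (sh ℏ u (m / 2)))
    + ∑ n ∈ Finset.Icc (μ + 1) N,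
        (bMinus ℏ μ n (sh ℏ u (n / 2)) - bMinus ℏ (μ + 1) n (sh ℏ u ((n - 1) / 2))))

theorem currentHPlus_eq (μ : ℕ) (u : ℂ) :
    currentHPlus N k ℏ μ u = AddMonoidAlgebra.single (hPlusExp N k ℏ μ u) 1 := by
  rw [currentHPlus, hPlusExp, rootPlus, vertex, ← add_assoc]
  congr 5; ring_nf

theorem currentHMinus_eq (μ : ℕ) (u : ℂ) :
    currentHMinus N k ℏ μ u = AddMonoidAlgebra.single (hMinusExp N k ℏ μ u) 1 := by
  rw [currentHMinus, hMinusExp, rootMinus, vertex, ← add_assoc]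

theorem isField_hPlusExp (μ : ℕ) : IsField (hPlusExp N k ℏ μ) :=
  (isField_rootPlus μ _).add ((IsField.sum _ fun _ =>
    ((isField_bPlus _ _).sh ℏ _).sub ((isField_bPlus _ _).sh ℏ _)).add (IsField.sum _ fun _ =>
    ((isField_bPlus _ _).sh ℏ _).sub ((isField_bPlus _ _).sh ℏ _)))

theorem isField_hMinusExp (μ : ℕ) : IsField (hMinusExp N k ℏ μ) :=
  (isField_rootMinus μ _).add ((IsField.sum _ fun _ =>
    ((isField_bMinus _ _).sh ℏ _).sub ((isField_bMinus _ _).sh ℏ _)).add (IsField.sum _ fun _ =>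
    ((isField_bMinus _ _).sh ℏ _).sub ((isField_bMinus _ _).sh ℏ _)))

theorem rootPlus_eq_zero (i : ℕ) (s u : ℂ) (m : Mode) (hm : ∀ i, m ≠ .lam i) :
    rootPlus ℏ i s u m = 0 := by
  rcases m with j | ⟨a, b⟩ | ⟨a, b⟩
  · exact absurd rfl (hm j)
  all_goals
    funext t
    simp [rootPlus, lamPlus, lamExp]

theorem rootMinus_eq_zero (i : ℕ) (s u : ℂ) (m : Mode) (hm : ∀ i, m ≠ .lam i) :
    rootMinus ℏ i s u m = 0 := by
  rcases m with j | ⟨a, b⟩ | ⟨a, b⟩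
  · exact absurd rfl (hm j)
  all_goals
    funext t
    simp [rootMinus, lamMinus, lamExp]

/-- The λ-sector and the b-sector of two vertex operators contract separately. -/
theorem contractionIntegrand_sectors {A A' B B' : Exponent}
    (hA : ∀ m, (∀ i, m ≠ .lam i) → A m = 0) (hB : ∀ m, (∀ i, m ≠ .lam i) → B m = 0)
    (hA' : ∀ i, A' (.lam i) = 0) (hB' : ∀ i, B' (.lam i) = 0) (t : ℝ) :
    contractionIntegrand N k ℏ (A + A') (B + B') t =
      contractionIntegrand N k ℏ A B t + contractionIntegrand N k ℏ A' B' t := by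
  rw [contractionIntegrand_add_left, contractionIntegrand_add_right,
    contractionIntegrand_add_right, (contractionIntegrand_eq_zero_of_lam hA hB' t).1,
    (contractionIntegrand_eq_zero_of_lam hB hA' t).2]
  ring

set_option maxHeartbeats 1000000 in
-- The parameter `(k+N)/4` of `Λ` and the shift `(k-N)/4` of `λ⁺` combine to `-N/2`. This is where
-- the row sums leave their boundary terms at `n = N`, and these cancel the λ-contraction; the
-- boundary terms at the lower end cancel the column factors. In the opposite order nothing
-- contracts.
theorem isLocal_hPlus_current (hℏ : ℏ ≠ 0) (hk : (k + N).re ≠ 0) {μ ν m : ℕ} (τ : Bool)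
    (hμ : 1 ≤ μ) (hμN : μ < N) (hν : 1 ≤ ν) (hνN : ν < N) (hm : ν + 1 ≤ m) (hmN : m ≤ N) :
    IsLocal N k ℏ (hPlusExp N k ℏ μ) (currentTerm N k ℏ ν τ m) 0 0 := by
  refine isLocal_zero (fun u v t ht => ?_) fun u v t ht => ?_
  · rw [hPlusExp, currentTerm, contractionIntegrand_sectors (rootPlus_eq_zero _ _ _)
      (ratioExp_eq_zero _ _ _) (fun i => ?_) (screenTerm_lam _ _ _ _),
      contractionIntegrand_rootPlus_ratio hk hℏ ht hμ hμN hν hνN]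
    · have hsum := sum_eq_add_succ (S := Finset.Icc 1 μ) (g := fun n =>
        contractionIntegrand N k ℏ (bPlus ℏ n (μ + 1) (sh ℏ u (-(n - 1) / 2)))
          (screenTerm N ℏ ν τ m v) t
        - contractionIntegrand N k ℏ (bPlus ℏ n μ (sh ℏ u (-n / 2))) (screenTerm N ℏ ν τ m v) t) ν
        (fun n _ h1 h2 => by
          simp only [contractionIntegrand_bPlus_screenTerm hℏ ht _ _ _ hν]
          simp (disch := omega) only [if_neg, sub_zero])
      simp only [contractionIntegrand_add_left, contractionIntegrand_sum_left,
        contractionIntegrand_sub_left]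
      -- Row `μ + 1` starts at the diagonal entry `n = μ + 1`, where the telescoped formula does not
      -- apply; that entry is split off.
      rw [hsum, Finset.sum_sub_distrib, sum_Icc_succ_bot (show μ + 1 ≤ N from hμN) fun n : ℕ =>
          contractionIntegrand N k ℏ (bPlus ℏ (μ + 1) n (sh ℏ u (1 / 2 - n / 2)))
            (screenTerm N ℏ ν τ m v) t,
        sum_bPlus_screenTerm_row hℏ ht _ _ τ hν (by omega) (by omega) hmN,
        sum_bPlus_screenTerm_row hℏ ht _ _ τ hν (by omega) (by omega) hmN]
      simp only [contractionIntegrand_bPlus_screenTerm hℏ ht _ _ _ hν, Finset.mem_Icc, rootPair]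
      clear hsum
      rcases adjacency μ ν with h2 | h2 | h2 | h2 | h2 <;>
        rcases trichotomy_succ m μ with h3 | h3 | h3 | h3
      all_goals first
        | (exfalso; omega)
        | (try subst h2
           try subst h3
           simp (disch := omega) only [if_pos, if_neg, if_true, crossElem, diagElem, Nat.cast_add,
               Nat.cast_one, true_and, true_or, or_true]
           try ring_nf)
    · funext t; simp [bPlus, bExp, Finset.sum_apply]
  · rw [currentTerm, hPlusExp, contractionIntegrand_sectors (ratioExp_eq_zero _ _ _)
      (rootPlus_eq_zero _ _ _) (screenTerm_lam _ _ _ _) fun i => ?_]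
    · simp only [contractionIntegrand_screenTerm_left ht, rootPlus, contractionIntegrand_sub_right,
        contractionIntegrand_lamPlus_right ht, contractionIntegrand_add_right,
        contractionIntegrand_sum_right, contractionIntegrand_bPlus_bPlus ht,
        contractionIntegrand_bc_bPlus ht]
      simp
    · funext t; simp [bPlus, bExp, Finset.sum_apply]

set_option maxHeartbeats 1000000 in
theorem isLocal_hMinus_current (hℏ : ℏ ≠ 0) (hk : (k + N).re ≠ 0) {μ ν m : ℕ} (τ : Bool)
    (hμ : 1 ≤ μ) (hμN : μ < N) (hν : 1 ≤ ν) (hνN : ν < N) (hm : ν + 1 ≤ m) (hmN : m ≤ N) :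
    IsLocal N k ℏ (hMinusExp N k ℏ μ) (currentTerm N k ℏ ν τ m) 0 0 := by
  refine isLocal_zero (fun u v t ht => ?_) fun v u t ht => ?_
  · simp only [hMinusExp, rootMinus, contractionIntegrand_sub_left,
        contractionIntegrand_lamMinus_left ht, contractionIntegrand_add_left,
        contractionIntegrand_sum_left, contractionIntegrand_bMinus_left ht]
    simp
  · rw [currentTerm, hMinusExp, contractionIntegrand_sectors (ratioExp_eq_zero _ _ _)
      (rootMinus_eq_zero _ _ _) (screenTerm_lam _ _ _ _) fun i => ?_,
      contractionIntegrand_ratio_rootMinus hk hℏ ht hμ hμN hν hνN,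
      contractionIntegrand_screenTerm_left ht]
    · simp only [contractionIntegrand_add_right, contractionIntegrand_sum_right,
        contractionIntegrand_sub_right, Finset.sum_sub_distrib, sum_bPlus_bMinus_col _ _ _ _ _ _ _ _ hℏ ht,
        sum_bPlus_bMinus_row _ _ _ _ _ _ _ _ hℏ ht, sum_bc_bMinus_col _ _ _ _ _ _ _ _ hℏ ht,
        sum_bc_bMinus_row _ _ _ _ _ _ _ _ hℏ ht, Finset.mem_Icc, rootPair]
      rcases adjacency μ ν with h2 | h2 | h2 | h2 | h2 <;>
        rcases trichotomy_succ m μ with h3 | h3 | h3 | h3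
      all_goals first
        | (exfalso; omega)
        | (try subst h2
           try subst h3
           cases τ <;> simp (disch := omega) only [if_pos, if_neg, if_true, if_false, reduceCtorEq, crossElem, diagElem, Nat.cast_add,
               Nat.cast_one, true_and, true_or, or_true]
           all_goals try ring_nf)
    · funext t; simp [bMinus, bExp, Finset.sum_apply]

theorem ope_screening_of_isLocal (hℏ : ℏ ≠ 0) (hk : (k + N).re ≠ 0) {ν : ℕ}
    {P : ℂ → NormalOrdered} {A : ℂ → Exponent}
    (hP : ∀ u, P u = AddMonoidAlgebra.single (A u) 1) (hA : IsField A)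
    (h : ∀ m ∈ Finset.Icc (ν + 1) N, ∀ τ, IsLocal N k ℏ A (currentTerm N k ℏ ν τ m) 0 0) :
    OPE N k ℏ P (screening N k ℏ ν) fun _ _ _ => 0 := by
  rw [ope_iff_expansion, funext hP, funext (screening_eq_sum ν)]
  convert Expansion.sum_right (Finset.Icc (ν + 1) N ×ˢ (Finset.univ : Finset Bool)) fun q hq =>
    (h q.1 (Finset.mem_product.1 hq).1 q.2).expansion hA (isField_currentTerm hℏ hk ν q.2 q.1)
      1 (1 / ℏ * bracketSign q.2) using 4
  simp

theorem ope_currentHPlus (hℏ : ℏ ≠ 0) (hk : (k + N).re ≠ 0) {μ ν : ℕ} (hμ : 1 ≤ μ) (hμN : μ < N)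
    (hν : 1 ≤ ν) (hνN : ν < N) :
    OPE N k ℏ (currentHPlus N k ℏ μ) (screening N k ℏ ν) fun _ _ _ => 0 :=
  ope_screening_of_isLocal hℏ hk (currentHPlus_eq μ) (isField_hPlusExp μ) fun _ hm τ =>
    isLocal_hPlus_current hℏ hk τ hμ hμN hν hνN (Finset.mem_Icc.1 hm).1 (Finset.mem_Icc.1 hm).2

theorem ope_currentHMinus (hℏ : ℏ ≠ 0) (hk : (k + N).re ≠ 0) {μ ν : ℕ} (hμ : 1 ≤ μ) (hμN : μ < N)
    (hν : 1 ≤ ν) (hνN : ν < N) :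
    OPE N k ℏ (currentHMinus N k ℏ μ) (screening N k ℏ ν) fun _ _ _ => 0 :=
  ope_screening_of_isLocal hℏ hk (currentHMinus_eq μ) (isField_hMinusExp μ) fun _ hm τ =>
    isLocal_hMinus_current hℏ hk τ hμ hμN hν hνN (Finset.mem_Icc.1 hm).1 (Finset.mem_Icc.1 hm).2

end YangianFreeField

namespace YangianFreeField

variable {N : ℕ} {k : ℂ} {ℏ : ℝ}

/-! ### Products of two screening currents -/

/-- Whether the term `(m, σ)` of `S̃_μ` precedes the term `(m', τ)` of `S̃_ν` in the product order. -/
def Precedes (μ ν : ℕ) (m m' : ℕ) (σ τ : Bool) : Prop :=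
  m < m' ∨ (m = m' ∧ if μ = ν then σ = false ∧ τ = true
    else if ν = μ + 1 then τ = true else σ = false)

instance (μ ν m m' : ℕ) (σ τ : Bool) : Decidable (Precedes μ ν m m' σ τ) := by
  unfold Precedes; infer_instance

/-- The first shift in the contraction of a term of `S̃_μ` with a term of `S̃_ν`. -/
noncomputable def screenShift (μ ν : ℕ) (m m' : ℕ) (σ τ : Bool) : ℂ :=
  if μ = ν then
    if m = m' ∧ σ = τ then -1 else if Precedes μ ν m m' σ τ then 0 else -1
  else if μ = ν + 1 ∨ ν = μ + 1 then
    if Precedes μ ν m m' σ τ then 0 else 1 / 2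
  else 0

/-- The second shift in the contraction of a term of `S̃_μ` with a term of `S̃_ν`. -/
noncomputable def screenShift' (μ ν : ℕ) (m m' : ℕ) (σ τ : Bool) : ℂ :=
  if μ = ν then
    if m = m' ∧ σ = τ then 0 else if Precedes μ ν m m' σ τ then 0 else 1
  else if μ = ν + 1 ∨ ν = μ + 1 then
    if Precedes μ ν m m' σ τ then 0 else -1 / 2
  else 0

set_option maxHeartbeats 1000000 in
-- With `z = u - v`: for `μ = ν` the factor is `z / (z - iℏ)` for equal terms, `1` if the first term
-- precedes, and `(z + iℏ) / (z - iℏ)` otherwise. For neighbours it is `1` or `(z - iℏ/2) / (z +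
-- iℏ/2)`, and for distant `μ`, `ν` it is `1`.
theorem hasSymbol_screen_screen (hℏ : ℏ ≠ 0) {μ ν m m' : ℕ} (σ τ : Bool) (hμ : 1 ≤ μ) (hν : 1 ≤ ν)
    (hm : μ + 1 ≤ m) (hmN : m ≤ N) (hm' : ν + 1 ≤ m') (hm'N : m' ≤ N) :
    HasSymbol N k ℏ (screenTerm N ℏ μ σ m) (screenTerm N ℏ ν τ m')
      (screenShift μ ν m m' σ τ) (screenShift' μ ν m m' σ τ) := by
  intro u v t ht
  rw [contractionIntegrand_screenTerm_left ht]
  simp only [contractionIntegrand_bPlus_screenTerm hℏ ht _ _ _ hν,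
    contractionIntegrand_bc_screenTerm hℏ ht _ _ _ hν, screenShift, screenShift', Precedes]
  rcases adjacency μ ν with h2 | h2 | h2 | h2 | h2 <;>
    rcases lt_trichotomy m m' with h3 | h3 | h3
  all_goals
    try subst h2
    try subst h3
    cases σ <;> cases τ <;> simp (disch := omega) only [if_pos, if_neg, if_true, if_false,
      reduceCtorEq, crossElem, diagElem, ite_self, true_and, true_or, or_true,
      and_true, and_false, or_false]
    all_goals try ring_nf

/-- Ties `m = m'` are broken by the bracket labels so that exactly one of two terms precedes the
other. Thus one order of a pair has a trivial factor and the other a fraction. -/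
theorem precedes_iff_not {μ ν m m' : ℕ} {σ τ : Bool} (h : μ = ν → ¬(m = m' ∧ σ = τ)) :
    (μ = ν ∨ μ = ν + 1 ∨ ν = μ + 1) → (Precedes ν μ m' m τ σ ↔ ¬Precedes μ ν m m' σ τ) := by
  rintro (rfl | rfl | rfl) <;> rcases lt_trichotomy m m' with h3 | rfl | h3 <;>
    cases σ <;> cases τ <;> simp [Precedes] at h ⊢ <;> omega

theorem expansion_screen_screen (hℏ : ℏ ≠ 0) {μ ν m m' : ℕ} (σ τ : Bool) (hμ : 1 ≤ μ) (hν : 1 ≤ ν)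
    (hm : μ + 1 ≤ m) (hmN : m ≤ N) (hm' : ν + 1 ≤ m') (hm'N : m' ≤ N) (a b : ℂ) :
    Expansion N k ℏ (fun u v => 1 / (u - v - Complex.I * halfCartan μ ν * ℏ))
      (fun u v => 1 / (u - v + Complex.I * halfCartan μ ν * ℏ))
      (fun u => AddMonoidAlgebra.single (screenTerm N ℏ μ σ m u) a)
      (fun v => AddMonoidAlgebra.single (screenTerm N ℏ ν τ m' v) b) (fun _ _ _ => 0) := by
  have h₁ := hasSymbol_screen_screen (k := k) hℏ σ τ hμ hν hm hmN hm' hm'N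
  have h₂ := hasSymbol_screen_screen (k := k) hℏ τ σ hν hμ hm' hm'N hm hmN
  -- In each case `q` is the contraction factor times `z - iBℏ`; that the reversed pair, times `z +
  -- iBℏ`, gives the same polynomial uses the antisymmetry of `Precedes`.
  have main : ∃ q : ℂ → ℂ, Differentiable ℂ q ∧
      (∀ z, (z + screenShift' μ ν m m' σ τ * Complex.I * ℏ) * (z - Complex.I * halfCartan μ ν * ℏ)
        = q z * (z + screenShift μ ν m m' σ τ * Complex.I * ℏ)) ∧
      (∀ z, (z - screenShift' ν μ m' m τ σ * Complex.I * ℏ) * (z + Complex.I * halfCartan μ ν * ℏ)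
        = q z * (z - screenShift ν μ m' m τ σ * Complex.I * ℏ)) := by
    have hP := precedes_iff_not (μ := μ) (ν := ν) (m := m) (m' := m') (σ := σ) (τ := τ)
    rcases eq_or_ne μ ν with rfl | hne
    · by_cases he : m = m' ∧ σ = τ
      · obtain ⟨rfl, rfl⟩ := he
        refine ⟨fun z => z, by fun_prop, fun z => ?_, fun z => ?_⟩ <;>
          simp [-mul_eq_mul_left_iff, -mul_eq_mul_right_iff, screenShift, screenShift', halfCartan] <;> ring
      · have he' : ¬(m' = m ∧ τ = σ) := fun h => he ⟨h.1.symm, h.2.symm⟩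
        have hP := hP (fun _ => he) (Or.inl rfl)
        by_cases hp : Precedes μ μ m m' σ τ
        · refine ⟨fun z => z - Complex.I * ℏ, by fun_prop, fun z => ?_, fun z => ?_⟩ <;>
            simp [-mul_eq_mul_left_iff, -mul_eq_mul_right_iff, screenShift, screenShift', halfCartan, he, he', hp, hP] <;> ring
        · refine ⟨fun z => z + Complex.I * ℏ, by fun_prop, fun z => ?_, fun z => ?_⟩ <;>
            simp [-mul_eq_mul_left_iff, -mul_eq_mul_right_iff, screenShift, screenShift', halfCartan, he, he', hp, hP] <;> ring
    · by_cases hadj : μ = ν + 1 ∨ ν = μ + 1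
      · have hP := hP (fun h => absurd h hne) (Or.inr hadj)
        by_cases hp : Precedes μ ν m m' σ τ
        · refine ⟨fun z => z + Complex.I * ℏ / 2, by fun_prop, fun z => ?_, fun z => ?_⟩ <;>
            simp [-mul_eq_mul_left_iff, -mul_eq_mul_right_iff, screenShift, screenShift', halfCartan, hne, hne.symm, hadj, hadj.symm, hp, hP] <;>
            ring
        · refine ⟨fun z => z - Complex.I * ℏ / 2, by fun_prop, fun z => ?_, fun z => ?_⟩ <;>
            simp [-mul_eq_mul_left_iff, -mul_eq_mul_right_iff, screenShift, screenShift', halfCartan, hne, hne.symm, hadj, hadj.symm, hp, hP] <;>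
            ring
      · have hadj' : ¬(ν = μ + 1 ∨ μ = ν + 1) := fun h => hadj h.symm
        refine ⟨fun z => z, by fun_prop, fun z => ?_, fun z => ?_⟩ <;>
          simp [-mul_eq_mul_left_iff, -mul_eq_mul_right_iff, screenShift, screenShift', halfCartan, hne, hne.symm, hadj, hadj']
  obtain ⟨q, hq, hq₁, hq₂⟩ := main
  exact h₁.expansion h₂ (isField_screenTerm hℏ μ σ m) (isField_screenTerm hℏ ν τ m') a b q hq hq₁ hq₂

theorem expansion_screeningTilde (hℏ : ℏ ≠ 0) {μ ν : ℕ} (hμ : 1 ≤ μ) (hν : 1 ≤ ν) :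
    Expansion N k ℏ (fun u v => 1 / (u - v - Complex.I * halfCartan μ ν * ℏ))
      (fun u v => 1 / (u - v + Complex.I * halfCartan μ ν * ℏ))
      (screeningTilde N ℏ μ) (screeningTilde N ℏ ν) (fun _ _ _ => 0) := by
  rw [funext (screeningTilde_eq_sum μ), funext (screeningTilde_eq_sum ν)]
  convert Expansion.sum_sum (Finset.Icc (μ + 1) N ×ˢ (Finset.univ : Finset Bool))
    (Finset.Icc (ν + 1) N ×ˢ (Finset.univ : Finset Bool)) fun p hp q hq => by
      simp only [Finset.mem_product, Finset.mem_Icc] at hp hq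
      exact expansion_screen_screen (k := k) hℏ p.2 q.2 hμ hν hp.1.1 hp.1.2 hq.1.1 hq.1.2
        (1 / ℏ * bracketSign p.2) (1 / ℏ * bracketSign q.2) using 4
  simp

end YangianFreeField

namespace YangianFreeField

variable {N : ℕ} {k : ℂ} {ℏ : ℝ}

/-! ### The terms of `F_μ` -/

/-- The bracket of the `m`-th summand of the first sum in `F_μ(u)`: its first term for `σ = false`,
its second term for `σ = true`. -/
noncomputable def lowerHead (ℏ : ℝ) (μ : ℕ) (u : ℂ) : Bool → ℕ → Exponent
  | false, m => -bMinus ℏ m μ (sh ℏ u (m / 2)) - bc ℏ m μ (sh ℏ u ((m - 1) / 2))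
  | true, m => -bPlus ℏ m μ (sh ℏ u (m / 2)) - bc ℏ m μ (sh ℏ u ((m + 1) / 2))

/-- The b-sector of the exponents in the first sum of `F_μ(u)`. -/
noncomputable def lowerTerm (N : ℕ) (ℏ : ℝ) (μ : ℕ) (σ : Bool) (m : ℕ) (u : ℂ) : Exponent :=
  bc ℏ m (μ + 1) (sh ℏ u (m / 2)) + lowerHead ℏ μ u σ m
    + ∑ n ∈ Finset.Icc (m + 1) μ,
        (bMinus ℏ n (μ + 1) (sh ℏ u ((n - 1) / 2)) - bMinus ℏ n μ (sh ℏ u (n / 2)))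
    + ∑ n ∈ Finset.Icc (μ + 1) N,
        (bMinus ℏ μ n (sh ℏ u (n / 2)) - bMinus ℏ (μ + 1) n (sh ℏ u ((n - 1) / 2)))

/-- The bracket of the `m`-th summand of the second sum in `F_μ(u)`: its first term for `σ = true`,
its second term for `σ = false`. -/
noncomputable def lowerHead' (k : ℂ) (ℏ : ℝ) (μ : ℕ) (u : ℂ) : Bool → ℕ → Exponent
  | true, m => bPlus ℏ (μ + 1) m (sh ℏ u (-(2 * k + m - 1) / 2))
      - bc ℏ (μ + 1) m (sh ℏ u (-(2 * k + m) / 2))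
  | false, m => bMinus ℏ (μ + 1) m (sh ℏ u (-(2 * k + m - 1) / 2))
      - bc ℏ (μ + 1) m (sh ℏ u (-(2 * k + m - 2) / 2))

/-- The b-sector of the exponents in the second sum of `F_μ(u)`. -/
noncomputable def lowerTerm' (N : ℕ) (k : ℂ) (ℏ : ℝ) (μ : ℕ) (σ : Bool) (m : ℕ) (u : ℂ) :
    Exponent :=
  bc ℏ μ m (sh ℏ u (-(2 * k + m - 1) / 2)) + lowerHead' k ℏ μ u σ m
    + ∑ n ∈ Finset.Icc m N, (bPlus ℏ μ n (sh ℏ u (-(2 * k + n) / 2))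
      - bPlus ℏ (μ + 1) n (sh ℏ u (-(2 * k + n - 1) / 2)))

theorem bExp_self (i : ℕ) (f : ℝ → ℂ) : bExp i i f = 0 := by
  funext m t; rcases m with _ | _ | _ <;> simp [bExp]

theorem cExp_self (i : ℕ) (f : ℝ → ℂ) : cExp i i f = 0 := by
  funext m t; rcases m with _ | _ | _ <;> simp [cExp]

theorem lowerHead_self (μ : ℕ) (u : ℂ) (σ : Bool) : lowerHead ℏ μ u σ μ = 0 := by
  cases σ <;> simp [lowerHead, bMinus, bPlus, bc, bExp_self, cExp_self]

theorem lowerHead'_self (μ : ℕ) (u : ℂ) (σ : Bool) : lowerHead' k ℏ μ u σ (μ + 1) = 0 := by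
  cases σ <;> simp [lowerHead', bMinus, bPlus, bc, bExp_self, cExp_self]

/-- The coefficients of the vertex operators in the first sum of `ℏ F_μ`. -/
def lowerCoeff (μ m : ℕ) (σ : Bool) : ℂ := if σ = true then (if m = μ then 0 else -1) else 1

/-- The coefficients of the vertex operators in the second sum of `ℏ F_μ`. -/
def lowerCoeff' (μ m : ℕ) (σ : Bool) : ℂ :=
  if σ = true then -1 else (if m = μ + 1 then 0 else 1)

theorem vertex_mul_bracket (A B C D E : Exponent) (c : ℂ) :
    vertex A * vertex B * (c • vertex C - vertex D) * vertex E =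
      c • vertex (B + (A + C + E)) - vertex (B + (A + D + E)) := by
  simp only [mul_sub, sub_mul, mul_smul_comm, smul_mul_assoc, vertex_mul_vertex,
    add_comm A B, add_assoc]

theorem currentF_eq_sum (μ : ℕ) (u : ℂ) :
    currentF N k ℏ μ u =
      ∑ p ∈ Finset.Icc 1 μ ×ˢ Finset.univ,
        AddMonoidAlgebra.single (rootMinus ℏ μ (-(k - N) / 4) u + lowerTerm N ℏ μ p.2 p.1 u)
          (1 / ℏ * lowerCoeff μ p.1 p.2)
      + ∑ p ∈ Finset.Icc (μ + 1) N ×ˢ Finset.univ,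
        AddMonoidAlgebra.single
          (rootPlus ℏ μ (-(3 * k + N) / 4) u + lowerTerm' N k ℏ μ p.2 p.1 u)
          (1 / ℏ * lowerCoeff' μ p.1 p.2) := by
  rw [currentF, Finset.sum_product, Finset.sum_product, smul_sub, Finset.smul_sum, Finset.smul_sum,
    sub_eq_add_neg, ← Finset.sum_neg_distrib]
  congr 1 <;> refine Finset.sum_congr rfl fun m _ => ?_
  · rw [← rootMinus]
    change _ • (_ * (_ • vertex (lowerHead ℏ μ u false m) - vertex (lowerHead ℏ μ u true m))
      * _ * _) = _
    rw [mul_assoc (_ * _), vertex_mul_vertex (∑ n ∈ _, _), vertex_mul_bracket]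
    simp only [Fintype.sum_bool, ← smul_vertex, lowerTerm, lowerCoeff, if_true, reduceCtorEq,
      if_false, ← add_assoc]
    by_cases h : m = μ
    · subst h
      -- As `b_{μ,μ} = c_{μ,μ} = 0`, both bracket terms are the identity; their weights `2` and `-1`
      -- merge into one coefficient, put on the label `false`.
      simp only [lowerHead_self, if_true]
      module
    · simp only [h, if_false]
      module
  · rw [← rootPlus]
    change -(_ • (_ * (_ • vertex (lowerHead' k ℏ μ u true m) - vertex (lowerHead' k ℏ μ u false m))
      * _)) = _
    rw [vertex_mul_bracket]
    simp only [Fintype.sum_bool, ← smul_vertex, lowerTerm', lowerCoeff', if_true, reduceCtorEq,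
      if_false]
    by_cases h : m = μ + 1
    · subst h
      simp only [lowerHead'_self, if_true]
      module
    · simp only [h, if_false]
      module

theorem isField_lowerTerm (hℏ : ℏ ≠ 0) (μ : ℕ) (σ : Bool) (m : ℕ) :
    IsField (lowerTerm N ℏ μ σ m) := by
  refine IsField.add (IsField.add (IsField.add ((isField_bc hℏ _ _).sh ℏ _) ?_)
    (IsField.sum _ fun _ => ((isField_bMinus _ _).sh ℏ _).sub ((isField_bMinus _ _).sh ℏ _)))
    (IsField.sum _ fun _ => ((isField_bMinus _ _).sh ℏ _).sub ((isField_bMinus _ _).sh ℏ _))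
  cases σ
  · exact ((isField_bMinus _ _).sh ℏ _).neg.sub ((isField_bc hℏ _ _).sh ℏ _)
  · exact ((isField_bPlus _ _).sh ℏ _).neg.sub ((isField_bc hℏ _ _).sh ℏ _)

theorem isField_lowerTerm' (hℏ : ℏ ≠ 0) (μ : ℕ) (σ : Bool) (m : ℕ) :
    IsField (lowerTerm' N k ℏ μ σ m) := by
  refine IsField.add (IsField.add ((isField_bc hℏ _ _).sh ℏ _) ?_)
    (IsField.sum _ fun _ => ((isField_bPlus _ _).sh ℏ _).sub ((isField_bPlus _ _).sh ℏ _))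
  cases σ
  · exact ((isField_bMinus _ _).sh ℏ _).sub ((isField_bc hℏ _ _).sh ℏ _)
  · exact ((isField_bPlus _ _).sh ℏ _).sub ((isField_bc hℏ _ _).sh ℏ _)

theorem lowerTerm_lam (μ : ℕ) (σ : Bool) (m : ℕ) (u : ℂ) (i : ℕ) :
    lowerTerm N ℏ μ σ m u (.lam i) = 0 := by
  funext t
  cases σ <;> simp [lowerTerm, lowerHead, bc, bPlus, bMinus, bExp, cExp, Finset.sum_apply]

theorem lowerTerm'_lam (μ : ℕ) (σ : Bool) (m : ℕ) (u : ℂ) (i : ℕ) :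
    lowerTerm' N k ℏ μ σ m u (.lam i) = 0 := by
  funext t
  cases σ <;> simp [lowerTerm', lowerHead', bc, bPlus, bMinus, bExp, cExp, Finset.sum_apply]

/-! ### Contractions of the first sum of `F_μ` -/

/-- The difference of the two shifts in the contraction of a term of the first sum of `F_μ` with a
term of `S_ν`. -/
noncomputable def lowerShift (μ ν m m' : ℕ) (σ τ : Bool) : ℂ :=
  if m = ν ∧ m' = μ + 1 then (if τ = true then 0 else -1)
  else if m = ν ∧ m' = μ then
    (if σ = true then (if τ = true then 0 else 1) else (if τ = true then -1 else 0))
  else if m = ν + 1 ∧ m' = μ then (if σ = true then 0 else 1)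
  else 0

set_option maxHeartbeats 1000000 in
-- On the left the `b⁻` tails are pure creators, so only the head of the `F`-term contracts. For `m
-- = μ` both labels give the same exponent, which the formula for the shift describes only under the
-- label `false`; the other has coefficient zero and is excluded.
theorem hasSymbol_lower_screen (hℏ : ℏ ≠ 0) {μ ν m m' : ℕ} (σ τ : Bool) (hν : 1 ≤ ν)
    (hm : 1 ≤ m) (hmμ : m ≤ μ) (hm' : ν + 1 ≤ m') (hm'N : m' ≤ N) (hμN : μ < N)
    (hσ : ¬(σ = true ∧ m = μ)) :
    HasSymbol N k ℏ (lowerTerm N ℏ μ σ m) (screenTerm N ℏ ν τ m') ((N - μ + ν) / 2)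
      ((N - μ + ν) / 2 + lowerShift μ ν m m' σ τ) := by
  intro u v t ht
  have h : contractionIntegrand N k ℏ (lowerTerm N ℏ μ σ m u) (screenTerm N ℏ ν τ m' v) t =
      contractionIntegrand N k ℏ (bc ℏ m (μ + 1) (sh ℏ u (m / 2))) (screenTerm N ℏ ν τ m' v) t
      + (if σ = true then
          -contractionIntegrand N k ℏ (bPlus ℏ m μ (sh ℏ u (m / 2))) (screenTerm N ℏ ν τ m' v) t
          - contractionIntegrand N k ℏ (bc ℏ m μ (sh ℏ u ((m + 1) / 2)))
              (screenTerm N ℏ ν τ m' v) t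
        else -contractionIntegrand N k ℏ (bc ℏ m μ (sh ℏ u ((m - 1) / 2)))
              (screenTerm N ℏ ν τ m' v) t) := by
    cases σ <;> simp [lowerTerm, lowerHead, contractionIntegrand_sub_left,
      contractionIntegrand_add_left, contractionIntegrand_sum_left,
      contractionIntegrand_neg_left, contractionIntegrand_bMinus_left ht]
  rw [h]
  clear h
  simp only [contractionIntegrand_bPlus_screenTerm hℏ ht _ _ _ hν,
    contractionIntegrand_bc_screenTerm hℏ ht _ _ _ hν, lowerShift]
  rcases trichotomy_succ m ν with h1 | h1 | h1 | h1
  · simp (disch := omega) only [if_neg]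
    simp
  all_goals
    rcases trichotomy_succ m' μ with h3 | h3 | h3 | h3
    all_goals
      rcases trichotomy_succ μ ν with h2 | h2 | h2 | h2 <;> try (exfalso; omega)
    all_goals
      try subst h1
      try subst h3
      try subst h2
      try simp (disch := omega) only [if_pos, if_neg]
      cases σ <;> cases τ <;>
        simp (disch := omega) only [if_pos, if_neg, reduceCtorEq, true_and, or_true, and_true,
        and_false, or_false, if_true, if_false, ite_self, crossElem, diagElem, Nat.cast_add,
        Nat.cast_one]
      all_goals first | (exfalso; simp at hσ; done) | (try ring_nf)

set_option maxHeartbeats 1000000 in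
-- In this order the tails and the λ-sector take part: the λ-contraction, centred at `-N/2`,
-- combines with the row and column factors so that only the negated shifts of the other order
-- survive.
theorem contractionIntegrand_current_lower (hℏ : ℏ ≠ 0) (hk : (k + N).re ≠ 0) {t : ℝ} (ht : 0 < t)
    {μ ν m m' : ℕ} (σ τ : Bool) (hν : 1 ≤ ν) (hνN : ν < N) (hm : 1 ≤ m) (hmμ : m ≤ μ)
    (hm' : ν + 1 ≤ m') (hm'N : m' ≤ N) (hμN : μ < N) (hσ : ¬(σ = true ∧ m = μ)) (u v : ℂ) :
    contractionIntegrand N k ℏ (currentTerm N k ℏ ν τ m' v)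
      (rootMinus ℏ μ (-(k - N) / 4) u + lowerTerm N ℏ μ σ m u) t =
      elem ℏ (v - u) t (-((N - μ + ν) / 2))
        - elem ℏ (v - u) t (-((N - μ + ν) / 2 + lowerShift μ ν m m' σ τ)) := by
  have hμ : 1 ≤ μ := hm.trans hmμ
  rw [currentTerm, contractionIntegrand_sectors (ratioExp_eq_zero _ _ _)
    (rootMinus_eq_zero _ _ _) (screenTerm_lam _ _ _ _) (lowerTerm_lam _ _ _ _),
    contractionIntegrand_ratio_rootMinus hk hℏ ht hμ hμN hν hνN,
    contractionIntegrand_screenTerm_left ht]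
  have hR : ∀ A : Exponent, contractionIntegrand N k ℏ A (lowerHead ℏ μ u σ m) t =
      if σ = true then
        -contractionIntegrand N k ℏ A (bPlus ℏ m μ (sh ℏ u (m / 2))) t
        - contractionIntegrand N k ℏ A (bc ℏ m μ (sh ℏ u ((m + 1) / 2))) t
      else -contractionIntegrand N k ℏ A (bMinus ℏ m μ (sh ℏ u (m / 2))) t
        - contractionIntegrand N k ℏ A (bc ℏ m μ (sh ℏ u ((m - 1) / 2))) t := by
    intro A
    cases σ <;> simp [lowerHead, contractionIntegrand_sub_right, contractionIntegrand_neg_right]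
  simp only [lowerTerm, hR, contractionIntegrand_add_right, contractionIntegrand_sum_right,
    contractionIntegrand_sub_right, Finset.sum_sub_distrib]
  simp only [sum_bPlus_bMinus_col _ _ _ _ _ _ _ _ hℏ ht,
    sum_bPlus_bMinus_row _ _ _ _ _ _ _ _ hℏ ht, sum_bc_bMinus_col _ _ _ _ _ _ _ _ hℏ ht,
    sum_bc_bMinus_row _ _ _ _ _ _ _ _ hℏ ht, Finset.mem_Icc]
  simp only [rootPair, contractionIntegrand_bc_bc, contractionIntegrand_bPlus_bc hℏ ht,
    contractionIntegrand_bPlus_bPlus ht, contractionIntegrand_bc_bPlus ht,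
    contractionIntegrand_bPlus_bMinus hℏ ht, contractionIntegrand_bc_bMinus hℏ ht, lowerShift]
  clear hR
  rcases adjacency μ ν with h2 | h2 | h2 | h2 | h2
  all_goals
    simp (disch := omega) only [if_pos, if_neg]
    rcases trichotomy_succ m' μ with h3 | h3 | h3 | h3
    all_goals first
      | (exfalso; omega)
      | (try simp (disch := omega) only [if_pos, if_neg]
         rcases trichotomy_succ m ν with h1 | h1 | h1 | h1
         all_goals first
          | (exfalso; omega)
          | (try simp (disch := omega) only [if_pos, if_neg]
             try subst h2
             try subst h3
             try subst h1
             cases σ <;> cases τ <;> simp (disch := omega) only [if_pos, if_neg, if_true, if_false,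
              reduceCtorEq, ite_self, crossElem, diagElem, Nat.cast_add,
              Nat.cast_one]
             all_goals first | (exfalso; simp at hσ; done) | (try ring_nf)))

theorem isLocal_lower_current (hℏ : ℏ ≠ 0) (hk : (k + N).re ≠ 0) {μ ν m m' : ℕ} (σ τ : Bool)
    (hν : 1 ≤ ν) (hνN : ν < N) (hm : 1 ≤ m) (hmμ : m ≤ μ) (hm' : ν + 1 ≤ m') (hm'N : m' ≤ N)
    (hμN : μ < N) (hσ : ¬(σ = true ∧ m = μ)) :
    IsLocal N k ℏ (fun u => rootMinus ℏ μ (-(k - N) / 4) u + lowerTerm N ℏ μ σ m u)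
      (currentTerm N k ℏ ν τ m') ((N - μ + ν) / 2)
      ((N - μ + ν) / 2 + lowerShift μ ν m m' σ τ) := by
  refine ⟨fun u v t ht => ?_, fun v u t ht =>
    contractionIntegrand_current_lower hℏ hk ht σ τ hν hνN hm hmμ hm' hm'N hμN hσ u v⟩
  rw [currentTerm, contractionIntegrand_sectors (rootMinus_eq_zero _ _ _)
    (ratioExp_eq_zero _ _ _) (lowerTerm_lam _ _ _ _) (screenTerm_lam _ _ _ _),
    hasSymbol_lower_screen hℏ σ τ hν hm hmμ hm' hm'N hμN hσ u v t ht, rootMinus,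
    contractionIntegrand_sub_left, contractionIntegrand_lamMinus_left ht,
    contractionIntegrand_lamMinus_left ht]
  ring

end YangianFreeField

namespace YangianFreeField

variable {N : ℕ} {k : ℂ} {ℏ : ℝ}

/-! ### Contractions of the second sum of `F_μ` -/

/-- The first shift in the contraction of a term of the second sum of `F_μ` with a term of `S_ν`. -/
noncomputable def lowerBase' (N : ℕ) (k : ℂ) (μ ν m : ℕ) (σ : Bool) : ℂ :=
  if ν = μ + 1 then -(k + m - (N + 1) / 2)
  else if σ = true then -(k + m - N / 2) else -(k + m - 1 - N / 2)

/-- The difference of the two shifts in the contraction of a term of the second sum of `F_μ` with a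
term of `S_ν`. -/
noncomputable def lowerShift' (μ ν m m' : ℕ) (σ τ : Bool) : ℂ :=
  if m = m' ∧ σ = τ then
    (if μ = ν then (if σ = true then 1 else -1)
      else if ν = μ + 1 then (if σ = true then -1 else 1) else 0)
  else 0

set_option maxHeartbeats 1000000 in
-- Unlike in the first sum, the pole moves with `m`, and only pairs with the same position and label
-- have one. For `μ = ν` the terms `(m, true)` and `(m + 1, false)` share a pole; for `ν = μ + 1`
-- the two labels of one `m` do.
theorem contractionIntegrand_lower'_current (hℏ : ℏ ≠ 0) (hk : (k + N).re ≠ 0) {t : ℝ} (ht : 0 < t)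
    {μ ν m m' : ℕ} (σ τ : Bool) (hν : 1 ≤ ν) (hνN : ν < N) (hμ : 1 ≤ μ) (hm : μ + 1 ≤ m)
    (hmN : m ≤ N) (hm' : ν + 1 ≤ m') (hm'N : m' ≤ N) (hσ : ¬(σ = false ∧ m = μ + 1)) (u v : ℂ) :
    contractionIntegrand N k ℏ (rootPlus ℏ μ (-(3 * k + N) / 4) u + lowerTerm' N k ℏ μ σ m u)
      (currentTerm N k ℏ ν τ m' v) t =
      elem ℏ (u - v) t (lowerBase' N k μ ν m σ)
        - elem ℏ (u - v) t (lowerBase' N k μ ν m σ + lowerShift' μ ν m m' σ τ) := by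
  rw [currentTerm, contractionIntegrand_sectors (rootPlus_eq_zero _ _ _)
    (ratioExp_eq_zero _ _ _) (lowerTerm'_lam _ _ _ _) (screenTerm_lam _ _ _ _),
    contractionIntegrand_rootPlus_ratio hk hℏ ht hμ (by omega) hν hνN]
  have h1 : ∀ n : ℕ, -(2 * k + n) / 2 = -k - n / 2 := fun n => by ring
  have h2 : ∀ n : ℕ, -(2 * k + n - 1) / 2 = (1 / 2 - k) - n / 2 := fun n => by ring
  have hL : ∀ B : Exponent, contractionIntegrand N k ℏ (lowerHead' k ℏ μ u σ m) B t =
      if σ = true then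
        contractionIntegrand N k ℏ (bPlus ℏ (μ + 1) m (sh ℏ u (1 / 2 - k - m / 2))) B t
        - contractionIntegrand N k ℏ (bc ℏ (μ + 1) m (sh ℏ u (-k - m / 2))) B t
      else -contractionIntegrand N k ℏ (bc ℏ (μ + 1) m (sh ℏ u (-(2 * k + m - 2) / 2))) B t := by
    intro B
    cases σ
    · simp [lowerHead', contractionIntegrand_sub_left, contractionIntegrand_bMinus_left ht]
    · simp only [lowerHead', contractionIntegrand_sub_left, h1, h2, if_true]
  simp only [lowerTerm', contractionIntegrand_add_left, contractionIntegrand_sum_left,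
    contractionIntegrand_sub_left, hL, h1, h2, Finset.sum_sub_distrib]
  -- The entry `n = m` of row `μ + 1` may be the diagonal one, which the telescoped row sum does not
  -- cover.
  rw [sum_Icc_succ_bot hmN fun n : ℕ =>
      contractionIntegrand N k ℏ (bPlus ℏ (μ + 1) n (sh ℏ u (1 / 2 - k - n / 2)))
        (screenTerm N ℏ ν τ m' v) t,
    sum_bPlus_screenTerm_row hℏ ht _ _ τ hν (by omega) (by omega) hm'N,
    sum_bPlus_screenTerm_row hℏ ht _ _ τ hν (by omega) (by omega) hm'N]
  simp only [rootPair, contractionIntegrand_bPlus_screenTerm hℏ ht _ _ _ hν,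
    contractionIntegrand_bc_screenTerm hℏ ht _ _ _ hν, lowerShift', lowerBase']
  clear hL h1 h2
  rcases adjacency μ ν with h2 | h2 | h2 | h2 | h2
  all_goals
    simp (disch := omega) only [if_pos, if_neg]
    rcases lt_trichotomy m m' with h3 | h3 | h3
    all_goals
      try simp (disch := omega) only [if_pos, if_neg]
      rcases (show m = μ + 1 ∨ μ + 1 < m by omega) with h1 | h1
      all_goals first
        | (exfalso; omega)
        | (try subst h2
           try subst h3
           try subst h1
           cases σ <;> cases τ <;> simp (disch := omega) only [if_pos, if_neg, if_true, if_false,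
              reduceCtorEq, ite_self, true_and, and_true, and_false, or_true, or_false, crossElem, diagElem,
              Nat.cast_add, Nat.cast_one]
           all_goals first | (exfalso; simp at hσ; done) | (try ring_nf))

set_option maxHeartbeats 1000000 in
theorem contractionIntegrand_current_lower' (hℏ : ℏ ≠ 0) {t : ℝ} (ht : 0 < t)
    {μ ν m m' : ℕ} (σ τ : Bool) (hν : 1 ≤ ν) (hμ : 1 ≤ μ) (hm : μ + 1 ≤ m)
    (hmN : m ≤ N) (hm' : ν + 1 ≤ m') (hm'N : m' ≤ N) (hσ : ¬(σ = false ∧ m = μ + 1)) (u v : ℂ) :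
    contractionIntegrand N k ℏ (currentTerm N k ℏ ν τ m' v)
      (rootPlus ℏ μ (-(3 * k + N) / 4) u + lowerTerm' N k ℏ μ σ m u) t =
      elem ℏ (v - u) t (-lowerBase' N k μ ν m σ)
        - elem ℏ (v - u) t (-(lowerBase' N k μ ν m σ + lowerShift' μ ν m m' σ τ)) := by
  rw [currentTerm, contractionIntegrand_sectors (ratioExp_eq_zero _ _ _)
    (rootPlus_eq_zero _ _ _) (screenTerm_lam _ _ _ _) (lowerTerm'_lam _ _ _ _),
    rootPlus, contractionIntegrand_sub_right, contractionIntegrand_lamPlus_right ht,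
    contractionIntegrand_lamPlus_right ht, contractionIntegrand_screenTerm_left ht]
  have hR : ∀ A : Exponent, contractionIntegrand N k ℏ A (lowerHead' k ℏ μ u σ m) t =
      if σ = true then
        contractionIntegrand N k ℏ A (bPlus ℏ (μ + 1) m (sh ℏ u (-(2 * k + m - 1) / 2))) t
        - contractionIntegrand N k ℏ A (bc ℏ (μ + 1) m (sh ℏ u (-(2 * k + m) / 2))) t
      else contractionIntegrand N k ℏ A (bMinus ℏ (μ + 1) m (sh ℏ u (-(2 * k + m - 1) / 2))) t
        - contractionIntegrand N k ℏ A (bc ℏ (μ + 1) m (sh ℏ u (-(2 * k + m - 2) / 2))) t := by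
    intro A
    cases σ <;> simp [lowerHead', contractionIntegrand_sub_right]
  simp only [lowerTerm', hR, contractionIntegrand_add_right, contractionIntegrand_sum_right,
    contractionIntegrand_sub_right, contractionIntegrand_bc_bc,
    contractionIntegrand_bPlus_bc hℏ ht, contractionIntegrand_bPlus_bPlus ht,
    contractionIntegrand_bc_bPlus ht, contractionIntegrand_bPlus_bMinus hℏ ht,
    contractionIntegrand_bc_bMinus hℏ ht, lowerShift', lowerBase', sub_self,
    Finset.sum_const_zero, zero_add, add_zero, sub_zero]
  clear hR
  rcases adjacency μ ν with h2 | h2 | h2 | h2 | h2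
  all_goals
    rcases lt_trichotomy m m' with h3 | h3 | h3
    all_goals
      rcases (show m = μ + 1 ∨ μ + 1 < m by omega) with h1 | h1
      all_goals first
        | (exfalso; omega)
        | (try subst h2
           try subst h3
           try subst h1
           cases σ <;> cases τ <;> simp (disch := omega) only [if_pos, if_neg, if_true, if_false,
            reduceCtorEq, ite_self, true_and, and_true, and_false, crossElem, diagElem,
            Nat.cast_add, Nat.cast_one]
           all_goals first | (exfalso; simp at hσ; done) | (try ring_nf))

theorem isLocal_lower'_current (hℏ : ℏ ≠ 0) (hk : (k + N).re ≠ 0) {μ ν m m' : ℕ} (σ τ : Bool)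
    (hν : 1 ≤ ν) (hνN : ν < N) (hμ : 1 ≤ μ) (hm : μ + 1 ≤ m) (hmN : m ≤ N) (hm' : ν + 1 ≤ m')
    (hm'N : m' ≤ N) (hσ : ¬(σ = false ∧ m = μ + 1)) :
    IsLocal N k ℏ (fun u => rootPlus ℏ μ (-(3 * k + N) / 4) u + lowerTerm' N k ℏ μ σ m u)
      (currentTerm N k ℏ ν τ m') (lowerBase' N k μ ν m σ)
      (lowerBase' N k μ ν m σ + lowerShift' μ ν m m' σ τ) :=
  ⟨fun u v _ ht =>
    contractionIntegrand_lower'_current hℏ hk ht σ τ hν hνN hμ hm hmN hm' hm'N hσ u v,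
  fun v u _ ht => contractionIntegrand_current_lower' hℏ ht σ τ hν hμ hm hmN hm' hm'N hσ u v⟩

end YangianFreeField

namespace YangianFreeField

variable {N : ℕ} {k : ℂ} {ℏ : ℝ}

/-! ### Relations between the exponents in `F_μ(u) S_ν(v)` -/

/-- Both heads are made of the same boson pair `(ν, μ)`; at the common pole, switching both labels
exchanges their contributions. -/
theorem lower_screen_add_eq₁ (hℏ : ℏ ≠ 0) {μ ν : ℕ} (v : ℂ) :
    lowerTerm N ℏ μ false ν (sh ℏ v (-((N - μ + ν) / 2))) + screenTerm N ℏ ν true μ v =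
    lowerTerm N ℏ μ true ν (sh ℏ v (-((N - μ + ν) / 2))) + screenTerm N ℏ ν false μ v := by
  simp only [lowerTerm, lowerHead, screenTerm, screenHead, sh_sh, bMinus_sh hℏ, bc]
  ring_nf

theorem lower_screen_add_eq₂ (hℏ : ℏ ≠ 0) {μ ν : ℕ} (hμN : μ < N) (hν : ν < μ) (v : ℂ) :
    lowerTerm N ℏ μ false ν (sh ℏ v (-((N - μ + ν) / 2))) + screenTerm N ℏ ν false (μ + 1) v =
    lowerTerm N ℏ μ false (ν + 1) (sh ℏ v (-((N - μ + ν) / 2))) + screenTerm N ℏ ν false μ v := by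
  simp only [lowerTerm, lowerHead, screenTerm, screenHead,
    sum_Icc_succ_bot (show ν + 1 ≤ μ from hν),
    sum_Icc_succ_bot (show μ + 1 ≤ N from hμN), sh_sh, bMinus_sh hℏ, bc]
  push_cast
  ring_nf

theorem lower_screen_add_eq₃ (hℏ : ℏ ≠ 0) {μ ν : ℕ} (hμN : μ < N) (hν : ν < μ) (v : ℂ) :
    lowerTerm N ℏ μ true ν (sh ℏ v (-((N - μ + ν) / 2))) + screenTerm N ℏ ν false (μ + 1) v =
    lowerTerm N ℏ μ false (ν + 1) (sh ℏ v (-((N - μ + ν) / 2))) + screenTerm N ℏ ν true μ v := by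
  simp only [lowerTerm, lowerHead, screenTerm, screenHead,
    sum_Icc_succ_bot (show ν + 1 ≤ μ from hν),
    sum_Icc_succ_bot (show μ + 1 ≤ N from hμN), sh_sh, bMinus_sh hℏ, bc]
  push_cast
  ring_nf

/-- At `m = μ`, `m' = μ + 1` and this pole the tail of `F_μ` is inverse to the head and tail of
`S̃_μ` together, so only the λ-sector survives in the residue. -/
theorem lower_screen_add_eq_zero (hℏ : ℏ ≠ 0) {μ : ℕ} (hμN : μ < N) (v : ℂ) :
    lowerTerm N ℏ μ false μ (sh ℏ v (-((N - μ + μ) / 2))) + screenTerm N ℏ μ false (μ + 1) v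
      = 0 := by
  rw [lowerTerm, lowerHead_self]
  simp only [screenTerm, screenHead, Finset.Icc_eq_empty (show ¬μ + 1 ≤ μ by omega),
    Finset.sum_empty, sum_Icc_succ_bot (show μ + 1 ≤ N from hμN), sh_sh, bMinus_sh hℏ, bc]
  simp only [bPlus, bExp_self, cExp_self, Finset.sum_sub_distrib, Finset.sum_add_distrib]
  push_cast
  ring_nf

/-- Neighbouring summands of the second sum have equal residues at their shared pole; this drives
the telescoping for `μ = ν`. -/
theorem lower'_screen_add_eq₁ (hℏ : ℏ ≠ 0) {μ m : ℕ} (hm : m < N) (v : ℂ) :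
    lowerTerm' N k ℏ μ true m (sh ℏ v (k + m - N / 2)) + screenTerm N ℏ μ true m v =
    lowerTerm' N k ℏ μ false (m + 1) (sh ℏ v (k + m - N / 2)) + screenTerm N ℏ μ false (m + 1) v := by
  simp only [lowerTerm', lowerHead', screenTerm, screenHead, sum_Icc_succ_bot hm.le,
    sum_Icc_succ_bot (show m + 1 ≤ N from hm), sh_sh, bMinus_sh hℏ, bc]
  push_cast
  ring_nf

theorem lower'_screen_add_eq₂ (hℏ : ℏ ≠ 0) {μ m : ℕ} (v : ℂ) :
    lowerTerm' N k ℏ μ true m (sh ℏ v (k + m - (N + 1) / 2)) + screenTerm N ℏ (μ + 1) true m v =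
    lowerTerm' N k ℏ μ false m (sh ℏ v (k + m - (N + 1) / 2))
      + screenTerm N ℏ (μ + 1) false m v := by
  simp only [lowerTerm', lowerHead', screenTerm, screenHead, sh_sh, bMinus_sh hℏ, bc]
  ring_nf

theorem lower'_screen_add_eq_zero {μ : ℕ} (v : ℂ) :
    lowerTerm' N k ℏ μ true N (sh ℏ v (k + N - N / 2)) + screenTerm N ℏ μ true N v = 0 := by
  simp only [lowerTerm', lowerHead', screenTerm, screenHead, Finset.Icc_self, Finset.sum_singleton,
    Finset.Icc_eq_empty (show ¬N + 1 ≤ N by omega), Finset.sum_empty, sh_sh, bc]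
  ring_nf

/-! ### The λ-sector of the surviving residues -/

theorem exp_sh (v s : ℂ) (t : ℝ) : Complex.exp (-(Complex.I * sh ℏ v s * t)) =
    Complex.exp (-(Complex.I * v * t)) * Complex.exp (s * ℏ * t) := by
  rw [← Complex.exp_add]
  congr 1
  simp only [sh]
  linear_combination (-s * ℏ * t : ℂ) * Complex.I_sq

theorem exp_half (β : ℂ) (t : ℝ) : Complex.exp (β / 2 * ℏ * t) =
    Complex.exp (β / 4 * ℏ * t) * Complex.exp (β / 4 * ℏ * t) := by
  rw [← Complex.exp_add]; ring_nf

theorem exp_neg_half (β : ℂ) (t : ℝ) : Complex.exp (-β / 2 * ℏ * t) =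
    Complex.exp (-(β / 4 * ℏ * t)) * Complex.exp (-(β / 4 * ℏ * t)) := by
  rw [← Complex.exp_add]; ring_nf

theorem exp_neg_quarter (β : ℂ) (t : ℝ) :
    Complex.exp (-β / 4 * ℏ * t) = Complex.exp (-(β / 4 * ℏ * t)) := by ring_nf

theorem exp_neg_neg_quarter (β : ℂ) (t : ℝ) :
    Complex.exp (-(-β / 4 * ℏ * t)) = Complex.exp (β / 4 * ℏ * t) := by ring_nf

theorem exp_quarter_mul (β : ℂ) (t : ℝ) :
    Complex.exp (β / 4 * ℏ * t) * Complex.exp (-(β / 4 * ℏ * t)) = 1 := by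
  rw [← Complex.exp_add, add_neg_cancel, Complex.exp_zero]

theorem two_mul_sinh_half (β : ℂ) (t : ℝ) : 2 * Complex.sinh (β / 2 * ℏ * t) =
    Complex.exp (β / 4 * ℏ * t) * Complex.exp (β / 4 * ℏ * t)
      - Complex.exp (-(β / 4 * ℏ * t)) * Complex.exp (-(β / 4 * ℏ * t)) := by
  rw [Complex.two_sinh, exp_half, ← exp_neg_half]; ring_nf

/-- For `t > 0` the shift by `-β/2` turns the weight `e^{βℏt/4}` of the new parameter into the old
`e^{-βℏt/4}`. For `t < 0` the two sides differ by `e^{βℏt/4} - e^{-3βℏt/4} = 2 e^{-βℏt/4} sinh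
(βℏt/2)`, whose `sinh` cancels the denominator and leaves `χ⁻`. -/
theorem fieldCoeff_sub_minusCoeff (hℏ : ℏ ≠ 0) {β : ℂ} (hβ : β.re ≠ 0) (v : ℂ) :
    fieldCoeff ℏ β v (β / 4) - minusCoeff ℏ (sh ℏ v (-β / 4)) =
      fieldCoeff ℏ β (sh ℏ v (-β / 2)) (-β / 4) := by
  funext t
  rcases eq_or_ne t 0 with rfl | ht
  · simp [minusCoeff, fieldCoeff]
  have hs : Complex.sinh (β / 2 * ℏ * t) ≠ 0 := sinh_ofReal_mul_ne_zero hβ hℏ ht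
  have h1 := two_mul_sinh_half (ℏ := ℏ) β t
  have h2 := exp_quarter_mul (ℏ := ℏ) β t
  simp only [Pi.sub_apply, fieldCoeff, minusCoeff, exp_sh, exp_neg_half, exp_neg_quarter,
    exp_neg_neg_quarter]
  generalize Complex.sinh (β / 2 * ℏ * t) = S at *
  generalize Complex.exp (β / 4 * ℏ * t) = p at *
  generalize Complex.exp (-(β / 4 * ℏ * t)) = q at *
  generalize Complex.exp (-(Complex.I * v * t)) = X
  rcases ht.lt_or_gt with h | h
  · simp only [h, if_true]
    field_simp
    linear_combination ℏ * q * X * h1 + ℏ * X * p * h2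
  · simp only [h.not_gt, if_false]
    field_simp
    linear_combination ℏ * X * q * h2

theorem fieldCoeff_sub_plusCoeff (hℏ : ℏ ≠ 0) {β : ℂ} (hβ : β.re ≠ 0) (v : ℂ) :
    fieldCoeff ℏ β v (β / 4) - plusCoeff ℏ (sh ℏ v (β / 4)) =
      fieldCoeff ℏ β (sh ℏ v (β / 2)) (-β / 4) := by
  funext t
  rcases eq_or_ne t 0 with rfl | ht
  · simp [plusCoeff, fieldCoeff]
  have hs : Complex.sinh (β / 2 * ℏ * t) ≠ 0 := sinh_ofReal_mul_ne_zero hβ hℏ ht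
  have h1 := two_mul_sinh_half (ℏ := ℏ) β t
  have h2 := exp_quarter_mul (ℏ := ℏ) β t
  simp only [Pi.sub_apply, fieldCoeff, plusCoeff, exp_sh, exp_half, exp_neg_quarter,
    exp_neg_neg_quarter]
  generalize Complex.sinh (β / 2 * ℏ * t) = S at *
  generalize Complex.exp (β / 4 * ℏ * t) = p at *
  generalize Complex.exp (-(β / 4 * ℏ * t)) = q at *
  generalize Complex.exp (-(Complex.I * v * t)) = X
  rcases ht.lt_or_gt with h | h
  · simp only [h, h.not_gt, if_true, if_false]
    field_simp
    linear_combination ℏ * X * p * h2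
  · simp only [h.not_gt, h, if_true, if_false]
    field_simp
    linear_combination -ℏ * p * X * h1 + ℏ * X * q * h2

theorem lamExp_sub (i : ℕ) (f g : ℝ → ℂ) : lamExp i (f - g) = lamExp i f - lamExp i g := by
  funext m t
  rcases m with a | _ | _
  · by_cases h : a = i <;> simp [lamExp, h]
  · simp [lamExp]
  · simp [lamExp]

/-- With `β = k + N`, the shift `-β/2` splits into the position `-N/2` of the pole and the shift
`-k/2` inside the residue. Its counterpart for `λ⁺` uses `β/2 = (k + N/2) - k/2`. -/
theorem rootMinus_add_ratioExp (hℏ : ℏ ≠ 0) (hk : (k + N).re ≠ 0) (μ : ℕ) (v : ℂ) :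
    rootMinus ℏ μ (-(k - N) / 4) (sh ℏ v (-N / 2)) + ratioExp N k ℏ μ ((k + N) / 4) v =
      ratioExp N k ℏ μ (-(k + N) / 4) (sh ℏ (sh ℏ v (-N / 2)) (-k / 2)) := by
  have h := fieldCoeff_sub_minusCoeff hℏ hk (sh ℏ v (-μ / 2))
  simp only [rootMinus, ratioExp, lamMinus, lamField, sh_sh] at h ⊢
  have e1 : (-N / 2 + (-(k - N) / 4 - μ / 2) : ℂ) = -μ / 2 + -(k + N) / 4 := by ring
  have e2 : (-N / 2 + -k / 2 + -μ / 2 : ℂ) = -μ / 2 + -(k + N) / 2 := by ring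
  rw [e1, e2, ← h, lamExp_sub, lamExp_sub]
  abel

theorem rootPlus_add_ratioExp (hℏ : ℏ ≠ 0) (hk : (k + N).re ≠ 0) (μ : ℕ) (v : ℂ) :
    rootPlus ℏ μ (-(3 * k + N) / 4) (sh ℏ v (k + N / 2)) + ratioExp N k ℏ μ ((k + N) / 4) v =
      ratioExp N k ℏ μ (-(k + N) / 4) (sh ℏ (sh ℏ v (k + N / 2)) (-k / 2)) := by
  have h := fieldCoeff_sub_plusCoeff hℏ hk (sh ℏ v (-μ / 2))
  simp only [rootPlus, ratioExp, lamPlus, lamField, sh_sh] at h ⊢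
  have e1 : (k + N / 2 + (-(3 * k + N) / 4 - μ / 2) : ℂ) = -μ / 2 + (k + N) / 4 := by ring
  have e2 : (k + N / 2 + -k / 2 + -μ / 2 : ℂ) = -μ / 2 + (k + N) / 2 := by ring
  rw [e1, e2, ← h, lamExp_sub, lamExp_sub]
  abel

/-! ### Products with `F_μ` -/

/-- For `ν > μ` no pair has a pole and for `ν < μ` all residues cancel in twos. For `ν = μ` the
partners of `(μ, false; μ + 1, false)` have zero coefficient or lie outside the sums, so this one
residue remains. -/
theorem expansion_lower (hℏ : ℏ ≠ 0) (hk : (k + N).re ≠ 0) {μ ν : ℕ} (hμN : μ < N)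
    (hμ : 1 ≤ μ) (hν : 1 ≤ ν) (hνN : ν < N) :
    Expansion N k ℏ (fun _ _ => 1) (fun _ _ => 1)
      (fun u => ∑ p ∈ Finset.Icc 1 μ ×ˢ Finset.univ,
        AddMonoidAlgebra.single (rootMinus ℏ μ (-(k - N) / 4) u + lowerTerm N ℏ μ p.2 p.1 u)
          (1 / ℏ * lowerCoeff μ p.1 p.2))
      (screening N k ℏ ν)
      (fun u v z => if μ = ν then Complex.I / (ℏ * (u - v + N / 2 * Complex.I * ℏ)) *
        matrixElement z (lamRatio N k ℏ μ (sh ℏ (sh ℏ v (-N / 2)) (-k / 2)) (-(k + N) / 4))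
        else 0) := by
  rw [funext (screening_eq_sum ν)]
  convert Expansion.of_isLocal (S := Finset.Icc 1 μ) (T := Finset.Icc (ν + 1) N)
    (A := fun m σ u => rootMinus ℏ μ (-(k - N) / 4) u + lowerTerm N ℏ μ σ m u)
    (B := fun m τ => currentTerm N k ℏ ν τ m)
    (s := fun _ _ => (N - μ + ν) / 2) (D := lowerShift μ ν)
    (fun m σ => 1 / ℏ * lowerCoeff μ m σ) (fun _ σ => 1 / ℏ * bracketSign σ)
    (fun m hm m' hm' σ τ h0 => isLocal_lower_current hℏ hk σ τ hν hνN (Finset.mem_Icc.1 hm).1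
      (Finset.mem_Icc.1 hm).2 (Finset.mem_Icc.1 hm').1 (Finset.mem_Icc.1 hm').2 hμN
      (fun h => h0 (by simp [lowerCoeff, h])))
    (fun m σ => (isField_rootMinus μ _).add (isField_lowerTerm hℏ μ σ m))
    (fun m τ => isField_currentTerm hℏ hk ν τ m) using 4 with u v z
  set C : ℂ := Complex.I * ℏ / (u - v + (N - μ + ν) / 2 * Complex.I * ℏ) with hC
  set G : ℕ → Bool → ℕ → Bool → ℂ := fun m σ m' τ => C *
    matrixElement z (vertex (rootMinus ℏ μ (-(k - N) / 4) (sh ℏ v (-((N - μ + ν) / 2)))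
      + lowerTerm N ℏ μ σ m (sh ℏ v (-((N - μ + ν) / 2))) + currentTerm N k ℏ ν τ m' v)) with hG
  have e : ∀ m m', ∑ σ, ∑ τ, 1 / (ℏ : ℂ) * lowerCoeff μ m σ * (1 / ℏ * bracketSign τ)
        * lowerShift μ ν m m' σ τ * G m σ m' τ
      = (if m = ν ∧ m' = μ + 1 then
          1 / (ℏ : ℂ) ^ 2 * (G m false m' false - (if m = μ then 0 else G m true m' false)) else 0)
      + (if m = ν ∧ m' = μ then
          1 / (ℏ : ℂ) ^ 2 * ((if m = μ then 0 else G m true m' false) - G m false m' true) else 0)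
      + (if m = ν + 1 ∧ m' = μ then
          1 / (ℏ : ℂ) ^ 2 * (G m false m' true - G m false m' false) else 0) := by
    intro m m'
    simp only [Fintype.sum_bool, bracketSign, lowerShift, lowerCoeff, if_true, reduceCtorEq,
      if_false]
    by_cases h1 : m = ν ∧ m' = μ + 1
    · simp (disch := omega) only [if_pos, if_neg]; split_ifs <;> ring
    by_cases h2 : m = ν ∧ m' = μ
    · simp (disch := omega) only [if_pos, if_neg]; split_ifs <;> ring
    by_cases h3 : m = ν + 1 ∧ m' = μ
    · simp (disch := omega) only [if_pos, if_neg]; ring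
    · simp only [h1, h2, h3, if_false]; ring
  have hGeq : ∀ m σ m' τ m₁ σ₁ m₁' τ₁,
      lowerTerm N ℏ μ σ m (sh ℏ v (-((N - μ + ν) / 2))) + screenTerm N ℏ ν τ m' v =
      lowerTerm N ℏ μ σ₁ m₁ (sh ℏ v (-((N - μ + ν) / 2))) + screenTerm N ℏ ν τ₁ m₁' v →
      G m σ m' τ = G m₁ σ₁ m₁' τ₁ := by
    intro m σ m' τ m₁ σ₁ m₁' τ₁ h
    simp only [hG, currentTerm]
    rw [add_add_add_comm, h, add_add_add_comm]
  change _ = ∑ m ∈ _, ∑ m' ∈ _, ∑ σ, ∑ τ, _ * G m σ m' τ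
  simp only [e, Finset.sum_add_distrib, sum_sum_ite, Finset.mem_Icc]
  rcases lt_trichotomy ν μ with h | h | h
  · rw [hGeq _ _ _ _ _ _ _ _ (lower_screen_add_eq₁ hℏ v),
      hGeq _ _ _ _ _ _ _ _ (lower_screen_add_eq₂ hℏ hμN h v),
      hGeq _ _ _ _ _ _ _ _ (lower_screen_add_eq₃ hℏ hμN h v)]
    simp (disch := omega) only [if_pos, if_neg]
    ring
  · subst h
    simp (disch := omega) only [if_pos, if_neg, if_true]
    have hexp : G ν false (ν + 1) false = C * matrixElement z
        (lamRatio N k ℏ ν (sh ℏ (sh ℏ v (-N / 2)) (-k / 2)) (-(k + N) / 4)) := by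
      simp only [hG, currentTerm]
      rw [add_add_add_comm, lower_screen_add_eq_zero hℏ hμN, add_zero, lamRatio, ← ratioExp,
        ← rootMinus_add_ratioExp hℏ hk]
      congr 6
      ring
    rw [hexp, hC]
    have hℏ' : (ℏ : ℂ) ≠ 0 := by exact_mod_cast hℏ
    rw [sub_add_cancel, div_mul_eq_div_div,
      show Complex.I / (ℏ : ℂ) = 1 / ℏ ^ 2 * (Complex.I * ℏ) by field_simp]
    ring
  · simp (disch := omega) only [if_neg]
    ring

theorem sum_telescope {X Y : ℕ → ℂ} {a n : ℕ} (han : a ≤ n)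
    (h : ∀ m, a ≤ m → m < n → Y (m + 1) = X m) :
    ∑ m ∈ Finset.Icc a n, ((if m = a then 0 else Y m) - X m) = -X n := by
  induction n, han using Nat.le_induction with
  | base => simp
  | succ n han ih =>
    rw [Finset.sum_Icc_succ_top (by omega), ih fun m h1 h2 => h m h1 (by omega),
      if_neg (by omega), h n han (by omega)]
    ring

/-- For `μ = ν` the sum over `m` telescopes. It starts cleanly because the label `false` has
coefficient zero at `m = μ + 1`, and it ends with the residue of `(N, true)`, whose b-sector is
trivial. For `ν = μ + 1` each `m` cancels by itself, and otherwise there is no pole. -/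
theorem expansion_lower' (hℏ : ℏ ≠ 0) (hk : (k + N).re ≠ 0) {μ ν : ℕ} (hμN : μ < N)
    (hμ : 1 ≤ μ) (hν : 1 ≤ ν) (hνN : ν < N) :
    Expansion N k ℏ (fun _ _ => 1) (fun _ _ => 1)
      (fun u => ∑ p ∈ Finset.Icc (μ + 1) N ×ˢ Finset.univ,
        AddMonoidAlgebra.single
          (rootPlus ℏ μ (-(3 * k + N) / 4) u + lowerTerm' N k ℏ μ p.2 p.1 u)
          (1 / ℏ * lowerCoeff' μ p.1 p.2))
      (screening N k ℏ ν)
      (fun u v z => if μ = ν then -(Complex.I / (ℏ * (u - v - (k + N / 2) * Complex.I * ℏ)) *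
        matrixElement z (lamRatio N k ℏ μ (sh ℏ (sh ℏ v (k + N / 2)) (-k / 2)) (-(k + N) / 4)))
        else 0) := by
  rw [funext (screening_eq_sum ν)]
  convert Expansion.of_isLocal (S := Finset.Icc (μ + 1) N) (T := Finset.Icc (ν + 1) N)
    (A := fun m σ u => rootPlus ℏ μ (-(3 * k + N) / 4) u + lowerTerm' N k ℏ μ σ m u)
    (B := fun m τ => currentTerm N k ℏ ν τ m)
    (s := lowerBase' N k μ ν) (D := lowerShift' μ ν)
    (fun m σ => 1 / ℏ * lowerCoeff' μ m σ) (fun _ σ => 1 / ℏ * bracketSign σ)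
    (fun m hm m' hm' σ τ h0 => isLocal_lower'_current hℏ hk σ τ hν hνN hμ (Finset.mem_Icc.1 hm).1
      (Finset.mem_Icc.1 hm).2 (Finset.mem_Icc.1 hm').1 (Finset.mem_Icc.1 hm').2
      (fun h => h0 (by simp [lowerCoeff', h])))
    (fun m σ => (isField_rootPlus μ _).add (isField_lowerTerm' hℏ μ σ m))
    (fun m τ => isField_currentTerm hℏ hk ν τ m) using 4 with u v z
  set G : ℂ → ℕ → Bool → ℂ := fun s m σ => Complex.I * ℏ / (u - v + -s * Complex.I * ℏ) *
    matrixElement z (vertex (rootPlus ℏ μ (-(3 * k + N) / 4) (sh ℏ v s)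
      + lowerTerm' N k ℏ μ σ m (sh ℏ v s) + currentTerm N k ℏ ν σ m v)) with hG
  have hGeq : ∀ s m σ m₁ σ₁,
      lowerTerm' N k ℏ μ σ m (sh ℏ v s) + screenTerm N ℏ ν σ m v =
      lowerTerm' N k ℏ μ σ₁ m₁ (sh ℏ v s) + screenTerm N ℏ ν σ₁ m₁ v → G s m σ = G s m₁ σ₁ := by
    intro s m σ m₁ σ₁ h
    simp only [hG, currentTerm]
    rw [add_add_add_comm, h, add_add_add_comm]
  have e : ∀ m m', ∑ σ, ∑ τ, 1 / (ℏ : ℂ) * lowerCoeff' μ m σ * (1 / ℏ * bracketSign τ)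
        * lowerShift' μ ν m m' σ τ * (Complex.I * ℏ / (u - v + lowerBase' N k μ ν m σ * Complex.I * ℏ)
          * matrixElement z (vertex (rootPlus ℏ μ (-(3 * k + N) / 4)
            (sh ℏ v (-lowerBase' N k μ ν m σ)) + lowerTerm' N k ℏ μ σ m
            (sh ℏ v (-lowerBase' N k μ ν m σ)) + currentTerm N k ℏ ν τ m' v)))
      = if m = m' then 1 / (ℏ : ℂ) ^ 2 *
          (if μ = ν then (if m = μ + 1 then 0 else G (k + m - 1 - N / 2) m false)
              - G (k + m - N / 2) m true
            else if ν = μ + 1 then G (k + m - (N + 1) / 2) m true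
              - (if m = μ + 1 then 0 else G (k + m - (N + 1) / 2) m false) else 0) else 0 := by
    intro m m'
    by_cases h : m = m'
    · subst h
      simp only [Fintype.sum_bool, bracketSign, lowerShift', lowerCoeff', lowerBase', if_true,
        reduceCtorEq, if_false, mul_zero, zero_mul, add_zero, zero_add, true_and, hG]
      by_cases h1 : μ = ν
      · subst h1
        simp (disch := omega) only [if_pos, if_neg, neg_neg]
        split_ifs <;> ring
      by_cases h2 : ν = μ + 1
      · simp only [h2, if_true, if_neg (show ¬μ = μ + 1 by omega), neg_neg]
        split_ifs <;> ring
      · simp only [h1, h2, if_false]; ring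
    · simp [lowerShift', h]
  simp only [e, Finset.sum_ite_eq, Finset.mem_Icc]
  by_cases h1 : μ = ν
  · subst h1
    have hexp : G (k + N - N / 2) N true =
        Complex.I * ℏ / (u - v - (k + N / 2) * Complex.I * ℏ) * matrixElement z
        (lamRatio N k ℏ μ (sh ℏ (sh ℏ v (k + N / 2)) (-k / 2)) (-(k + N) / 4)) := by
      simp only [hG, currentTerm]
      rw [add_add_add_comm, lower'_screen_add_eq_zero, add_zero, lamRatio, ← ratioExp,
        ← rootPlus_add_ratioExp hℏ hk]
      congr 2
      · ring
      · congr 4; ring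
    -- The pole of `(m + 1, false)` is at `k + (m + 1) - 1 - N/2`, that of `(m, true)`.
    have hsum := sum_telescope (X := fun m => G (k + m - N / 2) m true)
      (Y := fun m => G (k + m - 1 - N / 2) m false) (a := μ + 1) (n := N) (by omega)
      fun m h1 h2 => by
        have := hGeq _ _ _ _ _ (lower'_screen_add_eq₁ (k := k) (μ := μ) hℏ h2 v)
        rw [this]
        congr 1
        push_cast
        ring
    have hℏ' : (ℏ : ℂ) ≠ 0 := by exact_mod_cast hℏ
    simp only [if_true]
    rw [Finset.sum_congr rfl fun m hm => if_pos (Finset.mem_Icc.1 hm), ← Finset.mul_sum, hsum, hexp,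
      div_mul_eq_div_div,
      show Complex.I / (ℏ : ℂ) = 1 / ℏ ^ 2 * (Complex.I * ℏ) by field_simp]
    ring
  rw [if_neg h1]
  refine (Finset.sum_eq_zero fun m hm => ?_).symm
  by_cases h2 : ν = μ + 1
  · subst h2
    rw [if_neg (show ¬μ = μ + 1 by omega), if_pos rfl]
    split_ifs with h3 h4
    · omega
    · rw [hGeq _ _ _ _ _ (lower'_screen_add_eq₂ hℏ v)]
      ring
    · rfl
  · simp [h1, h2]

/-- The surviving poles `v - (N/2) iℏ` and `v + (k + N/2) iℏ` are the points at which `hDiff`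
evaluates, and `(1/(iℏ)) · (-1/(u - w)) = i / (ℏ (u - w))` matches the residues. -/
theorem ope_currentF (hℏ : ℏ ≠ 0) (hk : (k + N).re ≠ 0) {μ ν : ℕ} (hμN : μ < N)
    (hμ : 1 ≤ μ) (hν : 1 ≤ ν) (hνN : ν < N) :
    OPE N k ℏ (currentF N k ℏ μ) (screening N k ℏ ν)
      (fun u v z => if μ = ν then
        hDiff k ℏ N (fun w => -1 / (u - w) *
          matrixElement z (lamRatio N k ℏ μ (sh ℏ w (-k / 2)) (-(k + N) / 4))) v
        else 0) := by
  rw [ope_iff_expansion, funext (currentF_eq_sum μ)]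
  convert (expansion_lower hℏ hk hμN hμ hν hνN).add_left
    (expansion_lower' hℏ hk hμN hμ hν hνN) using 4 with u v z
  split_ifs
  · rw [hDiff]
    generalize matrixElement z _ = X
    generalize matrixElement z _ = Y
    have e1 : u - sh ℏ v (-N / 2) = u - v + N / 2 * Complex.I * ℏ := by rw [sh]; ring
    have e2 : u - sh ℏ v (k + N / 2) = u - v - (k + N / 2) * Complex.I * ℏ := by rw [sh]; ring
    rw [e1, e2]
    simp only [div_eq_mul_inv, mul_inv, Complex.inv_I]
    ring
  · ring

end YangianFreeField

theorem mainTheorem4 (N : ℕ) (k : ℂ) (ℏ : ℝ) (hℏ : ℏ ≠ 0) (hk : (k + N).re ≠ 0) (μ ν : ℕ)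
    (hμ : 1 ≤ μ) (hμN : μ < N) (hν : 1 ≤ ν) (hνN : ν < N) :
    YangianFreeField.OPE N k ℏ (YangianFreeField.currentHPlus N k ℏ μ)
        (YangianFreeField.screening N k ℏ ν) (fun _ _ _ => 0) ∧
    YangianFreeField.OPE N k ℏ (YangianFreeField.currentHMinus N k ℏ μ)
        (YangianFreeField.screening N k ℏ ν) (fun _ _ _ => 0) ∧
    YangianFreeField.OPE N k ℏ (YangianFreeField.currentE ℏ μ)
        (YangianFreeField.screening N k ℏ ν) (fun _ _ _ => 0) ∧
    (∃ R : ℂ → ℂ → YangianFreeField.CoherentLabel N ℏ → ℂ, YangianFreeField.IsRegular R ∧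
      YangianFreeField.ContinuesTo N k ℏ (YangianFreeField.screeningTilde N ℏ μ)
        (YangianFreeField.screeningTilde N ℏ ν)
        (fun u v z => R u v z / (u - v - Complex.I * YangianFreeField.halfCartan μ ν * ℏ)) ∧
      YangianFreeField.ContinuesTo N k ℏ (YangianFreeField.screeningTilde N ℏ ν)
        (YangianFreeField.screeningTilde N ℏ μ)
        (fun v u z => R u v z / (u - v + Complex.I * YangianFreeField.halfCartan μ ν * ℏ))) ∧
    YangianFreeField.OPE N k ℏ (YangianFreeField.currentF N k ℏ μ)
      (YangianFreeField.screening N k ℏ ν)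
      (fun u v z =>
        if μ = ν then
          YangianFreeField.hDiff k ℏ N
            (fun w => -1 / (u - w) * YangianFreeField.matrixElement z
              (YangianFreeField.lamRatio N k ℏ μ (YangianFreeField.sh ℏ w (-k / 2))
                (-(k + N) / 4))) v
        else 0) := by
  refine ⟨YangianFreeField.ope_currentHPlus hℏ hk hμ hμN hν hνN,
    YangianFreeField.ope_currentHMinus hℏ hk hμ hμN hν hνN,
    YangianFreeField.ope_currentE hℏ hk hμN hν, ?_,
    YangianFreeField.ope_currentF hℏ hk hμN hμ hν hνN⟩
  simpa only [YangianFreeField.Expansion, add_zero, mul_one_div] using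
    YangianFreeField.expansion_screeningTilde (N := N) (k := k) hℏ hμ hν
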